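/- Let $d\in\mathbf N$ and let $s,t>0$ satisfy $s+t>1$. The Gelfand--Shilov space $\Sigma_t^s(\mathbf R^d)$ consists of all $f\in C^\infty(\mathbf R^d)$ such that $$\|f\|_{h}=\sup_{\alpha,\beta\in\mathbf N^d,\ x\in\mathbf R^d}\frac{|x^\alpha \partial^\beta f(x)|}{h^{|\alpha+\beta|}\,\alpha!^t\,\beta!^s}<\infty\qquad\text{for every } h>0,$$ with the Fréchet topology defined by the seminorms $\|\cdot\|_h$, $h>0$. Its topological dual $(\Sigma_t^s)'(\mathbf R^d)$ (Gelfand--Shilov ultradistributions) carries the weak$^*$ topology and contains $\Sigma_t^s(\mathbf R^d)$ through $f\mapsto\int f(x)\,\cdot\,(x)\,dx$. We write $(u,\varphi)=u(\overline\varphi)$ for $u\in(\Sigma_t^s)'(\mathbf R^d)$ and $\varphi\in\Sigma_t^s(\mathbf R^d)$. For $\psi\in\Sigma_t^s(\mathbf R^d)\setminus\{0\}$ and $u\in(\Sigma_t^s)'(\mathbf R^d)$ let $$V_\psi u(x,\xi)=(2\pi)^{-d/2}\,(u,\,e^{i\langle\cdot,\xi\rangle}\psi(\cdot-x)),\qquad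 x,\xi\in\mathbf R^d .$$ The anisotropic wave front set $\mathrm{WF}^{t,s}(u)\subseteq\mathbf R^{2d}\setminus\{0\}$, computed with the window $\psi$, is defined as follows: $z_0\in\mathbf R^{2d}\setminus\{0\}$ does not belong to it if and only if there is an open set $U\subseteq\mathbf R^{2d}\setminus\{0\}$ containing $z_0$ such that $$\sup_{\lambda>0,\ (x,\xi)\in U}e^{r\lambda}\,|V_\psi u(\lambda^t x,\lambda^s\xi)|<\infty\qquad\text{for all } r>0 .$$ Let $a\in\Gamma_{t,s}^{s,t;0}(\mathbf R^{2d})$, that is, $a\in C^\infty(\mathbf R^{2d})$ and there is $\mu>0$ such that for every $h>0$ there is $C>0$ with $$|\partial_x^\alpha\partial_\xi^\beta a(x,\xi)|\le C\,h^{|\alpha+\beta|}\,\alpha!^s\,\beta!^t\,e^{\mu(|x|^{1/t}+|\xi|^{1/s})},\qquad \alpha,\beta\in\mathbf N^d,\ x,\xi\in\mathbf R^d .$$ For $f,g\in\Sigma_t^s(\mathbf R^d)$ the Weyl operator $a^w(x,D)$ is given by $$(a^w(x,D)f,g)=(2\pi)^{-d}\int_{\mathbf R^{2d}}a(x,\xi)\,\overline{W(g,f)(x,\xi)}\,dx\,d\xi,\qquad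 W(g,f)(x,\xi)=\int_{\mathbf R^d}g(x+\tfrac y2)\,\overline{f(x-\tfrac y2)}\,e^{-i\langle y,\xi\rangle}\,dy .$$ **Theorem.** There is exactly one continuous linear operator $a^w(x,D)$ on $(\Sigma_t^s)'(\mathbf R^d)$ that satisfies this identity for all $f,g\in\Sigma_t^s(\mathbf R^d)$, and it is microlocal for the anisotropic wave front set: $$\mathrm{WF}^{t,s}(a^w(x,D)u)\subseteq\mathrm{WF}^{t,s}(u)\qquad\text{for every } u\in(\Sigma_t^s)'(\mathbf R^d),$$ where each of the two wave front sets may be computed with an arbitrary window in $\Sigma_t^s(\mathbf R^d)\setminus\{0\}$. -/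

import Mathlib

open scoped ContDiff

noncomputable section

namespace GelfandShilov

/-- The Euclidean space `ℝ^d`. -/
abbrev Rn (d : ℕ) : Type := EuclideanSpace ℝ (Fin d)

section MultiIndex

variable {d : ℕ}

/-- The length `|α| = α₁ + ⋯ + α_d` of a multi-index. -/
def msize (α : Fin d → ℕ) : ℕ := ∑ i, α i

/-- The factorial `α! = α₁! ⋯ α_d!` of a multi-index, as a real number. -/
def mfact (α : Fin d → ℕ) : ℝ := ∏ i, ((α i).factorial : ℝ)

/-- The monomial `x^α`. -/
def mpow (x : Rn d) (α : Fin d → ℕ) : ℝ := ∏ i, x i ^ α i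

/-- The directional derivative of `f` in direction `v`. -/
def dirDeriv {V : Type*} [NormedAddCommGroup V] [NormedSpace ℝ V] (v : V) (f : V → ℂ) : V → ℂ :=
  fun x => fderiv ℝ f x v

/-- The iterated directional derivative `∂_{v₁}^{β₁} ⋯ ∂_{v_d}^{β_d} f`. It is only used for smooth
`f`, where the order of the derivatives does not matter. -/
def multiDeriv {V : Type*} [NormedAddCommGroup V] [NormedSpace ℝ V]
    (v : Fin d → V) (β : Fin d → ℕ) (f : V → ℂ) : V → ℂ :=
  (List.finRange d).foldr (fun i g => (dirDeriv (v i))^[β i] g) f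

/-- The standard basis vector `e_i` of `ℝ^d`. -/
def stdVec (i : Fin d) : Rn d := EuclideanSpace.single i (1 : ℝ)

/-- The partial derivative `∂^β f` of a function on `ℝ^d`. -/
def partialDeriv (β : Fin d → ℕ) (f : Rn d → ℂ) : Rn d → ℂ := multiDeriv stdVec β f

/-- The partial derivative `∂_x^α ∂_ξ^β a` of a function `a (x, ξ)` on `ℝ^d × ℝ^d`. -/
def partialDeriv₂ (α β : Fin d → ℕ) (a : Rn d × Rn d → ℂ) : Rn d × Rn d → ℂ :=
  multiDeriv (fun i => (stdVec i, 0)) α (multiDeriv (fun i => (0, stdVec i)) β a)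

/-- The quantity `|x^α D^β f(x)| / (h^{|α+β|} α!^t β!^s)`, whose supremum over `α`, `β`, `x` is the
norm of `𝒮_{t,h}^s(ℝ^d)`. (The factor `(-i)^{|β|}` in `D^β = (-i)^{|β|} ∂^β` has modulus one.) -/
def gsQuot (t s h : ℝ) (f : Rn d → ℂ) (p : (Fin d → ℕ) × (Fin d → ℕ) × Rn d) : ℝ :=
  ‖(mpow p.2.2 p.1 : ℂ) * partialDeriv p.2.1 f p.2.2‖ /
    (h ^ (msize p.1 + msize p.2.1) * mfact p.1 ^ t * mfact p.2.1 ^ s)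

/-- `f` belongs to the Beurling type Gelfand--Shilov space `Σ_t^s(ℝ^d) = ⋂_{h>0} 𝒮_{t,h}^s(ℝ^d)`. -/
def IsGelfandShilov (t s : ℝ) (f : Rn d → ℂ) : Prop :=
  ContDiff ℝ ∞ f ∧ ∀ h : ℝ, 0 < h → BddAbove (Set.range (gsQuot t s h f))

end MultiIndex

/-! ### Elementary facts needed to set up the spaces -/

section Aux

variable {d : ℕ} {V : Type*} [NormedAddCommGroup V] [NormedSpace ℝ V]

theorem mfact_pos (α : Fin d → ℕ) : 0 < mfact α :=
  Finset.prod_pos fun i _ => by exact_mod_cast Nat.factorial_pos _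

theorem weight_pos {t s h : ℝ} (hh : 0 < h) (α β : Fin d → ℕ) :
    0 < h ^ (msize α + msize β) * mfact α ^ t * mfact β ^ s := by
  have := Real.rpow_pos_of_pos (mfact_pos α) t
  have := Real.rpow_pos_of_pos (mfact_pos β) s
  positivity

theorem weight_split (h s : ℝ) (β : Fin d → ℕ) :
    h ^ msize β * mfact β ^ s = ∏ i, (h ^ β i * ((β i).factorial : ℝ) ^ s) := by
  rw [Finset.prod_mul_distrib, msize, mfact, Finset.prod_pow_eq_pow_sum,
    Real.finsetProd_rpow _ _ (fun i _ => by positivity)]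

theorem isGelfandShilov_iff {t s : ℝ} {f : Rn d → ℂ} :
    IsGelfandShilov t s f ↔ ContDiff ℝ ∞ f ∧ ∀ h : ℝ, 0 < h → ∃ C : ℝ, ∀ α β x,
      ‖(mpow x α : ℂ) * partialDeriv β f x‖ ≤
        C * (h ^ (msize α + msize β) * mfact α ^ t * mfact β ^ s) := by
  refine and_congr_right fun _ => forall₂_congr fun h hh => exists_congr fun C => ?_
  constructor
  · intro H α β x
    have := H ⟨(α, β, x), rfl⟩
    rwa [gsQuot, div_le_iff₀ (weight_pos hh α β)] at this
  · rintro H _ ⟨⟨α, β, x⟩, rfl⟩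
    rw [gsQuot, div_le_iff₀ (weight_pos hh α β)]
    exact H α β x

/-- The space of smooth functions, on which the derivatives are linear and commute. -/
def smoothSub (V : Type*) [NormedAddCommGroup V] [NormedSpace ℝ V] : Submodule ℂ (V → ℂ) where
  carrier := {f | ContDiff ℝ ∞ f}
  add_mem' {f g} (hf : ContDiff ℝ ∞ f) (hg : ContDiff ℝ ∞ g) := ContDiff.add hf hg
  zero_mem' := show ContDiff ℝ ∞ (fun _ => (0 : ℂ)) from contDiff_const
  smul_mem' c f (hf : ContDiff ℝ ∞ f) :=
    show ContDiff ℝ ∞ (fun x => c * f x) from contDiff_const.mul hf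

theorem contDiff_dirDeriv (v : V) {f : V → ℂ} (hf : ContDiff ℝ ∞ f) :
    ContDiff ℝ ∞ (dirDeriv v f) :=
  (hf.fderiv_right (m := ∞) (by simp)).clm_apply contDiff_const

theorem smooth_differentiable {f : V → ℂ} (hf : ContDiff ℝ ∞ f) : Differentiable ℝ f :=
  hf.differentiable (by simp)

/-- The directional derivative as a linear endomorphism of the space of smooth functions. -/
def dirDerivL (v : V) : Module.End ℂ (smoothSub V) where
  toFun f := ⟨dirDeriv v f.1, contDiff_dirDeriv v f.2⟩
  map_add' f g := by
    ext x
    have hf := smooth_differentiable f.2 x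
    have hg := smooth_differentiable g.2 x
    simp [dirDeriv, fderiv_add hf hg]
  map_smul' c f := by
    ext x
    have hf := smooth_differentiable f.2 x
    simp [dirDeriv, fderiv_const_smul hf]

theorem dirDerivL_commute (v w : V) : Commute (dirDerivL v) (dirDerivL w) := by
  have key : ∀ (v w : V) (f : V → ℂ) (_ : ContDiff ℝ ∞ f) (x : V),
      dirDeriv v (dirDeriv w f) x = fderiv ℝ (fderiv ℝ f) x v w := by
    intro v w f hf x
    have hd : DifferentiableAt ℝ (fderiv ℝ f) x :=
      (hf.fderiv_right (m := ∞) (by simp)).differentiable (by simp) x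
    have : dirDeriv w f = fun y => fderiv ℝ f y w := rfl
    rw [this, dirDeriv, fderiv_clm_apply hd (differentiableAt_const w)]
    simp
  refine LinearMap.ext fun f => Subtype.ext (funext fun x => ?_)
  change dirDeriv v (dirDeriv w f.1) x = dirDeriv w (dirDeriv v f.1) x
  rw [key v w f.1 f.2 x, key w v f.1 f.2 x]
  have hf : ContDiff ℝ ∞ f.1 := f.2
  have := (hf.contDiffAt (x := x)).isSymmSndFDerivAt
    (by simp only [minSmoothness_of_isRCLikeNormedField]; exact WithTop.coe_le_coe.2 (le_top : (2 : ℕ∞) ≤ ⊤))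
  exact this v w

theorem dirDerivL_pow (v : V) (k : ℕ) (f : smoothSub V) :
    ((dirDerivL v ^ k) f).1 = (dirDeriv v)^[k] f.1 := by
  induction k with
  | zero => rfl
  | succ k ih =>
    rw [pow_succ', Function.iterate_succ_apply', ← ih]
    rfl

theorem foldr_dirDeriv (v : Fin d → V) (β : Fin d → ℕ) (l : List (Fin d)) (f : smoothSub V) :
    l.foldr (fun i g => (dirDeriv (v i))^[β i] g) f.1 =
      ((l.map fun i => dirDerivL (v i) ^ β i).prod f).1 := by
  induction l with
  | nil => rfl
  | cons i l ih =>
    rw [List.foldr_cons, ih, ← dirDerivL_pow]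
    rfl

theorem multiDeriv_eq (v : Fin d → V) (β : Fin d → ℕ) (f : smoothSub V) :
    multiDeriv v β f.1 = (((List.finRange d).map fun i => dirDerivL (v i) ^ β i).prod f).1 :=
  foldr_dirDeriv v β _ f

theorem contDiff_multiDeriv (v : Fin d → V) (β : Fin d → ℕ) {f : V → ℂ} (hf : ContDiff ℝ ∞ f) :
    ContDiff ℝ ∞ (multiDeriv v β f) := by
  have := multiDeriv_eq v β ⟨f, hf⟩
  simp only at this
  rw [this]
  exact Subtype.property _

theorem multiDeriv_add (v : Fin d → V) (β : Fin d → ℕ) {f g : V → ℂ} (hf : ContDiff ℝ ∞ f)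
    (hg : ContDiff ℝ ∞ g) : multiDeriv v β (f + g) = multiDeriv v β f + multiDeriv v β g := by
  have h1 := multiDeriv_eq v β ⟨f, hf⟩
  have h2 := multiDeriv_eq v β ⟨g, hg⟩
  have h3 := multiDeriv_eq v β (⟨f, hf⟩ + ⟨g, hg⟩)
  rw [map_add] at h3
  simp only [Submodule.coe_add] at h1 h2 h3
  rw [h1, h2, h3]

theorem multiDeriv_smul (v : Fin d → V) (β : Fin d → ℕ) (c : ℂ) {f : V → ℂ}
    (hf : ContDiff ℝ ∞ f) : multiDeriv v β (c • f) = c • multiDeriv v β f := by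
  have h1 := multiDeriv_eq v β ⟨f, hf⟩
  have h3 := multiDeriv_eq v β (c • ⟨f, hf⟩)
  rw [map_smul] at h3
  simp only [Submodule.coe_smul] at h1 h3
  rw [h1, h3]

/-- An operator that commutes with all `∂_{v_i}` on smooth functions and preserves smoothness
commutes with the iterated derivatives. -/
theorem multiDeriv_comm (v : Fin d → V) (β : Fin d → ℕ) (T : (V → ℂ) → (V → ℂ))
    (hT : ∀ i f, ContDiff ℝ ∞ f → dirDeriv (v i) (T f) = T (dirDeriv (v i) f))
    {f : V → ℂ} (hf : ContDiff ℝ ∞ f) : multiDeriv v β (T f) = T (multiDeriv v β f) := by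
  have it : ∀ (i : Fin d) (k : ℕ) (g : V → ℂ), ContDiff ℝ ∞ g →
      ContDiff ℝ ∞ ((dirDeriv (v i))^[k] g) ∧
      (dirDeriv (v i))^[k] (T g) = T ((dirDeriv (v i))^[k] g) := by
    intro i k g hg
    induction k with
    | zero => exact ⟨hg, rfl⟩
    | succ k ih =>
      simp only [Function.iterate_succ_apply']
      exact ⟨contDiff_dirDeriv _ ih.1, by rw [ih.2, hT i _ ih.1]⟩
  have main : ∀ l : List (Fin d),
      ContDiff ℝ ∞ (l.foldr (fun i g => (dirDeriv (v i))^[β i] g) f) ∧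
      l.foldr (fun i g => (dirDeriv (v i))^[β i] g) (T f) =
        T (l.foldr (fun i g => (dirDeriv (v i))^[β i] g) f) := by
    intro l
    induction l with
    | nil => exact ⟨hf, rfl⟩
    | cons i l ih =>
      simp only [List.foldr_cons]
      exact ⟨(it i _ _ ih.1).1, by rw [ih.2, (it i _ _ ih.1).2]⟩
  exact (main _).2

/-- A geometric sequence is dominated by `h^k k!^s` for every `h > 0`. -/
theorem exists_pow_le {s h : ℝ} (hs : 0 < s) (hh : 0 < h) (c : ℝ) :
    ∃ M : ℝ, 1 ≤ M ∧ ∀ k : ℕ, |c| ^ k ≤ M * (h ^ k * (k.factorial : ℝ) ^ s) := by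
  set b : ℝ := (|c| / h) ^ (1 / s) with hb
  have hb0 : 0 ≤ b := by positivity
  refine ⟨Real.exp b ^ s, Real.one_le_rpow (Real.one_le_exp hb0) hs.le, fun k => ?_⟩
  have h1 : b ^ k ≤ Real.exp b * (k.factorial : ℝ) := by
    have := Real.pow_div_factorial_le_exp b hb0 k
    rwa [div_le_iff₀ (by positivity)] at this
  have h2 : (b ^ k) ^ s = (|c| / h) ^ k := by
    rw [hb, ← Real.rpow_natCast, ← Real.rpow_mul (by positivity), ← Real.rpow_mul (by positivity),
      ← Real.rpow_natCast]
    congr 1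
    field_simp
  have h3 : (|c| / h) ^ k ≤ Real.exp b ^ s * (k.factorial : ℝ) ^ s := by
    rw [← h2, ← Real.mul_rpow (by positivity) (by positivity)]
    exact Real.rpow_le_rpow (by positivity) h1 hs.le
  rw [div_pow, div_le_iff₀ (by positivity)] at h3
  linarith

theorem prod_bound {s B M : ℝ} (hs : 0 < s) (hB : 0 < B) (hM1 : 1 ≤ M) (v : Fin d → V)
    (c : Fin d → ℂ) (hM : ∀ i k, ‖c i‖ ^ k ≤ M * (B ^ k * (k.factorial : ℝ) ^ s))
    (β : Fin d → ℕ) (x : V) : ∀ (l : List (Fin d)), l.Nodup → ∀ (f : smoothSub V) (K : ℝ), 0 ≤ K →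
    (∀ γ : Fin d → ℕ, ‖((l.map fun i => dirDerivL (v i) ^ γ i).prod f).1 x‖ ≤
      K * (l.map fun i => B ^ γ i * ((γ i).factorial : ℝ) ^ s).prod) →
    ‖((l.map fun i => (dirDerivL (v i) + algebraMap ℂ _ (c i)) ^ β i).prod f).1 x‖ ≤
      K * (l.map fun i => M * ((2 * B) ^ β i * ((β i).factorial : ℝ) ^ s)).prod := by
  intro l
  induction l with
  | nil =>
    intro _ f K _ H
    simpa using H 0
  | cons i l ih =>
    intro hl f K hK H
    obtain ⟨hil, hl'⟩ := List.nodup_cons.mp hl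
    set D : Fin d → Module.End ℂ (smoothSub V) := fun i => dirDerivL (v i) with hD
    set P : Module.End ℂ (smoothSub V) := (l.map fun i => (D i + algebraMap ℂ _ (c i)) ^ β i).prod
      with hP
    set R : ℝ := (l.map fun i => M * ((2 * B) ^ β i * ((β i).factorial : ℝ) ^ s)).prod with hR
    have hR0 : 0 ≤ R := by
      apply List.prod_nonneg
      intro a ha
      obtain ⟨j, _, rfl⟩ := List.mem_map.mp ha
      positivity
    have hcomm : ∀ (γ : Fin d → ℕ) (j : ℕ),
        Commute ((l.map fun i => D i ^ γ i).prod) (D i ^ j) := by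
      intro γ j
      apply Commute.symm
      apply Commute.list_prod_right
      intro a ha
      obtain ⟨m, _, rfl⟩ := List.mem_map.mp ha
      exact (dirDerivL_commute _ _).pow_pow _ _
    have hcP : Commute P ((D i + algebraMap ℂ _ (c i)) ^ β i) := by
      apply Commute.symm
      apply Commute.list_prod_right
      intro a ha
      obtain ⟨m, _, rfl⟩ := List.mem_map.mp ha
      refine Commute.pow_pow ?_ _ _
      exact ((dirDerivL_commute _ _).add_right (Algebra.commutes _ _).symm).add_left
        (Algebra.commutes _ _)
    -- the estimate for the inner part
    have hin : ∀ j : ℕ, ‖(P ((D i ^ j) f)).1 x‖ ≤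
        K * (B ^ j * (j.factorial : ℝ) ^ s) * R := by
      intro j
      refine ih hl' ((D i ^ j) f) _ (by positivity) fun γ => ?_
      have h := H (Function.update γ i j)
      have e1 : (l.map fun m => D m ^ (Function.update γ i j) m) = l.map fun m => D m ^ γ m := by
        refine List.map_congr_left fun m hm => ?_
        rw [Function.update_of_ne (by rintro rfl; exact hil hm)]
      have e2 : (l.map fun m => B ^ (Function.update γ i j) m *
          (((Function.update γ i j) m).factorial : ℝ) ^ s) =
          l.map fun m => B ^ γ m * ((γ m).factorial : ℝ) ^ s := by
        refine List.map_congr_left fun m hm => ?_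
        rw [Function.update_of_ne (by rintro rfl; exact hil hm)]
      rw [List.map_cons, List.map_cons, List.prod_cons, List.prod_cons, e2] at h
      change ‖((D i ^ _ * (l.map fun m => D m ^ (Function.update γ i j) m).prod) f).1 x‖ ≤ _ at h
      rw [e1, Function.update_self, ← (hcomm γ j).eq] at h
      rw [mul_assoc]
      exact h
    have hexp : ((((i :: l).map fun i => (D i + algebraMap ℂ _ (c i)) ^ β i).prod) f).1 x =
        ∑ j ∈ Finset.range (β i + 1), (c i ^ (β i - j) * ((β i).choose j : ℂ)) *
          (P ((D i ^ j) f)).1 x := by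
      rw [List.map_cons, List.prod_cons, ← hP, ← hcP.eq,
        (Algebra.commute_algebraMap_right (c i) (D i)).add_pow, Finset.mul_sum, LinearMap.sum_apply]
      rw [Submodule.coe_sum, Finset.sum_apply]
      refine Finset.sum_congr rfl fun j _ => ?_
      have : (D i ^ j * algebraMap ℂ (Module.End ℂ (smoothSub V)) (c i) ^ (β i - j) *
          ((β i).choose j : Module.End ℂ (smoothSub V))) =
          (c i ^ (β i - j) * ((β i).choose j : ℂ)) • D i ^ j := by
        rw [← map_pow, ← map_natCast (algebraMap ℂ (Module.End ℂ (smoothSub V))), mul_assoc,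
          ← map_mul, ← Algebra.commutes, ← Algebra.smul_def]
      rw [this, mul_smul_comm]
      rfl
    change ‖((((i :: l).map fun i => (D i + algebraMap ℂ _ (c i)) ^ β i).prod) f).1 x‖ ≤ _
    rw [hexp, List.map_cons, List.prod_cons, ← hR]
    refine (norm_sum_le _ _).trans ?_
    have hterm : ∀ j ∈ Finset.range (β i + 1),
        ‖(c i ^ (β i - j) * ((β i).choose j : ℂ)) * (P ((D i ^ j) f)).1 x‖ ≤
        K * R * M * B ^ β i * ((β i).factorial : ℝ) ^ s * ((β i).choose j : ℝ) := by
      intro j hj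
      have hjk : j ≤ β i := Nat.lt_succ_iff.mp (Finset.mem_range.mp hj)
      rw [norm_mul, norm_mul, norm_pow, Complex.norm_natCast]
      have hfac : ((β i - j).factorial : ℝ) ^ s * (j.factorial : ℝ) ^ s ≤
          ((β i).factorial : ℝ) ^ s := by
        rw [← Real.mul_rpow (by positivity) (by positivity)]
        refine Real.rpow_le_rpow (by positivity) ?_ hs.le
        have := Nat.le_of_dvd (Nat.factorial_pos _) (Nat.factorial_mul_factorial_dvd_factorial hjk)
        rw [mul_comm]
        exact_mod_cast this
      calc ‖c i‖ ^ (β i - j) * ((β i).choose j : ℝ) * ‖(P ((D i ^ j) f)).1 x‖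
          ≤ (M * (B ^ (β i - j) * ((β i - j).factorial : ℝ) ^ s)) * ((β i).choose j : ℝ) *
            (K * (B ^ j * (j.factorial : ℝ) ^ s) * R) := by
            gcongr
            · exact hM i _
            · exact hin j
        _ = K * R * M * (B ^ (β i - j) * B ^ j) *
            (((β i - j).factorial : ℝ) ^ s * (j.factorial : ℝ) ^ s) * ((β i).choose j : ℝ) := by
            ring
        _ ≤ K * R * M * B ^ β i * ((β i).factorial : ℝ) ^ s * ((β i).choose j : ℝ) := by
            rw [← pow_add, Nat.sub_add_cancel hjk]
            gcongr
    refine (Finset.sum_le_sum hterm).trans (le_of_eq ?_)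
    rw [← Finset.mul_sum]
    have := Nat.sum_range_choose (β i)
    have h2 : ∑ j ∈ Finset.range (β i + 1), ((β i).choose j : ℝ) = 2 ^ β i := by
      exact_mod_cast this
    rw [h2, mul_pow]
    ring

/-- The function `y ↦ e^{i ⟨y, ξ⟩}`. -/
def planeWave (ξ y : Rn d) : ℂ := Complex.exp (Complex.I * ((inner ℝ y ξ : ℝ) : ℂ))

theorem contDiff_planeWave (ξ : Rn d) : ContDiff ℝ ∞ (planeWave ξ) := by
  unfold planeWave
  exact (contDiff_const.mul
    (Complex.ofRealCLM.contDiff.comp (contDiff_id.inner ℝ contDiff_const))).cexp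

theorem norm_planeWave (ξ y : Rn d) : ‖planeWave ξ y‖ = 1 := by
  rw [planeWave, mul_comm, Complex.norm_exp_ofReal_mul_I]

theorem dirDeriv_planeWave_mul (ξ : Rn d) (i : Fin d) {f : Rn d → ℂ} (hf : ContDiff ℝ ∞ f) :
    dirDeriv (stdVec i) (fun y => planeWave ξ y * f y) =
      fun y => planeWave ξ y * (dirDeriv (stdVec i) f y + Complex.I * (ξ i : ℂ) * f y) := by
  funext y
  have h1 : HasFDerivAt (fun y : Rn d => (inner ℝ y ξ : ℝ)) (innerSL ℝ ξ) y := by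
    have := (innerSL ℝ ξ).hasFDerivAt (x := y)
    refine this.congr_of_eventuallyEq (Filter.Eventually.of_forall fun z => ?_)
    simp [real_inner_comm]
  have h2 : HasFDerivAt (planeWave ξ)
      (planeWave ξ y • (Complex.I • (Complex.ofRealCLM.comp (innerSL ℝ ξ)))) y :=
    ((Complex.ofRealCLM.hasFDerivAt.comp y h1).const_mul Complex.I).cexp
  have h3 := h2.mul (smooth_differentiable hf y).hasFDerivAt
  have h4 : dirDeriv (stdVec i) (fun y => planeWave ξ y * f y) y = _ :=
    congrArg (fun L => L (stdVec i)) h3.fderiv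
  rw [h4]
  simp [dirDeriv, stdVec, EuclideanSpace.inner_single_right]
  ring

theorem multiDeriv_planeWave_mul (ξ : Rn d) (β : Fin d → ℕ) (f : smoothSub (Rn d)) :
    partialDeriv β (fun y => planeWave ξ y * f.1 y) = fun y => planeWave ξ y *
      (((List.finRange d).map fun i => (dirDerivL (stdVec i) +
        algebraMap ℂ _ (Complex.I * (ξ i : ℂ))) ^ β i).prod f).1 y := by
  have it : ∀ (i : Fin d) (k : ℕ) (g : smoothSub (Rn d)),
      (dirDeriv (stdVec i))^[k] (fun y => planeWave ξ y * g.1 y) = fun y => planeWave ξ y *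
        (((dirDerivL (stdVec i) + algebraMap ℂ _ (Complex.I * (ξ i : ℂ))) ^ k) g).1 y := by
    intro i k g
    induction k with
    | zero => rfl
    | succ k ih =>
      rw [Function.iterate_succ_apply', ih, pow_succ']
      exact dirDeriv_planeWave_mul ξ i (Subtype.property _)
  have main : ∀ l : List (Fin d),
      l.foldr (fun i g => (dirDeriv (stdVec i))^[β i] g) (fun y => planeWave ξ y * f.1 y) =
      fun y => planeWave ξ y * ((l.map fun i => (dirDerivL (stdVec i) +
        algebraMap ℂ _ (Complex.I * (ξ i : ℂ))) ^ β i).prod f).1 y := by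
    intro l
    induction l with
    | nil => rfl
    | cons i l ih =>
      rw [List.foldr_cons, ih, it]
      rfl
  exact main _

theorem pow_le_pow_of_half {h : ℝ} (hh : 0 < h) (m n : ℕ) :
    2 ^ m * (h / 2) ^ (m + n) ≤ h ^ (m + n) := by
  rw [pow_add, div_pow, div_pow, pow_add]
  have h1 : (1 : ℝ) ≤ 2 ^ n := one_le_pow₀ (by norm_num)
  have : (2 : ℝ) ^ m * (h ^ m / 2 ^ m * (h ^ n / 2 ^ n)) = h ^ m * (h ^ n / 2 ^ n) := by
    field_simp
  rw [this]
  gcongr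
  exact div_le_self (by positivity) h1

variable {t s : ℝ}

theorem IsGelfandShilov.modulate (hs : 0 < s) {f : Rn d → ℂ} (hf : IsGelfandShilov t s f)
    (ξ : Rn d) : IsGelfandShilov t s (fun y => planeWave ξ y * f y) := by
  rw [isGelfandShilov_iff] at hf ⊢
  obtain ⟨hsm, hbd⟩ := hf
  refine ⟨(contDiff_planeWave ξ).mul hsm, fun h hh => ?_⟩
  obtain ⟨C, hC⟩ := hbd (h / 2) (by positivity)
  have hC0 : 0 ≤ C := by
    have := (norm_nonneg _).trans (hC 0 0 0)
    exact nonneg_of_mul_nonneg_left this (weight_pos (by positivity) _ _)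
  choose M₀ hM₀ hM₀' using fun i => exists_pow_le hs (half_pos hh) (ξ i)
  set M : ℝ := 1 + ∑ i, M₀ i with hMdef
  have hMi : ∀ i, M₀ i ≤ M := fun i => by
    have := Finset.single_le_sum (f := M₀) (fun j _ => by linarith [hM₀ j]) (Finset.mem_univ i)
    linarith
  have hM1 : 1 ≤ M := by
    have := Finset.sum_nonneg (s := Finset.univ) (f := M₀) (fun j _ => by linarith [hM₀ j])
    linarith
  refine ⟨C * M ^ d, fun α β x => ?_⟩
  have key := prod_bound hs (half_pos hh) hM1 stdVec (fun i => Complex.I * (ξ i : ℂ))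
    (fun i k => by
      have : ‖Complex.I * (ξ i : ℂ)‖ = |ξ i| := by simp
      rw [this]
      refine (hM₀' i k).trans ?_
      gcongr
      exact hMi i) β x (List.finRange d) (List.nodup_finRange d)
    ((mpow x α : ℂ) • ⟨f, hsm⟩) (C * ((h / 2) ^ msize α * mfact α ^ t)) (by
      have := Real.rpow_pos_of_pos (mfact_pos α) t
      positivity) (fun γ => by
        rw [map_smul]
        have := hC α γ x
        have e := multiDeriv_eq stdVec γ ⟨f, hsm⟩
        rw [partialDeriv, e] at this
        refine this.trans (le_of_eq ?_)
        rw [← List.ofFn_eq_map, List.prod_ofFn, ← weight_split, pow_add]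
        ring)
  rw [multiDeriv_planeWave_mul ξ β ⟨f, hsm⟩]
  simp only [norm_mul, norm_planeWave, one_mul]
  rw [← norm_mul]
  rw [map_smul] at key
  refine key.trans ?_
  rw [← List.ofFn_eq_map, List.prod_ofFn, Finset.prod_mul_distrib, ← weight_split]
  simp only [Finset.prod_const, Finset.card_univ, Fintype.card_fin]
  have e : (2 : ℝ) * (h / 2) = h := by ring
  rw [e, pow_add]
  have := Real.rpow_pos_of_pos (mfact_pos α) t
  have := Real.rpow_pos_of_pos (mfact_pos β) s
  have h2 : (h / 2) ^ msize α ≤ h ^ msize α := by gcongr; linarith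
  calc C * ((h / 2) ^ msize α * mfact α ^ t) * (M ^ d * (h ^ msize β * mfact β ^ s))
      ≤ C * (h ^ msize α * mfact α ^ t) * (M ^ d * (h ^ msize β * mfact β ^ s)) := by gcongr
    _ = _ := by ring

theorem IsGelfandShilov.translate (ht : 0 < t) {f : Rn d → ℂ} (hf : IsGelfandShilov t s f)
    (a : Rn d) : IsGelfandShilov t s (fun y => f (y - a)) := by
  rw [isGelfandShilov_iff] at hf ⊢
  obtain ⟨hsm, hbd⟩ := hf
  refine ⟨hsm.comp (contDiff_id.sub contDiff_const), fun h hh => ?_⟩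
  obtain ⟨C, hC⟩ := hbd (h / 2) (by positivity)
  have hC0 : 0 ≤ C := by
    have := (norm_nonneg _).trans (hC 0 0 0)
    exact nonneg_of_mul_nonneg_left this (weight_pos (by positivity) _ _)
  choose M hM hM' using fun i => exists_pow_le ht (half_pos hh) (a i)
  refine ⟨C * ∏ i, M i, fun α β x => ?_⟩
  have e : partialDeriv β (fun y => f (y - a)) x = partialDeriv β f (x - a) := by
    have := multiDeriv_comm stdVec β (fun g y => g (y - a)) (fun i g _ => by
      funext y
      simp only [dirDeriv]
      rw [fderiv_comp_sub]) hsm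
    exact congrFun this x
  rw [e]
  set y : Rn d := x - a with hy
  classical
  set α' : Fin d → ℕ := fun i => if |a i| ≤ |y i| then α i else 0 with hα'
  set α'' : Fin d → ℕ := fun i => if |a i| ≤ |y i| then 0 else α i with hα''
  have hadd : ∀ i, α' i + α'' i = α i := fun i => by
    simp only [hα', hα'']; split_ifs <;> simp
  have hpt : ∀ i, |x i| ^ α i ≤ 2 ^ α i * (|y i| ^ α' i * |a i| ^ α'' i) := by
    intro i
    have hxi : |x i| ≤ |y i| + |a i| := by
      have : x i = y i + a i := by simp [hy]
      rw [this]; exact abs_add_le _ _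
    by_cases hc : |a i| ≤ |y i|
    · simp only [hα', hα'', if_pos hc, pow_zero, mul_one]
      rw [← mul_pow]
      gcongr
      linarith
    · simp only [hα', hα'', if_neg hc, pow_zero, one_mul]
      rw [← mul_pow]
      gcongr
      linarith [not_le.mp hc]
  have hx : ‖(mpow x α : ℂ)‖ ≤ 2 ^ msize α * (‖(mpow y α' : ℂ)‖ *
      ((∏ i, M i) * ((h / 2) ^ msize α'' * mfact α'' ^ t))) := by
    simp only [Complex.norm_real, mpow, Real.norm_eq_abs, Finset.abs_prod, abs_pow]
    rw [weight_split, msize, ← Finset.prod_pow_eq_pow_sum, ← Finset.prod_mul_distrib,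
      ← Finset.prod_mul_distrib, ← Finset.prod_mul_distrib]
    refine Finset.prod_le_prod (fun i _ => by positivity) fun i _ => (hpt i).trans ?_
    gcongr
    exact hM' i _
  have hfac : mfact α' ^ t * mfact α'' ^ t = mfact α ^ t := by
    rw [← Real.mul_rpow (mfact_pos _).le (mfact_pos _).le, mfact, mfact, mfact,
      ← Finset.prod_mul_distrib]
    congr 1
    refine Finset.prod_congr rfl fun i _ => ?_
    simp only [hα', hα'']; split_ifs <;> simp
  have hsz : msize α' + msize α'' = msize α := by
    rw [msize, msize, msize, ← Finset.sum_add_distrib]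
    exact Finset.sum_congr rfl fun i _ => hadd i
  have hMp : 0 ≤ ∏ i, M i := Finset.prod_nonneg fun i _ => by linarith [hM i]
  have h0 := Real.rpow_pos_of_pos (mfact_pos α'') t
  have h1 := Real.rpow_pos_of_pos (mfact_pos α) t
  have h2 := Real.rpow_pos_of_pos (mfact_pos β) s
  rw [norm_mul]
  calc ‖(mpow x α : ℂ)‖ * ‖partialDeriv β f y‖
      ≤ 2 ^ msize α * (‖(mpow y α' : ℂ)‖ * ((∏ i, M i) * ((h / 2) ^ msize α'' * mfact α'' ^ t))) *
        ‖partialDeriv β f y‖ := by gcongr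
    _ = 2 ^ msize α * ((∏ i, M i) * ((h / 2) ^ msize α'' * mfact α'' ^ t)) *
        ‖(mpow y α' : ℂ) * partialDeriv β f y‖ := by rw [norm_mul]; ring
    _ ≤ 2 ^ msize α * ((∏ i, M i) * ((h / 2) ^ msize α'' * mfact α'' ^ t)) *
        (C * ((h / 2) ^ (msize α' + msize β) * mfact α' ^ t * mfact β ^ s)) := by
          gcongr
          exact hC α' β y
    _ = C * (∏ i, M i) * (2 ^ msize α * (h / 2) ^ (msize α' + msize α'' + msize β)) *
        (mfact α' ^ t * mfact α'' ^ t) * mfact β ^ s := by rw [pow_add, pow_add, pow_add]; ring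
    _ ≤ C * (∏ i, M i) * h ^ (msize α + msize β) * mfact α ^ t * mfact β ^ s := by
          rw [hsz, hfac]
          gcongr
          exact pow_le_pow_of_half hh _ _
    _ = _ := by ring

theorem IsGelfandShilov.star {f : Rn d → ℂ} (hf : IsGelfandShilov t s f) :
    IsGelfandShilov t s (fun y => starRingEnd ℂ (f y)) := by
  rw [isGelfandShilov_iff] at hf ⊢
  obtain ⟨hsm, hbd⟩ := hf
  refine ⟨Complex.conjCLE.contDiff.comp hsm, fun h hh => ?_⟩
  obtain ⟨C, hC⟩ := hbd h hh
  refine ⟨C, fun α β x => ?_⟩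
  have e : partialDeriv β (fun y => starRingEnd ℂ (f y)) x = starRingEnd ℂ (partialDeriv β f x) := by
    have := multiDeriv_comm stdVec β (fun g y => starRingEnd ℂ (g y)) (fun i g hg => by
      funext y
      have h1 := Complex.conjCLE.toContinuousLinearMap.hasFDerivAt.comp y
        (smooth_differentiable hg y).hasFDerivAt
      have h2 : dirDeriv (stdVec i) (fun y => starRingEnd ℂ (g y)) y = _ :=
        congrArg (fun L => L (stdVec i)) h1.fderiv
      rw [h2]
      rfl) hsm
    exact congrFun this x
  rw [e]
  refine le_trans (le_of_eq ?_) (hC α β x)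
  rw [norm_mul, norm_mul, Complex.norm_conj]

theorem IsGelfandShilov.add {f g : Rn d → ℂ} (hf : IsGelfandShilov t s f)
    (hg : IsGelfandShilov t s g) : IsGelfandShilov t s (f + g) := by
  rw [isGelfandShilov_iff] at hf hg ⊢
  refine ⟨hf.1.add hg.1, fun h hh => ?_⟩
  obtain ⟨C, hC⟩ := hf.2 h hh
  obtain ⟨C', hC'⟩ := hg.2 h hh
  refine ⟨C + C', fun α β x => ?_⟩
  rw [partialDeriv, multiDeriv_add _ _ hf.1 hg.1, Pi.add_apply, mul_add, add_mul]
  exact (norm_add_le _ _).trans (add_le_add (hC α β x) (hC' α β x))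

theorem IsGelfandShilov.smul {f : Rn d → ℂ} (hf : IsGelfandShilov t s f) (c : ℂ) :
    IsGelfandShilov t s (c • f) := by
  rw [isGelfandShilov_iff] at hf ⊢
  refine ⟨contDiff_const.mul hf.1, fun h hh => ?_⟩
  obtain ⟨C, hC⟩ := hf.2 h hh
  refine ⟨‖c‖ * C, fun α β x => ?_⟩
  rw [partialDeriv, multiDeriv_smul _ _ _ hf.1, Pi.smul_apply, mul_smul_comm, norm_smul, mul_assoc]
  gcongr
  exact hC α β x

theorem IsGelfandShilov.zero : IsGelfandShilov t s (0 : Rn d → ℂ) := by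
  rw [isGelfandShilov_iff]
  refine ⟨contDiff_const, fun h hh => ⟨0, fun α β x => ?_⟩⟩
  have := multiDeriv_smul stdVec β 0 (f := (0 : Rn d → ℂ)) contDiff_const
  rw [zero_smul, zero_smul] at this
  rw [partialDeriv, this]
  simp

end Aux

/-! ### The Gelfand--Shilov space, its topology and its dual -/

/-- The Beurling type Gelfand--Shilov functions as a subspace of all functions `ℝ^d → ℂ`. -/
def spaceSub (t s : ℝ) (d : ℕ) : Submodule ℂ (Rn d → ℂ) where
  carrier := {f | IsGelfandShilov t s f}
  add_mem' {_ _} hf hg := IsGelfandShilov.add hf hg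
  zero_mem' := IsGelfandShilov.zero
  smul_mem' c _ hf := IsGelfandShilov.smul hf c

/-- The Beurling type Gelfand--Shilov space `Σ_t^s(ℝ^d)` (as a type of its own, so that it does not
carry the topology of pointwise convergence). -/
def Space (t s : ℝ) (d : ℕ) : Type := spaceSub t s d

section Space

variable {t s : ℝ} {d : ℕ}

instance : AddCommGroup (Space t s d) := inferInstanceAs (AddCommGroup (spaceSub t s d))

instance : Module ℂ (Space t s d) := inferInstanceAs (Module ℂ (spaceSub t s d))

instance : CoeFun (Space t s d) (fun _ => Rn d → ℂ) := ⟨fun f => f.1⟩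

/-- The norm `‖f‖_{𝒮_{t,h}^s}`, as a seminorm on `Σ_t^s(ℝ^d)`. -/
def gsSeminorm (t s : ℝ) (d : ℕ) (h : {h : ℝ // 0 < h}) : Seminorm ℂ (Space t s d) :=
  Seminorm.ofSMulLE (fun f => ⨆ p, gsQuot t s h.1 f p)
    (by
      have : ∀ p, gsQuot t s h.1 ((0 : Space t s d) : Rn d → ℂ) p = 0 := fun p => by
        have h0 := multiDeriv_smul stdVec p.2.1 0 (f := (0 : Rn d → ℂ)) contDiff_const
        rw [zero_smul, zero_smul] at h0
        have h1 : partialDeriv p.2.1 ((0 : Space t s d) : Rn d → ℂ) = 0 := h0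
        rw [gsQuot, h1]
        simp
      simp [this])
    (fun f g => by
      refine ciSup_le fun p => ?_
      refine le_trans ?_ (add_le_add (le_ciSup (f.2.2 h.1 h.2) p) (le_ciSup (g.2.2 h.1 h.2) p))
      have h1 : partialDeriv p.2.1 ((f + g : Space t s d) : Rn d → ℂ) = _ :=
        multiDeriv_add stdVec p.2.1 f.2.1 g.2.1
      rw [gsQuot, h1, gsQuot, gsQuot, ← add_div, Pi.add_apply, mul_add]
      have := weight_pos (t := t) (s := s) h.2 p.1 p.2.1
      gcongr
      exact norm_add_le _ _)
    (fun c f => by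
      refine ciSup_le fun p => ?_
      refine le_trans (le_of_eq ?_)
        (mul_le_mul_of_nonneg_left (le_ciSup (f.2.2 h.1 h.2) p) (norm_nonneg c))
      have h1 : partialDeriv p.2.1 ((c • f : Space t s d) : Rn d → ℂ) = _ :=
        multiDeriv_smul stdVec p.2.1 c f.2.1
      rw [gsQuot, h1, gsQuot, Pi.smul_apply, mul_smul_comm, norm_smul, mul_div_assoc]
      rfl)

instance : Nonempty {h : ℝ // 0 < h} := ⟨⟨1, one_pos⟩⟩

/-- The Fréchet space topology of `Σ_t^s(ℝ^d)`, defined by the seminorms `‖·‖_{𝒮_{t,h}^s}`,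
`h > 0`. -/
instance : TopologicalSpace (Space t s d) :=
  SeminormFamily.moduleFilterBasis (gsSeminorm t s d : SeminormFamily ℂ (Space t s d) _) |>.topology

theorem space_withSeminorms :
    WithSeminorms (gsSeminorm t s d : SeminormFamily ℂ (Space t s d) {h : ℝ // 0 < h}) := ⟨rfl⟩

instance : IsTopologicalAddGroup (Space t s d) := space_withSeminorms.topologicalAddGroup

instance : ContinuousSMul ℂ (Space t s d) := space_withSeminorms.continuousSMul

/-- The complex conjugate of a Gelfand--Shilov function. -/
def conj (f : Space t s d) : Space t s d := ⟨fun y => starRingEnd ℂ (f y), f.2.star⟩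

/-- The time-frequency shift `M_ξ T_x f (y) = e^{i ⟨y, ξ⟩} f (y - x)`. -/
def timeFreqShift (ht : 0 < t) (hs : 0 < s) (x ξ : Rn d) (f : Space t s d) : Space t s d :=
  ⟨fun y => planeWave ξ y * f (y - x), (f.2.translate ht x).modulate hs ξ⟩

theorem partialDeriv_zero (f : Rn d → ℂ) : partialDeriv 0 f = f := by
  have : ∀ l : List (Fin d),
      l.foldr (fun i g => (dirDeriv (stdVec i))^[(0 : Fin d → ℕ) i] g) f = f := by
    intro l
    induction l with
    | nil => rfl
    | cons i l ih => rw [List.foldr_cons, ih]; rfl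
  exact this _

theorem norm_le_gsSeminorm (f : Space t s d) (x : Rn d) :
    ‖f x‖ ≤ gsSeminorm t s d ⟨1, one_pos⟩ f := by
  have h := le_ciSup (f.2.2 1 one_pos) (0, 0, x)
  refine le_trans (le_of_eq ?_) h
  simp [gsQuot, partialDeriv_zero, mpow, mfact]

theorem integrable_space (f : Space t s d) : MeasureTheory.Integrable (f : Rn d → ℂ) := by
  have hc : Continuous (f : Rn d → ℂ) := f.2.1.continuous
  obtain ⟨C, hC⟩ := (isGelfandShilov_iff.mp f.2).2 1 one_pos
  have hb : ∃ K : ℝ, ∀ x, (1 + ‖x‖) ^ (d + 1) * ‖f x‖ ≤ K := by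
    have h1 : ∀ i : Fin d, ∃ K : ℝ, ∀ x, |x i| ^ (d + 1) * ‖f x‖ ≤ K := by
      intro i
      refine ⟨C * (1 * mfact (Pi.single i (d + 1)) ^ t * mfact (0 : Fin d → ℕ) ^ s), fun x => ?_⟩
      have := hC (Pi.single i (d + 1)) 0 x
      have e2 : ‖(mpow x (Pi.single i (d + 1)) : ℂ)‖ = |x i| ^ (d + 1) := by
        rw [mpow, Finset.prod_eq_single i]
        · simp
        · intro j _ hj; simp [hj]
        · simp
      rwa [partialDeriv_zero, norm_mul, e2, one_pow] at this
    choose K hK using h1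
    refine ⟨((d : ℝ) + 1) ^ d * (gsSeminorm t s d ⟨1, one_pos⟩ f + ∑ i, K i), fun x => ?_⟩
    have hn : ‖x‖ ≤ ∑ i, |x i| := by
      conv_lhs => rw [← (EuclideanSpace.basisFun (Fin d) ℝ).sum_repr x]
      refine (norm_sum_le _ _).trans (le_of_eq ?_)
      simp [norm_smul]
    have hp : (1 + ‖x‖) ^ (d + 1) ≤ ((d : ℝ) + 1) ^ d * (1 + ∑ i, |x i| ^ (d + 1)) := by
      have h2 : (1 + ‖x‖) ^ (d + 1) ≤
          (∑ i : Option (Fin d), (i.elim 1 fun i => |x i|)) ^ (d + 1) := by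
        rw [Fintype.sum_option]
        simp only [Option.elim]
        gcongr
      refine h2.trans ((pow_sum_le_card_mul_sum_pow (fun i _ => ?_) d).trans (le_of_eq ?_))
      · cases i <;> simp
      · rw [Fintype.sum_option]
        simp
    calc (1 + ‖x‖) ^ (d + 1) * ‖f x‖
        ≤ ((d : ℝ) + 1) ^ d * (1 + ∑ i, |x i| ^ (d + 1)) * ‖f x‖ := by gcongr
      _ = ((d : ℝ) + 1) ^ d * (‖f x‖ + ∑ i, |x i| ^ (d + 1) * ‖f x‖) := by
          rw [← Finset.sum_mul]; ring
      _ ≤ _ := by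
          gcongr with i _
          · exact norm_le_gsSeminorm f x
          · exact hK i x
  obtain ⟨K, hK⟩ := hb
  have hint : MeasureTheory.Integrable (fun x : Rn d => (1 + ‖x‖) ^ (-((d : ℝ) + 1))) :=
    integrable_one_add_norm (by simp)
  refine (hint.const_mul K).mono' hc.aestronglyMeasurable (Filter.Eventually.of_forall fun x => ?_)
  have hpos : 0 < 1 + ‖x‖ := by positivity
  rw [Real.rpow_neg hpos.le, ← div_eq_mul_inv, le_div_iff₀ (by positivity), mul_comm]
  have := hK x
  rw [← Real.rpow_natCast] at this
  exact_mod_cast this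

theorem integrable_mul_space (f g : Space t s d) :
    MeasureTheory.Integrable (fun x : Rn d => f x * g x) :=
  (integrable_space f).mul_bdd (c := gsSeminorm t s d ⟨1, one_pos⟩ g)
    g.2.1.continuous.aestronglyMeasurable
    (Filter.Eventually.of_forall fun x => norm_le_gsSeminorm g x)

variable (t s d) in
/-- The space `(Σ_t^s)'(ℝ^d)` of Gelfand--Shilov ultradistributions: the continuous linear
functionals on `Σ_t^s(ℝ^d)`, with the weak* topology. -/
abbrev Ultradistribution : Type := WeakDual ℂ (Space t s d)

/-- The conjugate linear action `(u, φ) = u (φ̄)` of an ultradistribution on a test function. -/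
def pairing (u : Ultradistribution t s d) (φ : Space t s d) : ℂ := u (conj φ)

/-- The embedding `Σ_t^s(ℝ^d) ⊆ (Σ_t^s)'(ℝ^d)`: the functional `g ↦ ∫ f(x) g(x) dx`. -/
def ofFun (f : Space t s d) : Ultradistribution t s d :=
  let L : Space t s d →ₗ[ℂ] ℂ :=
    { toFun := fun g => ∫ x : Rn d, f x * g x
      map_add' := fun g g' => by
        rw [← MeasureTheory.integral_add (integrable_mul_space f g) (integrable_mul_space f g')]
        exact MeasureTheory.integral_congr_ae (Filter.Eventually.of_forall fun x => mul_add _ _ _)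
      map_smul' := fun c g => by
        simp only [RingHom.id_apply, smul_eq_mul]
        rw [← MeasureTheory.integral_const_mul]
        exact MeasureTheory.integral_congr_ae
          (Filter.Eventually.of_forall fun x => mul_left_comm _ _ _) }
  StrongDual.toWeakDual (⟨L, by
    refine WithSeminorms.continuous_normedSpace_rng ℂ space_withSeminorms L
      ⟨{⟨1, one_pos⟩}, ⟨∫ x : Rn d, ‖f x‖, MeasureTheory.integral_nonneg fun _ => norm_nonneg _⟩,
        fun g => ?_⟩
    simp only [Finset.sup_singleton]
    change ‖∫ x : Rn d, f x * g x‖ ≤ (∫ x : Rn d, ‖f x‖) * gsSeminorm t s d ⟨1, one_pos⟩ g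
    rw [← MeasureTheory.integral_mul_const]
    refine MeasureTheory.norm_integral_le_of_norm_le ((integrable_space f).norm.mul_const _)
      (Filter.Eventually.of_forall fun x => ?_)
    rw [norm_mul]
    exact mul_le_mul_of_nonneg_left (norm_le_gsSeminorm g x) (norm_nonneg _)⟩ :
      StrongDual ℂ (Space t s d))

/-! ### Short-time Fourier transform, wave front set, Weyl operators -/

/-- The short-time Fourier transform `V_ψ u (x, ξ) = (2π)^{-d/2} (u, M_ξ T_x ψ)`. -/
def stft (ht : 0 < t) (hs : 0 < s) (ψ : Space t s d) (u : Ultradistribution t s d)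
    (x ξ : Rn d) : ℂ :=
  (((2 * Real.pi) ^ (-(d : ℝ) / 2) : ℝ) : ℂ) * pairing u (timeFreqShift ht hs x ξ ψ)

/-- The `t,s`-Gelfand--Shilov wave front set `WF^{t,s}(u)`, computed with the window `ψ`: a point
`z₀ ≠ 0` of `ℝ^d × ℝ^d` is *not* in it if there is an open set `U ∌ 0` that contains `z₀` and
satisfies `sup_{λ > 0, (x, ξ) ∈ U} e^{rλ} |V_ψ u (λ^t x, λ^s ξ)| < ∞` for all `r > 0`. -/
def waveFrontSet (ht : 0 < t) (hs : 0 < s) (ψ : Space t s d) (u : Ultradistribution t s d) :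
    Set (Rn d × Rn d) :=
  {z₀ | z₀ ≠ 0 ∧ ¬ ∃ U : Set (Rn d × Rn d), IsOpen U ∧ U ⊆ {0}ᶜ ∧ z₀ ∈ U ∧
    ∀ r : ℝ, 0 < r → ∃ C : ℝ, ∀ l : ℝ, 0 < l → ∀ x ξ : Rn d, (x, ξ) ∈ U →
      Real.exp (r * l) * ‖stft ht hs ψ u (l ^ t • x) (l ^ s • ξ)‖ ≤ C}

variable (t s) in
/-- The symbol class `Γ_{t,s}^{s,t;0}(ℝ^{2d})`: smooth `a` such that for some `μ > 0` and all `h > 0`,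
`|∂_x^α ∂_ξ^β a(x, ξ)| ≲ h^{|α+β|} α!^s β!^t exp(μ (|x|^{1/t} + |ξ|^{1/s}))`. -/
def IsSymbol (a : Rn d × Rn d → ℂ) : Prop :=
  ContDiff ℝ ∞ a ∧ ∃ μ : ℝ, 0 < μ ∧ ∀ h : ℝ, 0 < h → ∃ C : ℝ, ∀ (α β : Fin d → ℕ) (x ξ : Rn d),
    ‖partialDeriv₂ α β a (x, ξ)‖ ≤ C * (h ^ (msize α + msize β) * mfact α ^ s * mfact β ^ t *
      Real.exp (μ * (‖x‖ ^ (1 / t) + ‖ξ‖ ^ (1 / s))))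

/-- The cross-Wigner distribution
`W(g, f)(x, ξ) = ∫ g(x + y/2) conj(f(x - y/2)) e^{-i ⟨y, ξ⟩} dy`. -/
def wigner (g f : Space t s d) (x ξ : Rn d) : ℂ :=
  ∫ y : Rn d, g (x + (1 / 2 : ℝ) • y) * starRingEnd ℂ (f (x - (1 / 2 : ℝ) • y)) *
    planeWave (-ξ) y

/-- The continuous linear operator `A` on `(Σ_t^s)'(ℝ^d)` extends the Weyl operator `a^w(x, D)`,
which is given on `Σ_t^s(ℝ^d)` by `(a^w(x, D) f, g) = (2π)^{-d} (a, W(g, f))`, that is by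
`(2π)^{-d} ∫∫∫ e^{i ⟨y, ξ⟩} a(x, ξ) f(x - y/2) conj(g(x + y/2)) dy dx dξ`. -/
def IsWeylOperator (a : Rn d × Rn d → ℂ)
    (A : Ultradistribution t s d →L[ℂ] Ultradistribution t s d) : Prop :=
  ∀ f g : Space t s d, pairing (A (ofFun f)) g =
    (((2 * Real.pi) ^ (-(d : ℝ)) : ℝ) : ℂ) *
      ∫ z : Rn d × Rn d, a z * starRingEnd ℂ (wigner g f z.1 z.2)

end Space

end GelfandShilov

end

open scoped ContDiff FourierTransform

noncomputable section

namespace GelfandShilov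

open MeasureTheory
open Finset.HasAntidiagonal (antidiagonal mem_antidiagonal)

/-! ### Exponential weights -/

section Weights

variable {d : ℕ} {t s : ℝ}

/-! In phase space a Weyl operator is an integral operator whose kernel is concentrated near the
diagonal. Write π(w) for the time-frequency shift by w, and ρ for the gauge |x|^{1/t} + |ξ|^{1/s}
(`aniso`), which the dilation (λ^t x, λ^s ξ) multiplies by λ. For a window ψ ≠ 0, a test function f
is, up to the factor (2π)^d ‖ψ‖², the superposition of the conjugated shifts of ψ with coefficients
∫ f π(w)ψ (`synth_analysis`). Expanding through this formula gives, up to constants, V_φ(Au)(z) = ∫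
K(z,w) V_ψ u(w) dw, where K(z,w) is the Weyl form evaluated at the conjugate of π(z)φ and at π(w)ψ
(`weylOperator_apply`).

The kernel estimate is the analytic core. The cross-Wigner transform of two shifted windows is that
of the unshifted ones, translated to the midpoint (z+w)/2 and modulated by a phase linear in z-w
(`crossT_shift`). Hence |K(z,w)| is the modulus of a Fourier integral of a(· + (z+w)/2) times a
fixed cross-Wigner transform. Both factors have Gevrey bounds of order s in x and t in ξ with
arbitrarily small h. Repeated integration by parts, exploited for all orders at once, yields
|K(z,w)| ≤ C_r exp(μ'ρ(z) - rρ(z-w)) for every r, with μ' independent of r (`exists_kernel_bound`).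
The condition s+t > 1 enters because ξ-derivatives multiply the windows by powers of x, and
commuting derivatives with these powers costs factorials a!, which must be dominated by ε^a a!^{s+t}
for every ε > 0 (`exists_lineBound_coord_pow`).

Microlocality then follows by splitting the integral (`exists_isOpen_decay_integral`). Let Z be the
λ-dilate of a point near z₀. If w is in the λ-dilate of U, then V_ψ u(w) decays superexponentially
in λ. Otherwise ρ(Z-w) ≥ ελ, and a large off-diagonal rate r beats the exponential growth of V_ψ u
and of exp(μ'ρ(Z)).

For existence, φ ↦ ∫ K(φ,w) conj(π(w)ψ) dw, with K(φ,w) the Weyl form at φ and π(w)ψ, is continuous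
on Σ_t^s, and its normalised transpose is the operator. Applying u under the integral is justified
by representing u as integration of phase-space transforms against a weighted integrable density,
obtained from the Riesz theorem in L² (`exists_representation`, `apply_synth`). Uniqueness is a
weak* density argument (`weakDual_ext`). Since the operator is unique, it may be expanded with
whichever window ψ measures u, while φ stays free; different windows therefore need no separate
change-of-window argument. -/

theorem pow_le_exp_mul {p h c : ℝ} (hp : 0 < p) (hh : 0 < h) (hc : 0 ≤ c) (k : ℕ) :
    c ^ k ≤ Real.exp (p * (c / h) ^ (1 / p)) * (h ^ k * (k.factorial : ℝ) ^ p) := by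
  -- The k-th term of the exponential series gives b^k ≤ e^b k!. Its p-th power is the claim,
  -- because (b^k)^p = (c/h)^k.
  set b : ℝ := (c / h) ^ (1 / p) with hb
  have hb0 : 0 ≤ b := by positivity
  have h1 : b ^ k ≤ Real.exp b * (k.factorial : ℝ) := by
    have := Real.pow_div_factorial_le_exp b hb0 k
    rwa [div_le_iff₀ (by positivity)] at this
  have h2 : (b ^ k) ^ p = (c / h) ^ k := by
    rw [hb, ← Real.rpow_natCast, ← Real.rpow_mul (by positivity), ← Real.rpow_mul (by positivity),
      ← Real.rpow_natCast]
    congr 1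
    field_simp
  have h3 : (c / h) ^ k ≤ Real.exp (p * b) * (k.factorial : ℝ) ^ p := by
    rw [← h2, mul_comm p, Real.exp_mul, ← Real.mul_rpow (by positivity) (by positivity)]
    exact Real.rpow_le_rpow (by positivity) h1 hp.le
  rw [div_pow, div_le_iff₀ (by positivity)] at h3
  linarith

/-- With c = (y/h)^{1/p}, p-th roots of the moment bounds read c^k/k! · A^{1/p} ≤ M^{1/p}. Summing
them with weights 2^{-k} produces e^{c/2} A^{1/p} ≤ 2 M^{1/p}; the p-th power gives the factor 2^p
and the rate p/2. -/
theorem le_exp_of_moments {p h y A M : ℝ} (hp : 0 < p) (hh : 0 < h) (hy : 0 ≤ y) (hA : 0 ≤ A)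
    (H : ∀ k : ℕ, y ^ k * A ≤ M * (h ^ k * (k.factorial : ℝ) ^ p)) :
    A ≤ 2 ^ p * M * Real.exp (-(p / 2 * (y / h) ^ (1 / p))) := by
  have hM : 0 ≤ M := by
    have := H 0
    simp only [pow_zero, one_mul, Nat.factorial_zero, Nat.cast_one, Real.one_rpow, mul_one] at this
    exact hA.trans this
  set c : ℝ := (y / h) ^ (1 / p) with hc
  have hc0 : 0 ≤ c := by positivity
  have hcp : ∀ k : ℕ, (c ^ k) ^ p = (y / h) ^ k := fun k => by
    rw [hc, ← Real.rpow_natCast, ← Real.rpow_mul (by positivity), ← Real.rpow_mul (by positivity),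
      ← Real.rpow_natCast]
    congr 1
    field_simp
  have h1 : ∀ k : ℕ, c ^ k / (k.factorial : ℝ) * A ^ (1 / p) ≤ M ^ (1 / p) := by
    intro k
    have h2 : (c ^ k / (k.factorial : ℝ)) ^ p * A ≤ M := by
      rw [Real.div_rpow (by positivity) (by positivity), hcp, div_pow, div_div, div_mul_eq_mul_div,
        div_le_iff₀ (by positivity)]
      exact H k
    have h3 := Real.rpow_le_rpow (by positivity) h2 (one_div_nonneg.2 hp.le)
    rwa [Real.mul_rpow (by positivity) hA, ← Real.rpow_mul (by positivity),
      mul_one_div_cancel hp.ne', Real.rpow_one] at h3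
  have h4 : Real.exp (c / 2) * A ^ (1 / p) ≤ 2 * M ^ (1 / p) := by
    have hs1 : HasSum (fun k : ℕ => (c / 2) ^ k / (k.factorial : ℝ)) (Real.exp (c / 2)) := by
      rw [Real.exp_eq_exp_ℝ]
      exact NormedSpace.expSeries_div_hasSum_exp (c / 2)
    refine hasSum_le (fun k => ?_) (hs1.mul_right _) (hasSum_geometric_two.mul_right _)
    calc (c / 2) ^ k / (k.factorial : ℝ) * A ^ (1 / p)
        = (1 / 2) ^ k * (c ^ k / (k.factorial : ℝ) * A ^ (1 / p)) := by
          rw [div_pow, div_pow, one_pow]; ring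
      _ ≤ _ := by gcongr; exact h1 k
  have h5 := Real.rpow_le_rpow (by positivity) h4 hp.le
  rw [Real.mul_rpow (by positivity) (by positivity), Real.mul_rpow (by positivity) (by positivity),
    ← Real.rpow_mul hA, ← Real.rpow_mul hM, one_div_mul_cancel hp.ne', Real.rpow_one, Real.rpow_one,
    ← Real.exp_mul] at h5
  rw [Real.exp_neg, ← div_eq_mul_inv, le_div_iff₀ (Real.exp_pos _), mul_comm A]
  refine le_trans (le_of_eq ?_) h5
  congr 2
  ring

theorem norm_le_sum_abs (x : Rn d) : ‖x‖ ≤ ∑ i, |x i| := by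
  conv_lhs => rw [← (EuclideanSpace.basisFun (Fin d) ℝ).sum_repr x]
  refine (norm_sum_le _ _).trans (le_of_eq ?_)
  simp [norm_smul]

theorem abs_coord_le (x : Rn d) (i : Fin d) : |x i| ≤ ‖x‖ := by
  simpa using PiLp.norm_apply_le x i

theorem exists_coord_ge (x : Rn d) (hx : x ≠ 0) : ∃ i, ‖x‖ ≤ (d + 1) * |x i| := by
  by_contra! H
  have hpos : 0 < ‖x‖ := norm_pos_iff.2 hx
  have h1 : (d + 1) * ‖x‖ ≤ d * ‖x‖ := by
    calc (d + 1) * ‖x‖ ≤ (d + 1) * ∑ i, |x i| := by gcongr; exact norm_le_sum_abs x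
      _ = ∑ i, (d + 1) * |x i| := Finset.mul_sum _ _ _
      _ ≤ ∑ _i : Fin d, ‖x‖ := Finset.sum_le_sum fun i _ => (H i).le
      _ = d * ‖x‖ := by simp
  linarith

/-- Moment bounds in every coordinate give exponential decay, of any prescribed rate if the
parameter `h` of the moment bounds is small. -/
theorem exp_decay_of_moments {p : ℝ} (hp : 0 < p) (R : ℝ) (d : ℕ) : ∃ h₀ : ℝ, 0 < h₀ ∧
    ∀ h : ℝ, 0 < h → h ≤ h₀ → ∀ (x : Rn d) (A M : ℝ), 0 ≤ A → A ≤ M →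
    (∀ (i : Fin d) (k : ℕ), |x i| ^ k * A ≤ M * (h ^ k * (k.factorial : ℝ) ^ p)) →
    A ≤ 2 ^ p * M * Real.exp (-(R * ‖x‖ ^ (1 / p))) := by
  set R' : ℝ := max R 1
  have hR' : 0 < R' := lt_of_lt_of_le one_pos (le_max_right _ _)
  -- This threshold makes p/2 · (|x_i|/h)^{1/p} at least R'‖x‖^{1/p} for a coordinate with
  -- (d+1)|x_i| ≥ ‖x‖.
  refine ⟨(p / (2 * R')) ^ p / (d + 1), by positivity, fun h hh hh0 x A M hA hAM H => ?_⟩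
  -- No dominant coordinate exists at x = 0, and in dimension zero the moment hypothesis is empty;
  -- this is what the assumption A ≤ M is for.
  by_cases hx : x = 0
  · subst hx
    rw [norm_zero, Real.zero_rpow (by positivity), mul_zero, neg_zero, Real.exp_zero, mul_one]
    exact hAM.trans (le_mul_of_one_le_left (hA.trans hAM) (Real.one_le_rpow (by norm_num) hp.le))
  · obtain ⟨i, hi⟩ := exists_coord_ge x hx
    have h1 := le_exp_of_moments hp hh (abs_nonneg (x i)) hA (H i)
    refine h1.trans ?_
    have hM := hA.trans hAM
    refine mul_le_mul_of_nonneg_left (Real.exp_le_exp.2 (neg_le_neg ?_)) (by positivity)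
    have h2 : ‖x‖ / (p / (2 * R')) ^ p ≤ |x i| / h := by
      rw [div_le_div_iff₀ (by positivity) hh]
      calc ‖x‖ * h ≤ ((d + 1) * |x i|) * ((p / (2 * R')) ^ p / (d + 1)) := by gcongr
        _ = _ := by field_simp
    have h3 := Real.rpow_le_rpow (by positivity) h2 (one_div_nonneg.2 hp.le)
    rw [Real.div_rpow (by positivity) (by positivity), ← Real.rpow_mul (by positivity),
      mul_one_div_cancel hp.ne', Real.rpow_one] at h3
    calc R * ‖x‖ ^ (1 / p) ≤ R' * ‖x‖ ^ (1 / p) := by gcongr; exact le_max_left _ _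
      _ = p / 2 * (‖x‖ ^ (1 / p) / (p / (2 * R'))) := by field_simp
      _ ≤ _ := by gcongr

theorem add_rpow_le_two_rpow {a b p : ℝ} (ha : 0 ≤ a) (hb : 0 ≤ b) (hp : 0 ≤ p) :
    (a + b) ^ p ≤ 2 ^ p * (a ^ p + b ^ p) := by
  have h1 : (a + b) ^ p ≤ (2 * max a b) ^ p :=
    Real.rpow_le_rpow (by positivity) (by linarith [le_max_left a b, le_max_right a b]) hp
  rw [Real.mul_rpow (by norm_num) (le_max_of_le_left ha)] at h1
  refine h1.trans (mul_le_mul_of_nonneg_left ?_ (by positivity))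
  rcases max_choice a b with h | h <;> rw [h]
  · linarith [Real.rpow_nonneg hb p]
  · linarith [Real.rpow_nonneg ha p]

theorem norm_add_rpow_le {V : Type*} [SeminormedAddCommGroup V] (x y : V) {p : ℝ} (hp : 0 ≤ p) :
    ‖x + y‖ ^ p ≤ 2 ^ p * (‖x‖ ^ p + ‖y‖ ^ p) :=
  (Real.rpow_le_rpow (norm_nonneg _) (norm_add_le x y) hp).trans
    (add_rpow_le_two_rpow (norm_nonneg _) (norm_nonneg _) hp)

theorem norm_sub_rpow_le {V : Type*} [SeminormedAddCommGroup V] (x y : V) {p : ℝ} (hp : 0 ≤ p) :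
    ‖x - y‖ ^ p ≤ 2 ^ p * (‖x‖ ^ p + ‖y‖ ^ p) := by
  simpa [sub_eq_add_neg] using norm_add_rpow_le x (-y) hp

variable (t s) in
/-- The anisotropic gauge `|x|^{1/t} + |ξ|^{1/s}` on phase space. -/
def aniso (z : Rn d × Rn d) : ℝ := ‖z.1‖ ^ (1 / t) + ‖z.2‖ ^ (1 / s)

variable (t s) in
/-- A constant in the quasi-triangle inequality for `aniso`. -/
def anisoC : ℝ := 2 ^ (1 / t) + 2 ^ (1 / s)

theorem aniso_nonneg (z : Rn d × Rn d) : 0 ≤ aniso t s z := by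
  unfold aniso; positivity

theorem aniso_zero (ht : 0 < t) (hs : 0 < s) : aniso t s (0 : Rn d × Rn d) = 0 := by
  simp [aniso, ht.ne', hs.ne']

theorem aniso_neg (z : Rn d × Rn d) : aniso t s (-z) = aniso t s z := by simp [aniso]

theorem aniso_sub_comm (z w : Rn d × Rn d) : aniso t s (z - w) = aniso t s (w - z) := by
  rw [← aniso_neg, neg_sub]

theorem one_le_anisoC (ht : 0 < t) (hs : 0 < s) : 1 ≤ anisoC t s := by
  have h1 : (1 : ℝ) ≤ 2 ^ (1 / t) := Real.one_le_rpow (by norm_num) (by positivity)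
  have h2 : (1 : ℝ) ≤ 2 ^ (1 / s) := Real.one_le_rpow (by norm_num) (by positivity)
  unfold anisoC; linarith

theorem aniso_add_le (ht : 0 < t) (hs : 0 < s) (z w : Rn d × Rn d) :
    aniso t s (z + w) ≤ anisoC t s * (aniso t s z + aniso t s w) := by
  have h1 := norm_add_rpow_le z.1 w.1 (one_div_nonneg.2 ht.le)
  have h2 := norm_add_rpow_le z.2 w.2 (one_div_nonneg.2 hs.le)
  have p1 : (0 : ℝ) ≤ 2 ^ (1 / t) := by positivity
  have p2 : (0 : ℝ) ≤ 2 ^ (1 / s) := by positivity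
  have q1 : 0 ≤ ‖z.1‖ ^ (1 / t) + ‖w.1‖ ^ (1 / t) := by positivity
  have q2 : 0 ≤ ‖z.2‖ ^ (1 / s) + ‖w.2‖ ^ (1 / s) := by positivity
  unfold aniso anisoC
  rw [Prod.fst_add, Prod.snd_add]
  nlinarith [mul_nonneg p1 q2, mul_nonneg p2 q1]

theorem aniso_le_add_sub (ht : 0 < t) (hs : 0 < s) (z w : Rn d × Rn d) :
    aniso t s w ≤ anisoC t s * (aniso t s z + aniso t s (z - w)) := by
  rw [aniso_sub_comm z w]
  simpa using aniso_add_le ht hs z (w - z)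

theorem aniso_scale (ht : 0 < t) (hs : 0 < s) {l : ℝ} (hl : 0 < l) (x ξ : Rn d) :
    aniso t s (l ^ t • x, l ^ s • ξ) = l * aniso t s (x, ξ) := by
  simp only [aniso, norm_smul, Real.norm_eq_abs, Real.abs_rpow_of_nonneg hl.le, abs_of_pos hl]
  rw [Real.mul_rpow (by positivity) (by positivity), Real.mul_rpow (by positivity) (by positivity),
    ← Real.rpow_mul hl.le, ← Real.rpow_mul hl.le, mul_one_div_cancel ht.ne',
    mul_one_div_cancel hs.ne', Real.rpow_one]
  ring

theorem continuous_aniso (ht : 0 < t) (hs : 0 < s) :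
    Continuous (aniso t s : Rn d × Rn d → ℝ) := by
  unfold aniso
  exact (continuous_fst.norm.rpow_const fun _ => Or.inr (by positivity)).add
    (continuous_snd.norm.rpow_const fun _ => Or.inr (by positivity))

/-- Outside the unit ball one term of the exponential series, of index N with Np ≥ d+1, already
dominates ‖x‖^{d+1}. The comparison function is (1+‖x‖)^{-(d+1)}. -/
theorem integrable_exp_neg_mul_norm_rpow {r p : ℝ} (hr : 0 < r) (hp : 0 < p) :
    Integrable (fun x : Rn d => Real.exp (-(r * ‖x‖ ^ p))) := by
  have hint : Integrable (fun x : Rn d => (1 + ‖x‖) ^ (-((d : ℝ) + 1))) :=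
    integrable_one_add_norm (by simp)
  have hcont : Continuous fun x : Rn d => Real.exp (-(r * ‖x‖ ^ p)) := by
    have : Continuous fun x : Rn d => ‖x‖ ^ p :=
      continuous_norm.rpow_const fun _ => Or.inr hp.le
    fun_prop
  have hq : 0 < (d + 1 : ℝ) / p := by positivity
  obtain ⟨N, hN⟩ : ∃ N : ℕ, (d + 1 : ℝ) / p ≤ N := exists_nat_ge _
  set K : ℝ := (2 : ℝ) ^ ((d : ℝ) + 1) * (1 + N.factorial / r ^ N) with hK
  refine (hint.const_mul K).mono' hcont.aestronglyMeasurable (Filter.Eventually.of_forall fun x => ?_)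
  rw [Real.norm_eq_abs, Real.abs_exp, Real.rpow_neg (by positivity), ← div_eq_mul_inv,
    le_div_iff₀ (by positivity), Real.exp_neg, inv_mul_le_iff₀ (Real.exp_pos _)]
  by_cases hx : ‖x‖ ≤ 1
  · calc (1 + ‖x‖) ^ ((d : ℝ) + 1) ≤ (2 : ℝ) ^ ((d : ℝ) + 1) :=
          Real.rpow_le_rpow (by positivity) (by linarith) (by positivity)
      _ ≤ K := le_mul_of_one_le_right (by positivity) (by
          have : 0 ≤ (N.factorial : ℝ) / r ^ N := by positivity
          linarith)
      _ ≤ _ := le_mul_of_one_le_left (by positivity) (Real.one_le_exp (by positivity))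
  · have hx1 : 1 ≤ ‖x‖ := (not_le.1 hx).le
    have h1 : ‖x‖ ^ ((d : ℝ) + 1) ≤ (‖x‖ ^ p) ^ N := by
      rw [← Real.rpow_natCast, ← Real.rpow_mul (by positivity)]
      refine Real.rpow_le_rpow_of_exponent_le hx1 ?_
      rwa [div_le_iff₀ hp, mul_comm] at hN
    have h2 := Real.pow_div_factorial_le_exp (r * ‖x‖ ^ p) (by positivity) N
    rw [div_le_iff₀ (by positivity), mul_pow] at h2
    have h3 : (‖x‖ ^ p) ^ N ≤ Real.exp (r * ‖x‖ ^ p) * (N.factorial / r ^ N) := by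
      rw [mul_div_assoc', le_div_iff₀ (by positivity)]
      linarith
    calc (1 + ‖x‖) ^ ((d : ℝ) + 1) ≤ (2 * ‖x‖) ^ ((d : ℝ) + 1) :=
          Real.rpow_le_rpow (by positivity) (by linarith) (by positivity)
      _ = 2 ^ ((d : ℝ) + 1) * ‖x‖ ^ ((d : ℝ) + 1) := Real.mul_rpow (by norm_num) (by positivity)
      _ ≤ 2 ^ ((d : ℝ) + 1) * (Real.exp (r * ‖x‖ ^ p) * (N.factorial / r ^ N)) := by
          gcongr; exact h1.trans h3
      _ = Real.exp (r * ‖x‖ ^ p) * (2 ^ ((d : ℝ) + 1) * (N.factorial / r ^ N)) := by ring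
      _ ≤ _ := by rw [hK]; gcongr; linarith

theorem integrable_exp_neg_aniso {r : ℝ} (hr : 0 < r) (ht : 0 < t) (hs : 0 < s) :
    Integrable (fun z : Rn d × Rn d => Real.exp (-(r * aniso t s z))) := by
  have h1 := integrable_exp_neg_mul_norm_rpow (d := d) hr (one_div_pos.2 ht)
  have h2 := integrable_exp_neg_mul_norm_rpow (d := d) hr (one_div_pos.2 hs)
  refine (h1.mul_prod h2).congr (Filter.Eventually.of_forall fun z => ?_)
  simp only [aniso]
  rw [← Real.exp_add]
  congr 1
  ring

end Weights

/-! ### Chains of directional derivatives -/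

section LineChain

variable {V : Type*} [NormedAddCommGroup V] [NormedSpace ℝ V]

/-- `g 0, g 1, g 2, …` are the successive derivatives of `g 0` in direction `v`. -/
def LineChain (v : V) (g : ℕ → V → ℂ) : Prop :=
  ∀ k x, HasLineDerivAt ℝ (g k) (g (k + 1) x) x v

theorem hasLineDerivAt_mul {f g : V → ℂ} {f' g' : ℂ} {x v : V} (hf : HasLineDerivAt ℝ f f' x v)
    (hg : HasLineDerivAt ℝ g g' x v) :
    HasLineDerivAt ℝ (fun y => f y * g y) (f' * g x + f x * g') x v := by
  have := HasDerivAt.mul hf hg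
  simpa [HasLineDerivAt, Pi.mul_def] using this

theorem hasLineDerivAt_const_mul {f : V → ℂ} {f' : ℂ} {x v : V} (c : ℂ)
    (hf : HasLineDerivAt ℝ f f' x v) : HasLineDerivAt ℝ (fun y => c * f y) (c * f') x v :=
  HasDerivAt.const_mul c hf

theorem hasLineDerivAt_sum {ι : Type*} (u : Finset ι) {f : ι → V → ℂ} {f' : ι → ℂ} {x v : V}
    (h : ∀ i ∈ u, HasLineDerivAt ℝ (f i) (f' i) x v) :
    HasLineDerivAt ℝ (fun y => ∑ i ∈ u, f i y) (∑ i ∈ u, f' i) x v :=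
  HasDerivAt.fun_sum h

theorem hasLineDerivAt_dirDeriv (v : V) {f : V → ℂ} (hf : ContDiff ℝ ∞ f) (x : V) :
    HasLineDerivAt ℝ f (dirDeriv v f x) x v :=
  (smooth_differentiable hf x).hasFDerivAt.hasLineDerivAt v

theorem contDiff_dirDeriv_iterate (v : V) (k : ℕ) {f : V → ℂ} (hf : ContDiff ℝ ∞ f) :
    ContDiff ℝ ∞ ((dirDeriv v)^[k] f) := by
  induction k with
  | zero => exact hf
  | succ k ih => rw [Function.iterate_succ_apply']; exact contDiff_dirDeriv v ih

theorem lineChain_dirDeriv (v : V) {f : V → ℂ} (hf : ContDiff ℝ ∞ f) :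
    LineChain v (fun k => (dirDeriv v)^[k] f) := by
  intro k x
  simp only [Function.iterate_succ_apply']
  exact hasLineDerivAt_dirDeriv v (contDiff_dirDeriv_iterate v k hf) x

/-- Line derivatives are unique, so an explicit formula that forms a chain computes the iterated
derivatives. Smoothness has to be known only for the first member; the induction passes it on. -/
theorem LineChain.eq_iterate {v : V} {g : ℕ → V → ℂ} (hg : LineChain v g)
    (h0 : ContDiff ℝ ∞ (g 0)) (k : ℕ) : (dirDeriv v)^[k] (g 0) = g k := by
  induction k with
  | zero => rfl
  | succ k ih =>
    rw [Function.iterate_succ_apply', ih]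
    have hk : ContDiff ℝ ∞ (g k) := ih ▸ contDiff_dirDeriv_iterate v k h0
    funext x
    exact (hasLineDerivAt_dirDeriv v hk x).unique (hg k x)

/-- The Leibniz rule for a family `b j l` whose derivative is `b (j+1) l + b j (l+1)`. -/
theorem lineChain_leibniz {v : V} {b : ℕ → ℕ → V → ℂ}
    (hb : ∀ j l x, HasLineDerivAt ℝ (b j l) (b (j + 1) l x + b j (l + 1) x) x v) :
    LineChain v (fun k x => ∑ p ∈ antidiagonal k, (k.choose p.1 : ℂ) * b p.1 p.2 x) := by
  intro k x
  beta_reduce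
  rw [Finset.sum_antidiagonal_choose_succ_mul (fun i j => b i j x) k]
  have := hasLineDerivAt_sum (antidiagonal k) (x := x) (v := v)
    (f := fun p y => (k.choose p.1 : ℂ) * b p.1 p.2 y)
    (f' := fun p => (k.choose p.1 : ℂ) * (b (p.1 + 1) p.2 x + b p.1 (p.2 + 1) x))
    (fun p _ => hasLineDerivAt_const_mul _ (hb p.1 p.2 x))
  convert this using 1
  rw [← Finset.sum_add_distrib]
  refine Finset.sum_congr rfl fun p hp => ?_
  -- The Pascal recursion for sums over the antidiagonal carries the coefficient `choose p.2` in one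
  -- of its two sums.
  have e : k.choose p.2 = k.choose p.1 := by
    rw [← mem_antidiagonal.1 hp, add_comm, Nat.choose_symm_add]
  rw [e]
  ring

theorem LineChain.mul {v : V} {f g : ℕ → V → ℂ} (hf : LineChain v f) (hg : LineChain v g) :
    LineChain v (fun k x => ∑ p ∈ antidiagonal k,
      (k.choose p.1 : ℂ) * (f p.1 x * g p.2 x)) :=
  lineChain_leibniz (b := fun j l x => f j x * g l x) fun j l x => hasLineDerivAt_mul (hf j x) (hg l x)

/-- Gevrey bounds for the terms of a Leibniz sum. -/
theorem norm_leibniz_le {p h M : ℝ} (hp : 0 < p) (hh : 0 < h) (k : ℕ) {b : ℕ → ℕ → ℂ}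
    (hb : ∀ j l, ‖b j l‖ ≤ M * (h ^ j * (j.factorial : ℝ) ^ p) * (h ^ l * (l.factorial : ℝ) ^ p)) :
    ‖∑ q ∈ antidiagonal k, (k.choose q.1 : ℂ) * b q.1 q.2‖ ≤
      M * ((2 * h) ^ k * (k.factorial : ℝ) ^ p) := by
  have hM : 0 ≤ M := by simpa using (norm_nonneg _).trans (hb 0 0)
  -- Since j! l! ≤ (j+l)!, all terms share one bound apart from the binomial coefficient. Their sum
  -- 2^k is why h becomes 2h.
  have hterm : ∀ q ∈ antidiagonal k, ‖(k.choose q.1 : ℂ) * b q.1 q.2‖ ≤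
      M * (h ^ k * (k.factorial : ℝ) ^ p) * (k.choose q.1 : ℝ) := by
    intro q hq
    rw [mem_antidiagonal] at hq
    rw [norm_mul, Complex.norm_natCast]
    have hfac : (q.1.factorial : ℝ) ^ p * (q.2.factorial : ℝ) ^ p ≤ (k.factorial : ℝ) ^ p := by
      rw [← Real.mul_rpow (by positivity) (by positivity), ← hq]
      refine Real.rpow_le_rpow (by positivity) ?_ hp.le
      exact_mod_cast Nat.le_of_dvd (Nat.factorial_pos _)
        (Nat.factorial_mul_factorial_dvd_factorial_add _ _)
    calc (k.choose q.1 : ℝ) * ‖b q.1 q.2‖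
        ≤ (k.choose q.1 : ℝ) * (M * (h ^ q.1 * (q.1.factorial : ℝ) ^ p) *
          (h ^ q.2 * (q.2.factorial : ℝ) ^ p)) := by gcongr; exact hb _ _
      _ = M * (h ^ k * ((q.1.factorial : ℝ) ^ p * (q.2.factorial : ℝ) ^ p)) *
          (k.choose q.1 : ℝ) := by rw [← hq, pow_add]; ring
      _ ≤ _ := by gcongr
  refine (norm_sum_le _ _).trans ((Finset.sum_le_sum hterm).trans (le_of_eq ?_))
  rw [← Finset.mul_sum]
  have h2 : ∑ q ∈ antidiagonal k, (k.choose q.1 : ℝ) = 2 ^ k := by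
    rw [Finset.Nat.sum_antidiagonal_eq_sum_range_succ (fun i _ => (k.choose i : ℝ))]
    exact_mod_cast Nat.sum_range_choose k
  rw [h2, mul_pow]
  ring

/-- A product of two chains with Gevrey bounds satisfies Gevrey bounds. -/
theorem norm_leibniz_mul_le {p h M N : ℝ} (hp : 0 < p) (hh : 0 < h) (k : ℕ) {f g : ℕ → ℂ}
    (hf : ∀ j, ‖f j‖ ≤ M * (h ^ j * (j.factorial : ℝ) ^ p))
    (hg : ∀ j, ‖g j‖ ≤ N * (h ^ j * (j.factorial : ℝ) ^ p)) :
    ‖∑ q ∈ antidiagonal k, (k.choose q.1 : ℂ) * (f q.1 * g q.2)‖ ≤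
      M * N * ((2 * h) ^ k * (k.factorial : ℝ) ^ p) := by
  refine norm_leibniz_le hp hh k (b := fun j l => f j * g l) fun j l => ?_
  rw [norm_mul]
  refine (mul_le_mul (hf j) (hg l) (norm_nonneg _) ((norm_nonneg _).trans (hf j))).trans
    (le_of_eq (by ring))

/-- The chain rule along a map that stretches direction v to c times w; every derivative contributes
one factor c. It serves x ± y/2 and translations. -/
theorem LineChain.comp_affine {W : Type*} [NormedAddCommGroup W] [NormedSpace ℝ W] {w : W} {v : V}
    {g : ℕ → W → ℂ} (hg : LineChain w g) (A : V → W) (c : ℝ)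
    (hA : ∀ x (τ : ℝ), A (x + τ • v) = A x + (c * τ) • w) :
    LineChain v (fun k x => (c : ℂ) ^ k * g k (A x)) := by
  intro k x
  have h1 : HasDerivAt (fun τ : ℝ => g k (A x + τ • w)) (g (k + 1) (A x)) (c * 0) := by
    rw [mul_zero]; exact hg k (A x)
  have h2 : HasDerivAt (fun τ : ℝ => c * τ) c 0 := by simpa using (hasDerivAt_id (0:ℝ)).const_mul c
  have h3 := (h1.scomp (0:ℝ) h2).const_mul ((c : ℂ) ^ k)
  have e : (c : ℂ) ^ (k + 1) * g (k + 1) (A x) = (c : ℂ) ^ k * c • g (k + 1) (A x) := by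
    rw [Complex.real_smul]; ring
  change HasDerivAt (fun τ : ℝ => (c : ℂ) ^ k * g k (A (x + τ • v))) _ 0
  rw [← e] at h3
  refine h3.congr_of_eventuallyEq (Filter.Eventually.of_forall fun τ => ?_)
  simp [hA]

theorem hasLineDerivAt_exp (L : V →L[ℝ] ℝ) (x v : V) :
    HasLineDerivAt ℝ (fun y => Complex.exp (Complex.I * (L y : ℂ)))
      (Complex.I * (L v : ℂ) * Complex.exp (Complex.I * (L x : ℂ))) x v := by
  have h1 : HasFDerivAt (fun y : V => Complex.exp (Complex.I * (L y : ℂ)))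
      (Complex.exp (Complex.I * (L x : ℂ)) • (Complex.I • (Complex.ofRealCLM.comp L))) x :=
    ((Complex.ofRealCLM.hasFDerivAt.comp x L.hasFDerivAt).const_mul Complex.I).cexp
  have h2 := h1.hasLineDerivAt v
  convert h2 using 1
  simp
  ring

theorem norm_exp_I_mul (r : ℝ) : ‖Complex.exp (Complex.I * (r : ℂ))‖ = 1 := by
  rw [mul_comm, Complex.norm_exp_ofReal_mul_I]

/-! ### Integration by parts in oscillatory integrals. -/

section Integral

variable [MeasurableSpace V] [BorelSpace V] (μ : Measure V)

theorem integrable_mul_exp (L : V →L[ℝ] ℝ) {f : V → ℂ} (hf : Integrable f μ) :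
    Integrable (fun x => f x * Complex.exp (Complex.I * (L x : ℂ))) μ := by
  refine hf.mul_bdd (c := 1) ?_ (Filter.Eventually.of_forall fun x => (norm_exp_I_mul _).le)
  have : Continuous fun x => Complex.exp (Complex.I * (L x : ℂ)) := by fun_prop
  exact this.aestronglyMeasurable

variable [FiniteDimensional ℝ V] [μ.IsAddHaarMeasure]

/-- Differentiating the exponential along v produces the factor i L(v), and integrability of all
members of the chain removes boundary terms. Each integration by parts thus trades one factor L(v)
for one derivative of the amplitude. -/
theorem LineChain.integral_by_parts {v : V} {g : ℕ → V → ℂ} (hg : LineChain v g)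
    (hint : ∀ k, Integrable (g k) μ) (L : V →L[ℝ] ℝ) (k : ℕ) :
    |L v| ^ k * ‖∫ x, g 0 x * Complex.exp (Complex.I * (L x : ℂ)) ∂μ‖ ≤ ∫ x, ‖g k x‖ ∂μ := by
  have step : ∀ k, Complex.I * (L v : ℂ) * ∫ x, g k x * Complex.exp (Complex.I * (L x : ℂ)) ∂μ =
      -∫ x, g (k + 1) x * Complex.exp (Complex.I * (L x : ℂ)) ∂μ := by
    intro k
    have := integral_bilinear_hasLineDerivAt_right_eq_neg_left_of_integrable (μ := μ) (v := v)
      (B := ContinuousLinearMap.mul ℝ ℂ) (f := g k) (f' := g (k + 1))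
      (g := fun x => Complex.exp (Complex.I * (L x : ℂ)))
      (g' := fun x => Complex.I * (L v : ℂ) * Complex.exp (Complex.I * (L x : ℂ)))
      (integrable_mul_exp μ L (hint (k + 1)))
      (by
        have := (integrable_mul_exp μ L (hint k)).const_mul (Complex.I * (L v : ℂ))
        refine this.congr (Filter.Eventually.of_forall fun x => ?_)
        simp only [ContinuousLinearMap.mul_apply']
        ring)
      (integrable_mul_exp μ L (hint k)) (fun x _ => hg k x)
      (fun x _ => hasLineDerivAt_exp L x v)
    simp only [ContinuousLinearMap.mul_apply'] at this
    rw [← this, ← integral_const_mul]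
    congr 1
    funext x
    ring
  have main : ‖∫ x, g k x * Complex.exp (Complex.I * (L x : ℂ)) ∂μ‖ =
      |L v| ^ k * ‖∫ x, g 0 x * Complex.exp (Complex.I * (L x : ℂ)) ∂μ‖ := by
    induction k with
    | zero => simp
    | succ k ih =>
      have := congrArg norm (step k)
      rw [norm_neg, norm_mul, norm_mul, Complex.norm_I, one_mul, Complex.norm_real,
        Real.norm_eq_abs] at this
      rw [← this, ih, pow_succ]
      ring
  rw [← main]
  refine (norm_integral_le_integral_norm _).trans (le_of_eq ?_)
  congr 1
  funext x
  rw [norm_mul, norm_exp_I_mul, mul_one]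

/-- Moment bounds for an oscillatory integral with a Gevrey regular amplitude. -/
theorem LineChain.moment_le {v : V} {g : ℕ → V → ℂ} (hg : LineChain v g)
    (hmeas : ∀ k, AEStronglyMeasurable (g k) μ) {p h M : ℝ} {W : V → ℝ} (hW : Integrable W μ)
    (hb : ∀ k x, ‖g k x‖ ≤ M * (h ^ k * (k.factorial : ℝ) ^ p) * W x) (L : V →L[ℝ] ℝ) (k : ℕ) :
    |L v| ^ k * ‖∫ x, g 0 x * Complex.exp (Complex.I * (L x : ℂ)) ∂μ‖ ≤
      (M * ∫ x, W x ∂μ) * (h ^ k * (k.factorial : ℝ) ^ p) := by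
  have hint : ∀ k, Integrable (g k) μ := fun k =>
    (hW.const_mul _).mono' (hmeas k) (Filter.Eventually.of_forall (hb k))
  refine (hg.integral_by_parts μ hint L k).trans ?_
  refine (integral_mono (hint k).norm (hW.const_mul _) (hb k)).trans (le_of_eq ?_)
  rw [integral_const_mul]
  ring

end Integral

end LineChain

/-! ### Derivative bounds for Gelfand--Shilov functions -/

section PartialDeriv

variable {d : ℕ} {V : Type*} [NormedAddCommGroup V] [NormedSpace ℝ V]

/-- The iterated derivative is an ordered product of commuting operators, so an additional
derivative can be moved into its own slot, which occurs exactly once in the list. -/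
theorem dirDeriv_multiDeriv (v : Fin d → V) (β : Fin d → ℕ) (i : Fin d) {f : V → ℂ}
    (hf : ContDiff ℝ ∞ f) :
    dirDeriv (v i) (multiDeriv v β f) = multiDeriv v (β + Pi.single i 1) f := by
  classical
  have key : ∀ l : List (Fin d), l.Nodup →
      (l.map fun j => dirDerivL (v j) ^ (β + Pi.single i 1 : Fin d → ℕ) j).prod =
      (if i ∈ l then dirDerivL (v i) else 1) * (l.map fun j => dirDerivL (v j) ^ β j).prod := by
    intro l
    induction l with
    | nil => simp
    | cons j l ih =>
      intro hl
      obtain ⟨hjl, hl'⟩ := List.nodup_cons.mp hl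
      rw [List.map_cons, List.map_cons, List.prod_cons, List.prod_cons, ih hl']
      by_cases hij : i = j
      · subst hij
        simp [hjl, pow_succ', mul_assoc]
      · have h1 : (β + Pi.single i 1 : Fin d → ℕ) j = β j := by
          simp [Pi.single_eq_of_ne (Ne.symm hij)]
        rw [h1]
        by_cases hil : i ∈ l
        · simp only [hil, if_true, List.mem_cons, or_true, ← mul_assoc]
          rw [((dirDerivL_commute (v j) (v i)).pow_left (β j)).eq]
        · simp [hil, hij]
  have e1 := multiDeriv_eq v β ⟨f, hf⟩
  have e2 := multiDeriv_eq v (β + Pi.single i 1) ⟨f, hf⟩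
  rw [key _ (List.nodup_finRange d), if_pos (List.mem_finRange i)] at e2
  simp only at e1 e2
  rw [e1, e2]
  rfl

theorem multiDeriv_zero (v : Fin d → V) (f : V → ℂ) : multiDeriv v 0 f = f := by
  have : ∀ l : List (Fin d),
      l.foldr (fun i g => (dirDeriv (v i))^[(0 : Fin d → ℕ) i] g) f = f := by
    intro l
    induction l with
    | nil => rfl
    | cons i l ih => rw [List.foldr_cons, ih]; rfl
  exact this _

theorem iterate_dirDeriv_multiDeriv (v : Fin d → V) (β : Fin d → ℕ) (i : Fin d) (k : ℕ)
    {f : V → ℂ} (hf : ContDiff ℝ ∞ f) :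
    (dirDeriv (v i))^[k] (multiDeriv v β f) = multiDeriv v (β + Pi.single i k) f := by
  induction k with
  | zero => simp
  | succ k ih =>
    rw [Function.iterate_succ_apply', ih, dirDeriv_multiDeriv v _ i hf, add_assoc,
      ← Pi.single_add]

theorem iterate_dirDeriv_eq (v : Fin d → V) (i : Fin d) (k : ℕ) {f : V → ℂ}
    (hf : ContDiff ℝ ∞ f) : (dirDeriv (v i))^[k] f = multiDeriv v (Pi.single i k) f := by
  have := iterate_dirDeriv_multiDeriv v 0 i k hf
  rwa [multiDeriv_zero, zero_add] at this

theorem msize_add (α β : Fin d → ℕ) : msize (α + β) = msize α + msize β := by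
  simp [msize, Finset.sum_add_distrib]

theorem msize_single (i : Fin d) (k : ℕ) : msize (Pi.single i k) = k := by
  simp [msize]

theorem msize_zero : msize (0 : Fin d → ℕ) = 0 := by simp [msize]

theorem mfact_zero : mfact (0 : Fin d → ℕ) = 1 := by simp [mfact]

theorem mfact_le (β : Fin d → ℕ) : mfact β ≤ ((msize β).factorial : ℝ) := by
  unfold mfact msize
  exact_mod_cast Nat.le_of_dvd (Nat.factorial_pos _)
    (Nat.prod_factorial_dvd_factorial_sum Finset.univ β)

theorem mfact_single (i : Fin d) (k : ℕ) : mfact (Pi.single i k) = (k.factorial : ℝ) := by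
  rw [mfact, Finset.prod_eq_single i]
  · simp
  · intro j _ hj; simp [hj]
  · simp

theorem mpow_single (x : Rn d) (i : Fin d) (k : ℕ) : mpow x (Pi.single i k) = x i ^ k := by
  rw [mpow, Finset.prod_eq_single i]
  · simp
  · intro j _ hj; simp [hj]
  · simp

end PartialDeriv

/-! ### Seminorms, exponential decay, and stability under derivatives and coordinate powers. -/

section Bounds

variable {d : ℕ} {t s : ℝ}

theorem gsSeminorm_bound (h : {h : ℝ // 0 < h}) (f : Space t s d) (α β : Fin d → ℕ) (x : Rn d) :
    ‖(mpow x α : ℂ) * partialDeriv β f x‖ ≤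
      gsSeminorm t s d h f * (h.1 ^ (msize α + msize β) * mfact α ^ t * mfact β ^ s) := by
  have h1 := le_ciSup (f.2.2 h.1 h.2) (α, β, x)
  rw [gsQuot, div_le_iff₀ (weight_pos h.2 α β)] at h1
  exact h1

theorem gsSeminorm_le {h : {h : ℝ // 0 < h}} {f : Space t s d} {K : ℝ}
    (H : ∀ α β x, ‖(mpow x α : ℂ) * partialDeriv β f x‖ ≤
      K * (h.1 ^ (msize α + msize β) * mfact α ^ t * mfact β ^ s)) :
    gsSeminorm t s d h f ≤ K := by
  refine ciSup_le fun p => ?_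
  rw [gsQuot, div_le_iff₀ (weight_pos h.2 _ _)]
  exact H _ _ _

theorem gsSeminorm_nonneg (h : {h : ℝ // 0 < h}) (f : Space t s d) : 0 ≤ gsSeminorm t s d h f :=
  apply_nonneg _ _

theorem gsSeminorm_anti {h h' : {h : ℝ // 0 < h}} (hle : h ≤ h') (f : Space t s d) :
    gsSeminorm t s d h' f ≤ gsSeminorm t s d h f := by
  refine gsSeminorm_le fun α β x => (gsSeminorm_bound h f α β x).trans ?_
  have h1 : h.1 ≤ h'.1 := hle
  have := h.2.le
  have := gsSeminorm_nonneg h f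
  have := Real.rpow_pos_of_pos (mfact_pos α) t
  have := Real.rpow_pos_of_pos (mfact_pos β) s
  gcongr

/-- The derivatives of a Gelfand--Shilov function decay exponentially. -/
theorem exists_partialDeriv_bound (ht : 0 < t) (h r : ℝ) (hh : 0 < h) :
    ∃ h₁ : {h : ℝ // 0 < h}, ∀ (f : Space t s d) (β : Fin d → ℕ) (x : Rn d),
      ‖partialDeriv β f x‖ ≤ 2 ^ t * gsSeminorm t s d h₁ f * (h ^ msize β * mfact β ^ s) *
        Real.exp (-(r * ‖x‖ ^ (1 / t))) := by
  obtain ⟨h₀, hh₀, H⟩ := exp_decay_of_moments ht r d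
  -- One small parameter serves twice: below h for the growth in β, below h₀ for the decay rate r in
  -- x.
  have hm : 0 < min h h₀ := lt_min hh hh₀
  refine ⟨⟨min h h₀, hm⟩, fun f β x => ?_⟩
  have hw := Real.rpow_pos_of_pos (mfact_pos β) s
  have hn := gsSeminorm_nonneg ⟨min h h₀, hm⟩ f
  have hle : (min h h₀) ^ msize β ≤ h ^ msize β := by gcongr; exact min_le_left _ _
  have key := H _ hm (min_le_right _ _) x ‖partialDeriv β f x‖
    (gsSeminorm t s d ⟨min h h₀, hm⟩ f * (h ^ msize β * mfact β ^ s)) (norm_nonneg _) ?_ ?_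
  · refine key.trans (le_of_eq (by ring))
  · have := gsSeminorm_bound ⟨min h h₀, hm⟩ f 0 β x
    simp only [mpow, Pi.zero_apply, pow_zero, Finset.prod_const_one, Complex.ofReal_one, one_mul,
      msize_zero, mfact_zero, Real.one_rpow, zero_add, mul_one] at this
    refine this.trans ?_
    gcongr
  · intro i k
    have := gsSeminorm_bound ⟨min h h₀, hm⟩ f (Pi.single i k) β x
    rw [mpow_single, norm_mul, Complex.norm_real, Real.norm_eq_abs, abs_pow, msize_single,
      mfact_single] at this
    refine this.trans ?_
    calc gsSeminorm t s d ⟨min h h₀, hm⟩ f * ((min h h₀) ^ (k + msize β) *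
          (k.factorial : ℝ) ^ t * mfact β ^ s)
        = gsSeminorm t s d ⟨min h h₀, hm⟩ f * ((min h h₀) ^ msize β * mfact β ^ s) *
          ((min h h₀) ^ k * (k.factorial : ℝ) ^ t) := by rw [pow_add]; ring
      _ ≤ _ := by gcongr

theorem norm_mpow_le (ht : 0 < t) {h : ℝ} (hh : 0 < h) (x : Rn d) (α : Fin d → ℕ) :
    ‖(mpow x α : ℂ)‖ ≤
      Real.exp (d * t / h ^ (1 / t) * ‖x‖ ^ (1 / t)) * (h ^ msize α * mfact α ^ t) := by
  simp only [Complex.norm_real, mpow, Real.norm_eq_abs, Finset.abs_prod, abs_pow]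
  rw [weight_split]
  calc ∏ i, |x i| ^ α i ≤ ∏ i : Fin d, (Real.exp (t * (‖x‖ / h) ^ (1 / t)) *
        (h ^ α i * ((α i).factorial : ℝ) ^ t)) := by
        refine Finset.prod_le_prod (fun i _ => by positivity) fun i _ => ?_
        refine (pow_le_exp_mul ht hh (abs_nonneg _) _).trans ?_
        gcongr
        exact abs_coord_le x i
    _ = _ := by
        rw [Finset.prod_mul_distrib, Finset.prod_const, Finset.card_univ, Fintype.card_fin,
          ← Real.exp_nat_mul, Real.div_rpow (norm_nonneg _) hh.le]
        congr 2
        ring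

/-- Exponentially decaying derivatives bound the seminorms. -/
theorem gsSeminorm_le_of_decay (ht : 0 < t) (h : {h : ℝ // 0 < h}) {f : Space t s d} {K : ℝ}
    (H : ∀ β x, ‖partialDeriv β f x‖ ≤ K * (h.1 ^ msize β * mfact β ^ s) *
      Real.exp (-(d * t / h.1 ^ (1 / t) * ‖x‖ ^ (1 / t)))) :
    gsSeminorm t s d h f ≤ K := by
  refine gsSeminorm_le fun α β x => ?_
  rw [norm_mul]
  have := Real.rpow_pos_of_pos (mfact_pos α) t
  have := h.2
  refine (mul_le_mul (norm_mpow_le ht h.2 x α) (H β x) (norm_nonneg _) (by positivity)).trans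
    (le_of_eq ?_)
  rw [Real.exp_neg, pow_add]
  field_simp

theorem partialDeriv_translate {f : Rn d → ℂ} (hf : ContDiff ℝ ∞ f) (β : Fin d → ℕ) (a y : Rn d) :
    partialDeriv β (fun y => f (y - a)) y = partialDeriv β f (y - a) := by
  have := multiDeriv_comm stdVec β (fun g y => g (y - a)) (fun i g _ => by
    funext y
    simp only [dirDeriv]
    rw [fderiv_comp_sub]) hf
  exact congrFun this y

/-- The seminorms of a time-frequency shift grow at most exponentially. -/
theorem exists_timeFreqShift_bound (ht : 0 < t) (hs : 0 < s) (ψ : Space t s d)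
    (h : {h : ℝ // 0 < h}) : ∃ C ν : ℝ, 0 ≤ C ∧ 0 < ν ∧ ∀ x ξ : Rn d,
      gsSeminorm t s d h (timeFreqShift ht hs x ξ ψ) ≤ C * Real.exp (ν * aniso t s (x, ξ)) := by
  have hh := h.2
  -- The rate of decay in y that `gsSeminorm_le_of_decay` demands. The larger r below allows
  -- e^{-r|y-x|^{1/t}} ≤ e^{r|x|^{1/t}} e^{-q|y|^{1/t}} by the quasi-triangle inequality.
  set q : ℝ := d * t / h.1 ^ (1 / t) with hq
  have hq0 : 0 ≤ q := by positivity
  set r : ℝ := 2 ^ (1 / t) * q with hr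
  have hr0 : 0 ≤ r := by positivity
  obtain ⟨h₁, H⟩ := exists_partialDeriv_bound (s := s) (d := d) ht (h.1 / 2) r (by positivity)
  set C : ℝ := 2 ^ t * gsSeminorm t s d h₁ ψ with hC
  have hC0 : 0 ≤ C := mul_nonneg (by positivity) (gsSeminorm_nonneg _ _)
  -- The cost of derivatives falling on the plane wave: each of the d coordinates contributes a
  -- factor exp(s(2‖ξ‖/h)^{1/s}).
  set κ : ℝ := d * (s * (2 / h.1) ^ (1 / s)) with hκ
  have hκ0 : 0 ≤ κ := by positivity
  -- The summand 1 keeps the rate positive also when d = 0, where r and κ vanish.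
  refine ⟨C, r + κ + 1, hC0, by positivity, fun x ξ => ?_⟩
  have main : gsSeminorm t s d h (timeFreqShift ht hs x ξ ψ) ≤
      C * Real.exp (r * ‖x‖ ^ (1 / t) + κ * ‖ξ‖ ^ (1 / s)) := by
    refine gsSeminorm_le_of_decay ht h fun β y => ?_
    have hsm : ContDiff ℝ ∞ (fun y => ψ (y - x)) := ψ.2.1.comp (contDiff_id.sub contDiff_const)
    set M : ℝ := Real.exp (s * (‖ξ‖ / (h.1 / 2)) ^ (1 / s)) with hM
    have hM1 : 1 ≤ M := Real.one_le_exp (by positivity)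
    -- Conjugation by the plane wave turns ∂_i into ∂_i + iξ_i, whose powers expand binomially;
    -- starting from h/2 leaves room for the resulting factor 2.
    have key := prod_bound hs (half_pos hh) hM1 stdVec (fun i => Complex.I * (ξ i : ℂ))
      (fun i k => by
        have : ‖Complex.I * (ξ i : ℂ)‖ = |ξ i| := by simp
        rw [this]
        refine (pow_le_exp_mul hs (half_pos hh) (abs_nonneg _) k).trans ?_
        rw [hM]
        gcongr
        exact abs_coord_le ξ i) β y (List.finRange d) (List.nodup_finRange d)
      ⟨fun y => ψ (y - x), hsm⟩ (C * Real.exp (-(r * ‖y - x‖ ^ (1 / t)))) (by positivity)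
      (fun γ => by
        have e := multiDeriv_eq stdVec γ ⟨fun y => ψ (y - x), hsm⟩
        rw [← e]
        change ‖partialDeriv γ (fun y => ψ (y - x)) y‖ ≤ _
        rw [partialDeriv_translate ψ.2.1, ← List.ofFn_eq_map, List.prod_ofFn, ← weight_split]
        refine (H ψ γ (y - x)).trans (le_of_eq (by ring)))
    have e := multiDeriv_planeWave_mul ξ β ⟨fun y => ψ (y - x), hsm⟩
    change ‖partialDeriv β (fun y => planeWave ξ y * ψ (y - x)) y‖ ≤ _
    simp only at e
    rw [e]
    rw [norm_mul, norm_planeWave, one_mul]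
    refine key.trans ?_
    rw [← List.ofFn_eq_map, List.prod_ofFn, Finset.prod_mul_distrib, ← weight_split]
    simp only [Finset.prod_const, Finset.card_univ, Fintype.card_fin]
    have e2 : (2 : ℝ) * (h.1 / 2) = h.1 := by ring
    have hMd : M ^ d = Real.exp (κ * ‖ξ‖ ^ (1 / s)) := by
      rw [hM, ← Real.exp_nat_mul, hκ]
      congr 1
      have : ‖ξ‖ / (h.1 / 2) = (2 / h.1) * ‖ξ‖ := by field_simp
      rw [this, Real.mul_rpow (by positivity) (by positivity)]
      ring
    have hexp : Real.exp (-(r * ‖y - x‖ ^ (1 / t))) ≤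
        Real.exp (r * ‖x‖ ^ (1 / t)) * Real.exp (-(q * ‖y‖ ^ (1 / t))) := by
      rw [← Real.exp_add]
      refine Real.exp_le_exp.2 ?_
      have h1 := norm_add_rpow_le (y - x) x (one_div_nonneg.2 ht.le)
      rw [sub_add_cancel] at h1
      have h2 := mul_le_mul_of_nonneg_left h1 hq0
      rw [hr]
      linarith
    have := Real.rpow_pos_of_pos (mfact_pos β) s
    rw [e2, hMd, Real.exp_add]
    calc C * Real.exp (-(r * ‖y - x‖ ^ (1 / t))) * (Real.exp (κ * ‖ξ‖ ^ (1 / s)) *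
          (h.1 ^ msize β * mfact β ^ s))
        ≤ C * (Real.exp (r * ‖x‖ ^ (1 / t)) * Real.exp (-(q * ‖y‖ ^ (1 / t)))) *
          (Real.exp (κ * ‖ξ‖ ^ (1 / s)) * (h.1 ^ msize β * mfact β ^ s)) := by gcongr
      _ = _ := by ring
  refine main.trans ?_
  gcongr
  simp only [aniso]
  have h1 : 0 ≤ ‖x‖ ^ (1 / t) := by positivity
  have h2 : 0 ≤ ‖ξ‖ ^ (1 / s) := by positivity
  nlinarith [mul_nonneg hr0 h2, mul_nonneg hκ0 h1]

/-- Gevrey bounds with exponential decay for all derivatives of `f` in coordinate directions. -/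
def LineBound (t s h r M : ℝ) (f : Rn d → ℂ) : Prop :=
  ContDiff ℝ ∞ f ∧ (∀ x, ‖f x‖ ≤ M * Real.exp (-(r * ‖x‖ ^ (1 / t)))) ∧ ∀ (i : Fin d) (k : ℕ) (x : Rn d), ‖(dirDeriv (stdVec i))^[k] f x‖ ≤
    M * (h ^ k * (k.factorial : ℝ) ^ s) * Real.exp (-(r * ‖x‖ ^ (1 / t)))

/-- Any coordinate direction yields the undifferentiated bound by taking k = 0. That bound is a
separate clause of `LineBound` because in dimension zero there is no direction. -/
theorem lineBound_of_coord {h r M : ℝ} {f : Rn d → ℂ} (i₀ : Fin d) (hf : ContDiff ℝ ∞ f)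
    (H : ∀ (i : Fin d) (k : ℕ) (x : Rn d), ‖(dirDeriv (stdVec i))^[k] f x‖ ≤
      M * (h ^ k * (k.factorial : ℝ) ^ s) * Real.exp (-(r * ‖x‖ ^ (1 / t)))) :
    LineBound t s h r M f :=
  ⟨hf, fun x => by simpa using H i₀ 0 x, H⟩

theorem LineBound.nonneg {h r M : ℝ} {f : Rn d → ℂ} (hf : LineBound t s h r M f) : 0 ≤ M :=
  nonneg_of_mul_nonneg_left ((norm_nonneg _).trans (hf.2.1 0)) (Real.exp_pos _)

/-- From (j+k)! ≤ 2^{j+k} j! k!, the orders j and k separate. The parameter h' controls derivatives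
already taken, h those still to come. -/
theorem exists_lineBound_deriv (ht : 0 < t) (hs : 0 < s) {h h' : ℝ} (r : ℝ) (hh : 0 < h)
    (hh' : 0 < h') : ∃ h₁ : {h : ℝ // 0 < h}, ∀ (f : Space t s d) (i : Fin d) (j : ℕ),
      LineBound t s h r (2 ^ t * gsSeminorm t s d h₁ f * (h' ^ j * (j.factorial : ℝ) ^ s))
        ((dirDeriv (stdVec i))^[j] f) := by
  set m : ℝ := min h h' with hm
  have hm0 : 0 < m := lt_min hh hh'
  -- Dividing by 2^s cancels the factor (2^s)^{j+k} from the split of (j+k)!^s.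
  obtain ⟨h₁, H⟩ := exists_partialDeriv_bound (s := s) (d := d) ht (m / 2 ^ s) r (by positivity)
  refine ⟨h₁, fun f i j => lineBound_of_coord i (contDiff_dirDeriv_iterate _ _ f.2.1)
    fun l k x => ?_⟩
  rw [iterate_dirDeriv_eq stdVec i j f.2.1, iterate_dirDeriv_multiDeriv stdVec _ l k f.2.1]
  refine (H f _ x).trans ?_
  have hn := gsSeminorm_nonneg h₁ f
  rw [msize_add, msize_single, msize_single]
  have h1 : mfact (Pi.single i j + Pi.single l k) ^ s ≤
      (2 ^ s) ^ (j + k) * ((j.factorial : ℝ) ^ s * (k.factorial : ℝ) ^ s) := by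
    have h2 := mfact_le (Pi.single i j + Pi.single l k)
    rw [msize_add, msize_single, msize_single] at h2
    have h3 : ((j + k).factorial : ℝ) ≤ 2 ^ (j + k) * ((j.factorial : ℝ) * (k.factorial : ℝ)) := by
      rw [← Nat.add_choose_mul_factorial_mul_factorial]
      push_cast
      rw [mul_assoc]
      gcongr
      exact_mod_cast Nat.choose_le_two_pow _ _
    refine (Real.rpow_le_rpow (mfact_pos _).le (h2.trans h3) hs.le).trans (le_of_eq ?_)
    rw [Real.mul_rpow (by positivity) (by positivity), Real.mul_rpow (by positivity) (by positivity),
      ← Real.rpow_natCast, ← Real.rpow_natCast, ← Real.rpow_mul (by norm_num),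
      ← Real.rpow_mul (by norm_num), mul_comm s]
  have h4 : (m / 2 ^ s) ^ (j + k) * ((2 ^ s) ^ (j + k) *
      ((j.factorial : ℝ) ^ s * (k.factorial : ℝ) ^ s)) ≤
      (h' ^ j * (j.factorial : ℝ) ^ s) * (h ^ k * (k.factorial : ℝ) ^ s) := by
    rw [div_pow, ← mul_assoc, div_mul_cancel₀ _ (by positivity), pow_add]
    calc m ^ j * m ^ k * ((j.factorial : ℝ) ^ s * (k.factorial : ℝ) ^ s)
        ≤ h' ^ j * h ^ k * ((j.factorial : ℝ) ^ s * (k.factorial : ℝ) ^ s) := by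
          gcongr
          · exact min_le_right _ _
          · exact min_le_left _ _
      _ = _ := by ring
  calc _ ≤ 2 ^ t * gsSeminorm t s d h₁ f * ((m / 2 ^ s) ^ (j + k) * ((2 ^ s) ^ (j + k) *
        ((j.factorial : ℝ) ^ s * (k.factorial : ℝ) ^ s))) * Real.exp (-(r * ‖x‖ ^ (1 / t))) := by
        gcongr
    _ ≤ 2 ^ t * gsSeminorm t s d h₁ f * ((h' ^ j * (j.factorial : ℝ) ^ s) *
        (h ^ k * (k.factorial : ℝ) ^ s)) * Real.exp (-(r * ‖x‖ ^ (1 / t))) := by gcongr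
    _ = _ := by ring

theorem exists_lineBound (ht : 0 < t) {h : ℝ} (r : ℝ) (hh : 0 < h) :
    ∃ h₁ : {h : ℝ // 0 < h}, ∀ f : Space t s d,
      LineBound t s h r (2 ^ t * gsSeminorm t s d h₁ f) f := by
  obtain ⟨h₁, H⟩ := exists_partialDeriv_bound (s := s) (d := d) ht h r hh
  refine ⟨h₁, fun f => ⟨f.2.1, fun x => ?_, fun i k x => ?_⟩⟩
  · have := H f 0 x
    rwa [partialDeriv_zero, msize_zero, mfact_zero, pow_zero, Real.one_rpow, mul_one, mul_one] at this
  rw [iterate_dirDeriv_eq stdVec i k f.2.1]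
  have := H f (Pi.single i k) x
  rwa [msize_single, mfact_single] at this

/-- For k > j the falling factorial vanishes, so the truncated exponent j - k is harmless. The
powers of the i-th component of the direction vector switch the derivatives off when l ≠ i. -/
theorem lineChain_coord_pow (i l : Fin d) (j : ℕ) :
    LineChain (stdVec l) (fun k (x : Rn d) =>
      ((j.descFactorial k : ℝ) * x i ^ (j - k) * (stdVec l i) ^ k : ℝ)) := by
  intro k x
  have h1 : HasDerivAt (fun τ : ℝ => (x + τ • stdVec l : Rn d) i) (stdVec l i) 0 := by
    have : HasDerivAt (fun τ : ℝ => x i + τ * stdVec l i) (stdVec l i) 0 := by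
      simpa using ((hasDerivAt_id (0:ℝ)).mul_const (stdVec l i)).const_add (x i)
    exact this
  have h2 := (((h1.pow (j - k)).const_mul (j.descFactorial k : ℝ)).mul_const
    ((stdVec l i) ^ k)).ofReal_comp
  refine HasDerivAt.congr_deriv h2 ?_
  beta_reduce
  rw [Nat.descFactorial_succ, Nat.sub_sub]
  push_cast
  simp
  ring

/-- Multiplication by powers of a coordinate preserves `LineBound`; here `s + t > 1` is used. -/
theorem exists_lineBound_coord_pow (ht : 0 < t) (hs : 0 < s) (hst : 1 < s + t) {h h' : ℝ} (r : ℝ)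
    (hh : 0 < h) (hh' : 0 < h') : ∃ (h₁ : {h : ℝ // 0 < h}) (C : ℝ), 0 ≤ C ∧
      ∀ (f : Space t s d) (i : Fin d) (j : ℕ),
      LineBound t s h r (C * gsSeminorm t s d h₁ f * (h' ^ j * (j.factorial : ℝ) ^ t))
        (fun x => ((x i : ℝ) : ℂ) ^ j * f x) := by
  -- Halving h pays for the binomial sum 2^n, halving h' for the bound 2^j a! on the falling
  -- factorial.
  set g : ℝ := h / 2 with hg
  set g' : ℝ := h' / 2 with hg'
  have hg0 : 0 < g := by positivity
  have hg0' : 0 < g' := by positivity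
  -- The growth rate of e^{r'|x|^{1/t}} in the bound for the remaining power |x_i|^c; the window is
  -- therefore required to decay at rate r + r'.
  set r' : ℝ := t / g' ^ (1 / t) with hr'
  obtain ⟨h₁, H⟩ := exists_lineBound (d := d) (s := s) ht (r + r') hg0
  have hp : 0 < s + t - 1 := by linarith
  set K : ℝ := Real.exp ((s + t - 1) * (1 / (g * g') / 1) ^ (1 / (s + t - 1))) with hK
  refine ⟨h₁, K * 2 ^ t, by positivity, fun f i j => ?_⟩
  have hcoord : ContDiff ℝ ∞ (fun x : Rn d => ((x i : ℝ) : ℂ)) :=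
    Complex.ofRealCLM.contDiff.comp (EuclideanSpace.proj (𝕜 := ℝ) i).contDiff
  have hsm : ContDiff ℝ ∞ (fun x : Rn d => ((x i : ℝ) : ℂ) ^ j * f x) :=
    (hcoord.pow j).mul f.2.1
  refine lineBound_of_coord i hsm fun l n x => ?_
  have hchain := (lineChain_coord_pow i l j).mul (lineChain_dirDeriv (stdVec l) f.2.1)
  have e := hchain.eq_iterate (by simpa using hsm) n
  have e0 : (fun x : Rn d => ∑ p ∈ antidiagonal 0, (Nat.choose 0 p.1 : ℂ) *
      (((((j.descFactorial p.1 : ℝ) * x i ^ (j - p.1) * (stdVec l i) ^ p.1 : ℝ)) : ℂ) *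
        (dirDeriv (stdVec l))^[p.2] f x)) = fun x => ((x i : ℝ) : ℂ) ^ j * f x := by
    funext x; simp
  rw [e0] at e
  rw [e]
  have hN := gsSeminorm_nonneg h₁ f
  set N : ℝ := gsSeminorm t s d h₁ f with hNdef
  have hterm : ∀ p ∈ antidiagonal n, ‖(n.choose p.1 : ℂ) *
      (((((j.descFactorial p.1 : ℝ) * x i ^ (j - p.1) * (stdVec l i) ^ p.1 : ℝ)) : ℂ) *
        (dirDeriv (stdVec l))^[p.2] f x)‖ ≤
      K * 2 ^ t * N * (g' ^ j * (j.factorial : ℝ) ^ t) * 2 ^ j *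
        (g ^ n * (n.factorial : ℝ) ^ s) * Real.exp (-(r * ‖x‖ ^ (1 / t))) *
        (n.choose p.1 : ℝ) := by
    rintro ⟨a, b⟩ hab
    rw [mem_antidiagonal] at hab
    simp only at hab ⊢
    by_cases haj : a ≤ j
    swap
    · rw [Nat.descFactorial_eq_zero_iff_lt.2 (not_le.1 haj)]
      simp only [Nat.cast_zero, zero_mul, Complex.ofReal_zero, mul_zero, norm_zero]
      positivity
    obtain ⟨c, rfl⟩ := Nat.exists_eq_add_of_le haj
    rw [norm_mul, norm_mul, Complex.norm_natCast, Complex.norm_real, Real.norm_eq_abs, abs_mul,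
      abs_mul, abs_pow, abs_pow, Nat.abs_cast, Nat.add_sub_cancel_left]
    have hv : |stdVec l i| ^ a ≤ 1 := by
      refine pow_le_one₀ (abs_nonneg _) ?_
      simp only [stdVec, PiLp.single_apply]
      split_ifs <;> simp
    have hD := (H f).2.2 l b x
    have hxc : |x i| ^ c ≤ Real.exp (r' * ‖x‖ ^ (1 / t)) * (g' ^ c * (c.factorial : ℝ) ^ t) := by
      refine (pow_le_exp_mul ht hg0' (abs_nonneg _) c).trans ?_
      refine mul_le_mul_of_nonneg_right (Real.exp_le_exp.2 ?_) (by positivity)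
      rw [Real.div_rpow (abs_nonneg _) hg0'.le, hr', div_mul_eq_mul_div, mul_div_assoc]
      have := abs_coord_le x i
      gcongr
    have hdesc : ((a + c).descFactorial a : ℝ) ≤ 2 ^ (a + c) * (a.factorial : ℝ) := by
      rw [Nat.descFactorial_eq_factorial_mul_choose, mul_comm]
      push_cast
      gcongr
      exact_mod_cast Nat.choose_le_two_pow _ _
    -- A derivatives-on-monomial term carries a!, which is to be shared as a!^s with the order of
    -- differentiation and a!^t with the power of the coordinate. The surplus a!^{s+t-1} beats
    -- (gg')^{-a} up to the constant K exactly because s+t-1 > 0.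
    have hfa : (a.factorial : ℝ) ≤
        K * ((g * g') ^ a * ((a.factorial : ℝ) ^ s * (a.factorial : ℝ) ^ t)) := by
      have h1 := pow_le_exp_mul hp one_pos (c := 1 / (g * g')) (by positivity) a
      rw [← hK, one_pow, one_mul, one_div, inv_pow, inv_le_iff_one_le_mul₀ (by positivity)] at h1
      have h2 := mul_le_mul_of_nonneg_right h1 (Nat.cast_nonneg (α := ℝ) a.factorial)
      have h3 : (a.factorial : ℝ) ^ (s + t - 1) * (a.factorial : ℝ) =
          (a.factorial : ℝ) ^ s * (a.factorial : ℝ) ^ t := by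
        rw [← Real.rpow_add (by positivity), ← Real.rpow_add_one (by positivity)]
        congr 1
        ring
      rw [one_mul] at h2
      calc (a.factorial : ℝ)
          ≤ K * (a.factorial : ℝ) ^ (s + t - 1) * (g * g') ^ a * (a.factorial : ℝ) := h2
        _ = K * ((g * g') ^ a * ((a.factorial : ℝ) ^ (s + t - 1) * (a.factorial : ℝ))) := by ring
        _ = _ := by rw [h3]
    have hfs : (a.factorial : ℝ) ^ s * (b.factorial : ℝ) ^ s ≤ (n.factorial : ℝ) ^ s := by
      rw [← Real.mul_rpow (by positivity) (by positivity), ← hab]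
      refine Real.rpow_le_rpow (by positivity) ?_ hs.le
      exact_mod_cast Nat.le_of_dvd (Nat.factorial_pos _)
        (Nat.factorial_mul_factorial_dvd_factorial_add _ _)
    have hft : (a.factorial : ℝ) ^ t * (c.factorial : ℝ) ^ t ≤ ((a + c).factorial : ℝ) ^ t := by
      rw [← Real.mul_rpow (by positivity) (by positivity)]
      refine Real.rpow_le_rpow (by positivity) ?_ ht.le
      exact_mod_cast Nat.le_of_dvd (Nat.factorial_pos _)
        (Nat.factorial_mul_factorial_dvd_factorial_add _ _)
    have hexp : Real.exp (r' * ‖x‖ ^ (1 / t)) * Real.exp (-((r + r') * ‖x‖ ^ (1 / t))) =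
        Real.exp (-(r * ‖x‖ ^ (1 / t))) := by
      rw [← Real.exp_add]; congr 1; ring
    calc (n.choose a : ℝ) * (((a + c).descFactorial a : ℝ) * |x i| ^ c * |stdVec l i| ^ a *
          ‖(dirDeriv (stdVec l))^[b] f x‖)
        ≤ (n.choose a : ℝ) * ((2 ^ (a + c) *
          (K * ((g * g') ^ a * ((a.factorial : ℝ) ^ s * (a.factorial : ℝ) ^ t)))) *
          (Real.exp (r' * ‖x‖ ^ (1 / t)) * (g' ^ c * (c.factorial : ℝ) ^ t)) * 1 *
          (2 ^ t * N * (g ^ b * (b.factorial : ℝ) ^ s) *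
            Real.exp (-((r + r') * ‖x‖ ^ (1 / t))))) := by
          gcongr
          exact hdesc.trans (by gcongr)
      _ = K * 2 ^ t * N * (g' ^ (a + c) * ((a.factorial : ℝ) ^ t * (c.factorial : ℝ) ^ t)) *
          2 ^ (a + c) * (g ^ n * ((a.factorial : ℝ) ^ s * (b.factorial : ℝ) ^ s)) *
          (Real.exp (r' * ‖x‖ ^ (1 / t)) * Real.exp (-((r + r') * ‖x‖ ^ (1 / t)))) *
          (n.choose a : ℝ) := by rw [← hab, pow_add g' a c, pow_add g a b, mul_pow]; ring
      _ ≤ _ := by rw [hexp]; gcongr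
  refine (norm_sum_le _ _).trans ((Finset.sum_le_sum hterm).trans (le_of_eq ?_))
  rw [← Finset.mul_sum]
  have h2 : ∑ q ∈ antidiagonal n, (n.choose q.1 : ℝ) = 2 ^ n := by
    rw [Finset.Nat.sum_antidiagonal_eq_sum_range_succ (fun i _ => (n.choose i : ℝ))]
    exact_mod_cast Nat.sum_range_choose n
  rw [h2, hg, hg', div_pow, div_pow]
  field_simp

end Bounds

/-! ### Oscillatory integrals of products -/

section Osc

variable {d : ℕ} {t s : ℝ}

theorem planeWave_eq (ξ y : Rn d) :
    planeWave ξ y = Complex.exp (Complex.I * ((innerSL ℝ ξ y : ℝ) : ℂ)) := by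
  rw [planeWave, innerSL_apply_apply, real_inner_comm]

theorem continuous_planeWave_uncurry : Continuous fun p : Rn d × Rn d => planeWave p.1 p.2 := by
  unfold planeWave
  fun_prop

theorem innerSL_stdVec (ξ : Rn d) (i : Fin d) : innerSL ℝ ξ (stdVec i) = ξ i := by
  simp [stdVec, EuclideanSpace.inner_single_right]

/-- The weight hypothesis splits the decay of the two factors into e^{-rκa} and an integrable
function of y. Gevrey bounds of order s for the product, integrated by parts, give decay of any rate
in ξ. Slopes of modulus at most 1 do not enlarge derivatives. -/
theorem exists_osc_bound (ht : 0 < t) (hs : 0 < s) (R : ℝ) {r κ : ℝ} (hr : 0 < r) (hκ : 0 < κ) :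
    ∃ h C : ℝ, 0 < h ∧ 0 ≤ C ∧ ∀ (f g : Rn d → ℂ) (M N : ℝ), LineBound t s h r M f →
      LineBound t s h r N g → ∀ (c₁ c₂ a : ℝ) (b₁ b₂ : Rn d), |c₁| ≤ 1 → |c₂| ≤ 1 →
      (∀ y : Rn d, κ * (a + ‖y‖ ^ (1 / t)) ≤
        ‖c₁ • y + b₁‖ ^ (1 / t) + ‖c₂ • y + b₂‖ ^ (1 / t)) → ∀ ξ : Rn d,
      ‖∫ y, f (c₁ • y + b₁) * g (c₂ • y + b₂) * planeWave ξ y‖ ≤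
        C * (M * N) * Real.exp (-(r * κ * a)) * Real.exp (-(R * ‖ξ‖ ^ (1 / s))) := by
  obtain ⟨h₀, hh₀, H⟩ := exp_decay_of_moments hs R d
  have hrκ : 0 < r * κ := by positivity
  have hint := integrable_exp_neg_mul_norm_rpow (d := d) hrκ (one_div_pos.2 ht)
  set I : ℝ := ∫ y : Rn d, Real.exp (-(r * κ * ‖y‖ ^ (1 / t))) with hI
  have hI0 : 0 ≤ I := integral_nonneg fun _ => (Real.exp_pos _).le
  refine ⟨h₀ / 2, 2 ^ s * I, by positivity, by positivity, ?_⟩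
  intro f g M N hf hg c₁ c₂ a b₁ b₂ hc₁ hc₂ hw ξ
  have hM := hf.nonneg
  have hN := hg.nonneg
  set W : Rn d → ℝ := fun y => Real.exp (-(r * κ * a)) * Real.exp (-(r * κ * ‖y‖ ^ (1 / t)))
    with hW
  have hWint : Integrable W := hint.const_mul _
  have hexp : ∀ y, Real.exp (-(r * ‖c₁ • y + b₁‖ ^ (1 / t))) *
      Real.exp (-(r * ‖c₂ • y + b₂‖ ^ (1 / t))) ≤ W y := by
    intro y
    rw [hW]
    simp only
    rw [← Real.exp_add, ← Real.exp_add]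
    refine Real.exp_le_exp.2 ?_
    have := mul_le_mul_of_nonneg_left (hw y) hr.le
    linarith
  have hcF : Continuous fun y : Rn d => f (c₁ • y + b₁) * g (c₂ • y + b₂) := by
    have h1 := hf.1.continuous
    have h2 := hg.1.continuous
    fun_prop
  set A : ℝ := ‖∫ y, f (c₁ • y + b₁) * g (c₂ • y + b₂) * planeWave ξ y‖ with hA
  have key := H h₀ hh₀ le_rfl ξ A (M * N * (Real.exp (-(r * κ * a)) * I)) (norm_nonneg _) ?_ ?_
  · refine key.trans (le_of_eq (by ring))
  · rw [hA]
    have hbd : ∀ y, ‖f (c₁ • y + b₁) * g (c₂ • y + b₂) * planeWave ξ y‖ ≤ M * N * W y := by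
      intro y
      rw [norm_mul, norm_planeWave, mul_one, norm_mul]
      calc _ ≤ (M * Real.exp (-(r * ‖c₁ • y + b₁‖ ^ (1 / t)))) *
            (N * Real.exp (-(r * ‖c₂ • y + b₂‖ ^ (1 / t)))) := by
            gcongr
            · exact hf.2.1 _
            · exact hg.2.1 _
        _ = M * N * (Real.exp (-(r * ‖c₁ • y + b₁‖ ^ (1 / t))) *
            Real.exp (-(r * ‖c₂ • y + b₂‖ ^ (1 / t)))) := by ring
        _ ≤ _ := by gcongr; exact hexp y
    refine (norm_integral_le_of_norm_le (hWint.const_mul _)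
      (Filter.Eventually.of_forall hbd)).trans (le_of_eq ?_)
    rw [integral_const_mul, hW, integral_const_mul]
  · intro i k
    have ch := fun (φ : Rn d → ℂ) (hφ : ContDiff ℝ ∞ φ) (c : ℝ) (b : Rn d) =>
      (lineChain_dirDeriv (stdVec i) hφ).comp_affine (v := stdVec i) (fun y => c • y + b) c
        (fun x τ => by
          simp only [smul_add, smul_smul]
          abel)
    have hch := (ch f hf.1 c₁ b₁).mul (ch g hg.1 c₂ b₂)
    have hbound : ∀ (φ : Rn d → ℂ) (K : ℝ), LineBound t s (h₀ / 2) r K φ → ∀ (c : ℝ) (b : Rn d),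
        |c| ≤ 1 → ∀ (k : ℕ) (y : Rn d),
        ‖(c : ℂ) ^ k * (dirDeriv (stdVec i))^[k] φ (c • y + b)‖ ≤
          (K * Real.exp (-(r * ‖c • y + b‖ ^ (1 / t)))) *
            ((h₀ / 2) ^ k * (k.factorial : ℝ) ^ s) := by
      intro φ K hφ c b hc k y
      rw [norm_mul, norm_pow, Complex.norm_real, Real.norm_eq_abs]
      refine (mul_le_of_le_one_left (norm_nonneg _) (pow_le_one₀ (abs_nonneg _) hc)).trans ?_
      exact (hφ.2.2 i k _).trans (le_of_eq (by ring))
    have hmom := hch.moment_le volume (fun k => by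
        refine Continuous.aestronglyMeasurable ?_
        have h1 := fun m => (contDiff_dirDeriv_iterate (stdVec i) m hf.1).continuous
        have h2 := fun m => (contDiff_dirDeriv_iterate (stdVec i) m hg.1).continuous
        fun_prop) (p := s) (h := h₀) (M := M * N) hWint (fun k y => by
        have h1 := norm_leibniz_mul_le hs (half_pos hh₀) k
          (fun j => hbound f M hf c₁ b₁ hc₁ j y) (fun j => hbound g N hg c₂ b₂ hc₂ j y)
        refine h1.trans ?_
        rw [mul_div_cancel₀ _ (two_ne_zero)]
        calc _ = M * N * (h₀ ^ k * (k.factorial : ℝ) ^ s) *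
              (Real.exp (-(r * ‖c₁ • y + b₁‖ ^ (1 / t))) *
                Real.exp (-(r * ‖c₂ • y + b₂‖ ^ (1 / t)))) := by ring
          _ ≤ _ := by gcongr; exact hexp y) (innerSL ℝ ξ) k
    rw [innerSL_stdVec] at hmom
    rw [hA]
    simp only [planeWave_eq]
    refine le_trans (le_of_eq ?_) (hmom.trans (le_of_eq ?_))
    · simp
    · rw [hW, integral_const_mul]

/-- Here a = ‖x‖^{1/t} and the decay rate of the factors is R'/κ, so position and frequency decay at
the same rate and combine into the anisotropic gauge. -/
theorem exists_osc_bound' (ht : 0 < t) (hs : 0 < s) (R : ℝ) {κ : ℝ} (hκ : 0 < κ) :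
    ∃ h r C : ℝ, 0 < h ∧ 0 < r ∧ 0 ≤ C ∧ ∀ (f g : Rn d → ℂ) (M N : ℝ), LineBound t s h r M f →
      LineBound t s h r N g → ∀ (c₁ c₂ : ℝ) (x b₁ b₂ : Rn d), |c₁| ≤ 1 → |c₂| ≤ 1 →
      (∀ y : Rn d, κ * (‖x‖ ^ (1 / t) + ‖y‖ ^ (1 / t)) ≤
        ‖c₁ • y + b₁‖ ^ (1 / t) + ‖c₂ • y + b₂‖ ^ (1 / t)) → ∀ ξ : Rn d,
      ‖∫ y, f (c₁ • y + b₁) * g (c₂ • y + b₂) * planeWave ξ y‖ ≤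
        C * (M * N) * Real.exp (-(R * aniso t s (x, ξ))) := by
  set R' : ℝ := max R 1
  have hR' : 0 < R' := lt_of_lt_of_le one_pos (le_max_right _ _)
  have hr : 0 < R' / κ := by positivity
  obtain ⟨h, C, hh, hC, H⟩ := exists_osc_bound (d := d) ht hs R' hr hκ
  refine ⟨h, R' / κ, C, hh, hr, hC, fun f g M N hf hg c₁ c₂ x b₁ b₂ hc₁ hc₂ hw ξ => ?_⟩
  have hM := hf.nonneg
  have hN := hg.nonneg
  refine (H f g M N hf hg c₁ c₂ _ b₁ b₂ hc₁ hc₂ hw ξ).trans ?_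
  rw [mul_assoc, ← Real.exp_add, div_mul_cancel₀ _ hκ.ne', aniso]
  gcongr
  have h1 : 0 ≤ ‖x‖ ^ (1 / t) + ‖ξ‖ ^ (1 / s) := by positivity
  have h2 := mul_le_mul_of_nonneg_right (le_max_left R 1) h1
  simp only
  change _ ≤ -(R * _)
  have h3 : R' = max R 1 := rfl
  rw [h3]
  linarith

/-! ### The bilinear short-time Fourier transform -/

/-- The integral of `f` against the time-frequency shifts of `ψ`. -/
def analysis (ht : 0 < t) (hs : 0 < s) (ψ f : Space t s d) (w : Rn d × Rn d) : ℂ :=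
  ∫ y : Rn d, f y * timeFreqShift ht hs w.1 w.2 ψ y

theorem timeFreqShift_apply (ht : 0 < t) (hs : 0 < s) (x ξ : Rn d) (ψ : Space t s d) (y : Rn d) :
    timeFreqShift ht hs x ξ ψ y = planeWave ξ y * ψ (y - x) := rfl

theorem exists_analysis_bound (ht : 0 < t) (hs : 0 < s) (ψ : Space t s d) (R : ℝ) :
    ∃ (h : {h : ℝ // 0 < h}) (C : ℝ), 0 ≤ C ∧ ∀ (f : Space t s d) (w : Rn d × Rn d),
      ‖analysis ht hs ψ f w‖ ≤ C * gsSeminorm t s d h f * Real.exp (-(R * aniso t s w)) := by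
  have hp : (0 : ℝ) < 2 ^ (1 / t) := by positivity
  -- Since w₁ = y - (y - w₁), the quasi-triangle inequality bounds ‖w₁‖^{1/t} with constant 2^{1/t};
  -- the extra 1 accounts for ‖y‖^{1/t} itself.
  have hκ : (0 : ℝ) < 1 / (2 ^ (1 / t) + 1) := by positivity
  obtain ⟨h, r, C, hh, hr, hC, H⟩ := exists_osc_bound' (d := d) ht hs R hκ
  obtain ⟨h₁, H₁⟩ := exists_lineBound (d := d) (s := s) ht r hh
  refine ⟨h₁, C * (2 ^ t * (2 ^ t * gsSeminorm t s d h₁ ψ)), ?_, fun f w => ?_⟩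
  · have := gsSeminorm_nonneg h₁ ψ
    positivity
  have key := H f ψ _ _ (H₁ f) (H₁ ψ) 1 1 w.1 0 (-w.1) (by simp) (by simp) (fun y => by
    have h1 := norm_sub_rpow_le y (y - w.1) (one_div_nonneg.2 ht.le)
    rw [sub_sub_cancel] at h1
    have h2 : 0 ≤ ‖y - w.1‖ ^ (1 / t) := by positivity
    rw [one_smul, add_zero, one_div_mul_eq_div, div_le_iff₀ (by positivity), ← sub_eq_add_neg]
    linarith) w.2
  simp only [one_smul, add_zero, ← sub_eq_add_neg] at key
  have e : analysis ht hs ψ f w = ∫ y, f y * ψ (y - w.1) * planeWave w.2 y := by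
    refine integral_congr_ae (Filter.Eventually.of_forall fun y => ?_)
    simp only [timeFreqShift_apply]
    ring
  rw [e]
  refine key.trans (le_of_eq ?_)
  ring

/-! ### The bilinear cross-Wigner transform -/

/-- The bilinear cross-Wigner transform `∫ f(x + y/2) g(x - y/2) e^{i⟨y, ξ⟩} dy`. -/
def crossT (f g : Rn d → ℂ) (X : Rn d × Rn d) : ℂ :=
  ∫ y : Rn d, f (X.1 + (1 / 2 : ℝ) • y) * g (X.1 - (1 / 2 : ℝ) • y) * planeWave X.2 y

/-- The points x ± y/2 have sum 2x and difference y, so decay at both points is decay in x and y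
jointly. -/
theorem cross_weight_le (ht : 0 < t) (x y : Rn d) : ‖x‖ ^ (1 / t) + ‖y‖ ^ (1 / t) ≤
    2 * 2 ^ (1 / t) * (‖x + (1 / 2 : ℝ) • y‖ ^ (1 / t) + ‖x - (1 / 2 : ℝ) • y‖ ^ (1 / t)) := by
  have hp : 0 ≤ 1 / t := by positivity
  set a := x + (1 / 2 : ℝ) • y with ha
  set b := x - (1 / 2 : ℝ) • y with hb
  have e1 : a - b = y := by rw [ha, hb]; module
  have e2 : a + b = (2 : ℝ) • x := by rw [ha, hb]; module
  have h1 := norm_sub_rpow_le a b hp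
  have h2 := norm_add_rpow_le a b hp
  rw [e1] at h1
  rw [e2, norm_smul, Real.norm_eq_abs, abs_two] at h2
  have h3 : ‖x‖ ^ (1 / t) ≤ (2 * ‖x‖) ^ (1 / t) :=
    Real.rpow_le_rpow (norm_nonneg _) (by linarith [norm_nonneg x]) hp
  linarith

theorem exists_crossT_bound (ht : 0 < t) (hs : 0 < s) (R : ℝ) :
    ∃ h r C : ℝ, 0 < h ∧ 0 < r ∧ 0 ≤ C ∧ ∀ (f g : Rn d → ℂ) (M N : ℝ), LineBound t s h r M f →
      LineBound t s h r N g → ∀ X : Rn d × Rn d,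
      ‖crossT f g X‖ ≤ C * (M * N) * Real.exp (-(R * aniso t s X)) := by
  have hκ : (0 : ℝ) < 1 / (2 * 2 ^ (1 / t)) := by positivity
  obtain ⟨h, r, C, hh, hr, hC, H⟩ := exists_osc_bound' (d := d) ht hs R hκ
  refine ⟨h, r, C, hh, hr, hC, fun f g M N hf hg X => ?_⟩
  have e : crossT f g X = ∫ y, f ((1 / 2 : ℝ) • y + X.1) * g ((-(1 / 2) : ℝ) • y + X.1) *
      planeWave X.2 y := by
    refine integral_congr_ae (Filter.Eventually.of_forall fun y => ?_)
    simp only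
    rw [add_comm X.1, neg_smul, sub_eq_neg_add]
  rw [e]
  refine H f g M N hf hg _ _ X.1 _ _ (by norm_num [abs_le]) (by norm_num [abs_le]) (fun y => ?_) X.2
  have := cross_weight_le ht X.1 y
  rw [one_div_mul_eq_div, div_le_iff₀ (by positivity), neg_smul, ← sub_eq_neg_add,
    add_comm _ X.1, mul_comm]
  exact this

theorem stronglyMeasurable_crossT {f g : Rn d → ℂ} (hf : Continuous f) (hg : Continuous g) :
    StronglyMeasurable (crossT f g) := by
  refine StronglyMeasurable.integral_prod_right' (f := fun p : (Rn d × Rn d) × Rn d =>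
    f (p.1.1 + (1 / 2 : ℝ) • p.2) * g (p.1.1 - (1 / 2 : ℝ) • p.2) * planeWave p.1.2 p.2) ?_
  refine Continuous.stronglyMeasurable ?_
  have : Continuous fun p : (Rn d × Rn d) × Rn d => planeWave p.1.2 p.2 :=
    continuous_planeWave_uncurry.comp (continuous_fst.snd.prodMk continuous_snd)
  fun_prop

variable (t) in
/-- Continuous functions with exponential decay. -/
def ExpDecay (f : Rn d → ℂ) : Prop :=
  Continuous f ∧ ∃ M r : ℝ, 0 < r ∧ ∀ x, ‖f x‖ ≤ M * Real.exp (-(r * ‖x‖ ^ (1 / t)))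

theorem LineBound.expDecay {h r M : ℝ} {f : Rn d → ℂ} (hr : 0 < r) (hf : LineBound t s h r M f) :
    ExpDecay t f := ⟨hf.1.continuous, M, r, hr, hf.2.1⟩

/-- A majorant that is integrable in y and independent of x, as needed for differentiation under the
integral sign. -/
theorem ExpDecay.exists_cross_bound (ht : 0 < t) {f g : Rn d → ℂ} (hf : ExpDecay t f)
    (hg : ExpDecay t g) : ∃ K c : ℝ, 0 < c ∧ ∀ x y : Rn d,
      ‖f (x + (1 / 2 : ℝ) • y) * g (x - (1 / 2 : ℝ) • y)‖ ≤
        K * Real.exp (-(c * ‖y‖ ^ (1 / t))) := by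
  obtain ⟨-, M, r, hr, H⟩ := hf
  obtain ⟨-, N, r', hr', H'⟩ := hg
  have hM : 0 ≤ M := nonneg_of_mul_nonneg_left ((norm_nonneg _).trans (H 0)) (Real.exp_pos _)
  have hN : 0 ≤ N := nonneg_of_mul_nonneg_left ((norm_nonneg _).trans (H' 0)) (Real.exp_pos _)
  have hm : 0 < min r r' := lt_min hr hr'
  refine ⟨M * N, min r r' / (2 * 2 ^ (1 / t)), by positivity, fun x y => ?_⟩
  set a := x + (1 / 2 : ℝ) • y with ha
  set b := x - (1 / 2 : ℝ) • y with hb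
  rw [norm_mul]
  calc ‖f a‖ * ‖g b‖ ≤ (M * Real.exp (-(r * ‖a‖ ^ (1 / t)))) *
        (N * Real.exp (-(r' * ‖b‖ ^ (1 / t)))) := by gcongr; exacts [H a, H' b]
    _ = M * N * Real.exp (-(r * ‖a‖ ^ (1 / t)) + -(r' * ‖b‖ ^ (1 / t))) := by
        rw [Real.exp_add]; ring
    _ ≤ _ := by
        refine mul_le_mul_of_nonneg_left (Real.exp_le_exp.2 ?_) (by positivity)
        have h1 := cross_weight_le ht x y
        have h2 : 0 ≤ ‖x‖ ^ (1 / t) := by positivity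
        have h3 : ‖y‖ ^ (1 / t) / (2 * 2 ^ (1 / t)) ≤ ‖a‖ ^ (1 / t) + ‖b‖ ^ (1 / t) := by
          rw [div_le_iff₀ (by positivity), mul_comm]; linarith
        have h4 := mul_le_mul_of_nonneg_left h3 hm.le
        have h5 : min r r' * ‖a‖ ^ (1 / t) ≤ r * ‖a‖ ^ (1 / t) := by
          gcongr; exact min_le_left _ _
        have h6 : min r r' * ‖b‖ ^ (1 / t) ≤ r' * ‖b‖ ^ (1 / t) := by
          gcongr; exact min_le_right _ _
        have h7 : min r r' / (2 * 2 ^ (1 / t)) * ‖y‖ ^ (1 / t) =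
            min r r' * (‖y‖ ^ (1 / t) / (2 * 2 ^ (1 / t))) := by ring
        rw [h7]
        linarith

theorem ExpDecay.integrable_cross (ht : 0 < t) {f g : Rn d → ℂ} (hf : ExpDecay t f)
    (hg : ExpDecay t g) (X : Rn d × Rn d) : Integrable fun y : Rn d =>
      f (X.1 + (1 / 2 : ℝ) • y) * g (X.1 - (1 / 2 : ℝ) • y) * planeWave X.2 y := by
  obtain ⟨K, c, hc, H⟩ := hf.exists_cross_bound ht hg
  refine ((integrable_exp_neg_mul_norm_rpow hc (one_div_pos.2 ht)).const_mul K).mono' ?_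
    (Filter.Eventually.of_forall fun y => ?_)
  · refine Continuous.aestronglyMeasurable ?_
    have := hf.1
    have := hg.1
    have := (contDiff_planeWave X.2).continuous
    fun_prop
  · rw [norm_mul, norm_planeWave, mul_one]
    exact H X.1 y

theorem hasDerivAt_comp_line {f : Rn d → ℂ} (hf : ContDiff ℝ ∞ f) (e x z : Rn d) (τ : ℝ) :
    HasDerivAt (fun τ : ℝ => f (x + τ • e + z)) (dirDeriv e f (x + τ • e + z)) τ := by
  have h : HasDerivAt (fun τ : ℝ => x + τ • e + z) e τ := by
    simpa using ((((hasDerivAt_id τ).smul_const e).const_add x).add_const z)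
  exact (smooth_differentiable hf _).hasFDerivAt.comp_hasDerivAt τ h

theorem hasLineDerivAt_crossT_fst (ht : 0 < t) {f g : Rn d → ℂ} (hfs : ContDiff ℝ ∞ f)
    (hgs : ContDiff ℝ ∞ g) (e : Rn d) (hf : ExpDecay t f) (hg : ExpDecay t g)
    (hf' : ExpDecay t (dirDeriv e f)) (hg' : ExpDecay t (dirDeriv e g)) (X : Rn d × Rn d) :
    HasLineDerivAt ℝ (crossT f g) (crossT (dirDeriv e f) g X + crossT f (dirDeriv e g) X) X
      (e, 0) := by
  obtain ⟨K, c, hc, H⟩ := hf'.exists_cross_bound ht hg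
  obtain ⟨K', c', hc', H'⟩ := hf.exists_cross_bound ht hg'
  have hF := hf.1
  have hG := hg.1
  have hF' := hf'.1
  have hG' := hg'.1
  have hP := (contDiff_planeWave X.2).continuous
  have key := hasDerivAt_integral_of_dominated_loc_of_deriv_le (μ := (volume : Measure (Rn d)))
    (𝕜 := ℝ) (x₀ := (0 : ℝ)) (s := Set.univ)
    (F := fun τ y => f (X.1 + τ • e + (1 / 2 : ℝ) • y) * g (X.1 + τ • e - (1 / 2 : ℝ) • y) *
      planeWave X.2 y)
    (F' := fun τ y => (dirDeriv e f (X.1 + τ • e + (1 / 2 : ℝ) • y) *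
        g (X.1 + τ • e - (1 / 2 : ℝ) • y) + f (X.1 + τ • e + (1 / 2 : ℝ) • y) *
        dirDeriv e g (X.1 + τ • e - (1 / 2 : ℝ) • y)) * planeWave X.2 y)
    (bound := fun y => K * Real.exp (-(c * ‖y‖ ^ (1 / t))) +
      K' * Real.exp (-(c' * ‖y‖ ^ (1 / t)))) Filter.univ_mem
    (Filter.Eventually.of_forall fun τ => Continuous.aestronglyMeasurable (by fun_prop))
    (hf.integrable_cross ht hg (X.1 + (0 : ℝ) • e, X.2))
    (Continuous.aestronglyMeasurable (by fun_prop))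
    (Filter.Eventually.of_forall fun y τ _ => by
      rw [norm_mul, norm_planeWave, mul_one]
      exact (norm_add_le _ _).trans (add_le_add (H _ _) (H' _ _)))
    (((integrable_exp_neg_mul_norm_rpow hc (one_div_pos.2 ht)).const_mul K).add
      ((integrable_exp_neg_mul_norm_rpow hc' (one_div_pos.2 ht)).const_mul K'))
    (Filter.Eventually.of_forall fun y τ _ => by
      have h2 := hasDerivAt_comp_line hgs e X.1 (-((1 / 2 : ℝ) • y)) τ
      simp only [← sub_eq_add_neg] at h2
      exact ((hasDerivAt_comp_line hfs e X.1 ((1 / 2 : ℝ) • y) τ).mul h2).mul_const _)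
  have h2 := key.2
  simp only [zero_smul, add_zero, add_mul] at h2
  rw [integral_add (hf'.integrable_cross ht hg X) (hf.integrable_cross ht hg' X)] at h2
  refine HasDerivAt.congr_of_eventuallyEq h2 (Filter.Eventually.of_forall fun τ => ?_)
  simp [crossT]

/-- Differentiating the plane wave gives i y_i, and y_i = (x + y/2)_i - (x - y/2)_i distributes this
factor as multiplication by the coordinate on either function. -/
theorem hasLineDerivAt_crossT_snd (ht : 0 < t) {f g : Rn d → ℂ} (i : Fin d)
    (hf : ExpDecay t f) (hg : ExpDecay t g) (hf' : ExpDecay t (fun x => ((x i : ℝ) : ℂ) * f x))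
    (hg' : ExpDecay t (fun x => ((x i : ℝ) : ℂ) * g x)) (X : Rn d × Rn d) :
    HasLineDerivAt ℝ (crossT f g) (Complex.I * (crossT (fun x => ((x i : ℝ) : ℂ) * f x) g X -
      crossT f (fun x => ((x i : ℝ) : ℂ) * g x) X)) X (0, stdVec i) := by
  obtain ⟨K, c, hc, H⟩ := hf'.exists_cross_bound ht hg
  obtain ⟨K', c', hc', H'⟩ := hf.exists_cross_bound ht hg'
  have hF := hf.1
  have hG := hg.1
  have hP := fun τ : ℝ => (contDiff_planeWave (X.2 + τ • stdVec i)).continuous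
  have key := hasDerivAt_integral_of_dominated_loc_of_deriv_le (μ := (volume : Measure (Rn d)))
    (𝕜 := ℝ) (x₀ := (0 : ℝ)) (s := Set.univ)
    (F := fun τ y => f (X.1 + (1 / 2 : ℝ) • y) * g (X.1 - (1 / 2 : ℝ) • y) *
      planeWave (X.2 + τ • stdVec i) y)
    (F' := fun τ y => f (X.1 + (1 / 2 : ℝ) • y) * g (X.1 - (1 / 2 : ℝ) • y) *
      (Complex.I * ((y i : ℝ) : ℂ) * planeWave (X.2 + τ • stdVec i) y))
    (bound := fun y => K * Real.exp (-(c * ‖y‖ ^ (1 / t))) +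
      K' * Real.exp (-(c' * ‖y‖ ^ (1 / t)))) Filter.univ_mem
    (Filter.Eventually.of_forall fun τ => Continuous.aestronglyMeasurable (by fun_prop))
    (hf.integrable_cross ht hg (X.1, X.2 + (0 : ℝ) • stdVec i))
    (Continuous.aestronglyMeasurable (by fun_prop))
    (Filter.Eventually.of_forall fun y τ _ => by
      refine le_trans (le_of_eq ?_) ((norm_sub_le _ _).trans (add_le_add (H X.1 y) (H' X.1 y)))
      rw [norm_mul, norm_mul (Complex.I * _), norm_planeWave, mul_one, norm_mul Complex.I,
        Complex.norm_I, one_mul, ← norm_mul]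
      congr 1
      simp
      ring)
    (((integrable_exp_neg_mul_norm_rpow hc (one_div_pos.2 ht)).const_mul K).add
      ((integrable_exp_neg_mul_norm_rpow hc' (one_div_pos.2 ht)).const_mul K'))
    (Filter.Eventually.of_forall fun y τ _ => by
      refine HasDerivAt.const_mul _ ?_
      have h1 : HasDerivAt (fun τ : ℝ => (inner ℝ y (X.2 + τ • stdVec i) : ℝ)) (y i) τ := by
        have : HasDerivAt (fun τ : ℝ => (inner ℝ y X.2 : ℝ) + τ * y i) (y i) τ := by
          simpa using ((hasDerivAt_id τ).mul_const (y i)).const_add (inner ℝ y X.2 : ℝ)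
        refine this.congr_of_eventuallyEq (Filter.Eventually.of_forall fun σ => ?_)
        simp [inner_add_right, inner_smul_right, stdVec, EuclideanSpace.inner_single_right]
      have h2 := (h1.ofReal_comp.const_mul Complex.I).cexp
      refine h2.congr_deriv ?_
      rw [planeWave]
      ring)
  have h2 := key.2
  have e : (∫ y : Rn d, f (X.1 + (1 / 2 : ℝ) • y) * g (X.1 - (1 / 2 : ℝ) • y) *
      (Complex.I * ((y i : ℝ) : ℂ) * planeWave (X.2 + (0 : ℝ) • stdVec i) y)) =
      Complex.I * (crossT (fun x => ((x i : ℝ) : ℂ) * f x) g X -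
      crossT f (fun x => ((x i : ℝ) : ℂ) * g x) X) := by
    rw [crossT, crossT, ← integral_sub (hf'.integrable_cross ht hg X)
      (hf.integrable_cross ht hg' X), ← integral_const_mul]
    refine integral_congr_ae (Filter.Eventually.of_forall fun y => ?_)
    simp
    ring
  rw [e] at h2
  refine HasDerivAt.congr_of_eventuallyEq h2 (Filter.Eventually.of_forall fun τ => ?_)
  simp [crossT]

end Osc

section Kernel

variable {d : ℕ} {t s : ℝ}

instance : (volume : Measure (Rn d × Rn d)).IsAddHaarMeasure :=
  inferInstanceAs ((volume : Measure (Rn d)).prod (volume : Measure (Rn d))).IsAddHaarMeasure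

/-! ### Derivatives of the cross-Wigner transform -/

/-- The derivatives of `crossT f g` in direction `(e_i, 0)`. -/
def crossFst (f g : Rn d → ℂ) (i : Fin d) (k : ℕ) (X : Rn d × Rn d) : ℂ :=
  ∑ p ∈ antidiagonal k, (k.choose p.1 : ℂ) *
    crossT ((dirDeriv (stdVec i))^[p.1] f) ((dirDeriv (stdVec i))^[p.2] g) X

/-- The derivatives of `crossT f g` in direction `(0, e_i)`. -/
def crossSnd (f g : Rn d → ℂ) (i : Fin d) (k : ℕ) (X : Rn d × Rn d) : ℂ :=
  ∑ p ∈ antidiagonal k, (k.choose p.1 : ℂ) * (Complex.I ^ p.1 * (-Complex.I) ^ p.2 *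
    crossT (fun x => ((x i : ℝ) : ℂ) ^ p.1 * f x) (fun x => ((x i : ℝ) : ℂ) ^ p.2 * g x) X)

theorem crossFst_zero (f g : Rn d → ℂ) (i : Fin d) : crossFst f g i 0 = crossT f g := by
  funext X; simp [crossFst]

theorem crossSnd_zero (f g : Rn d → ℂ) (i : Fin d) : crossSnd f g i 0 = crossT f g := by
  funext X; simp [crossSnd]

theorem expDecay_iterate_dirDeriv (ht : 0 < t) (hs : 0 < s) (f : Space t s d) (i : Fin d) (j : ℕ) :
    ExpDecay t ((dirDeriv (stdVec i))^[j] f) := by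
  obtain ⟨h₁, H⟩ := exists_lineBound_deriv (d := d) ht hs 1 one_pos one_pos
  exact (H f i j).expDecay one_pos

theorem expDecay_coord_pow_mul (ht : 0 < t) (hs : 0 < s) (hst : 1 < s + t) (f : Space t s d)
    (i : Fin d) (j : ℕ) : ExpDecay t (fun x => ((x i : ℝ) : ℂ) ^ j * f x) := by
  obtain ⟨h₁, C, -, H⟩ := exists_lineBound_coord_pow (d := d) ht hs hst 1 one_pos one_pos
  exact (H f i j).expDecay one_pos

theorem lineChain_crossFst (ht : 0 < t) (hs : 0 < s) (f g : Space t s d) (i : Fin d) :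
    LineChain (stdVec i, (0 : Rn d)) (crossFst f g i) := by
  refine lineChain_leibniz (b := fun j l =>
    crossT ((dirDeriv (stdVec i))^[j] f) ((dirDeriv (stdVec i))^[l] g)) fun j l X => ?_
  have D := fun (φ : Space t s d) m => expDecay_iterate_dirDeriv ht hs φ i m
  simp only [Function.iterate_succ_apply'] at D ⊢
  have D' := fun (φ : Space t s d) m => D φ (m + 1)
  simp only [Function.iterate_succ_apply'] at D'
  exact hasLineDerivAt_crossT_fst ht (contDiff_dirDeriv_iterate _ _ f.2.1)
    (contDiff_dirDeriv_iterate _ _ g.2.1) _ (D f j) (D g l) (D' f j) (D' g l) X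

theorem lineChain_crossSnd (ht : 0 < t) (hs : 0 < s) (hst : 1 < s + t) (f g : Space t s d)
    (i : Fin d) : LineChain ((0 : Rn d), stdVec i) (crossSnd f g i) := by
  refine lineChain_leibniz (b := fun j l X => Complex.I ^ j * (-Complex.I) ^ l *
    crossT (fun x => ((x i : ℝ) : ℂ) ^ j * f x) (fun x => ((x i : ℝ) : ℂ) ^ l * g x) X)
    fun j l X => ?_
  have D := fun (φ : Space t s d) m => expDecay_coord_pow_mul ht hs hst φ i m
  have D' : ∀ (φ : Space t s d) m,
      ExpDecay t (fun x => ((x i : ℝ) : ℂ) * (((x i : ℝ) : ℂ) ^ m * φ x)) := fun φ m => by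
    have := D φ (m + 1)
    simpa only [pow_succ', mul_assoc] using this
  have := hasLineDerivAt_const_mul (Complex.I ^ j * (-Complex.I) ^ l)
    (hasLineDerivAt_crossT_snd ht i (D f j) (D g l) (D' f j) (D' g l) X)
  convert this using 1
  simp only [pow_succ', mul_assoc]
  ring

theorem exists_crossFst_bound (ht : 0 < t) (hs : 0 < s) {h : ℝ} (hh : 0 < h) (R : ℝ) :
    ∃ (h₁ : {h : ℝ // 0 < h}) (C : ℝ), 0 ≤ C ∧ ∀ (f g : Space t s d) (i : Fin d) (k : ℕ)
      (X : Rn d × Rn d), ‖crossFst f g i k X‖ ≤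
        C * (gsSeminorm t s d h₁ f * gsSeminorm t s d h₁ g) * Real.exp (-(R * aniso t s X)) *
          (h ^ k * (k.factorial : ℝ) ^ s) := by
  obtain ⟨h₀, r, C, hh₀, hr, hC, H⟩ := exists_crossT_bound (d := d) ht hs R
  obtain ⟨h₁, H₁⟩ := exists_lineBound_deriv (d := d) ht hs r hh₀ (half_pos hh)
  refine ⟨h₁, C * (2 ^ t * 2 ^ t), by positivity, fun f g i k X => ?_⟩
  have e : h = 2 * (h / 2) := by ring
  conv_rhs => rw [e]
  refine norm_leibniz_le hs (half_pos hh) k (b := fun j l =>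
    crossT ((dirDeriv (stdVec i))^[j] f) ((dirDeriv (stdVec i))^[l] g) X) fun j l => ?_
  refine (H _ _ _ _ (H₁ f i j) (H₁ g i l) X).trans (le_of_eq ?_)
  ring

/-- Derivatives in ξ become powers of a coordinate on f and g, whose size is governed by j!^t; hence
order t in this direction, and hence the need for s+t > 1. -/
theorem exists_crossSnd_bound (ht : 0 < t) (hs : 0 < s) (hst : 1 < s + t) {h : ℝ} (hh : 0 < h)
    (R : ℝ) : ∃ (h₁ : {h : ℝ // 0 < h}) (C : ℝ), 0 ≤ C ∧ ∀ (f g : Space t s d) (i : Fin d) (k : ℕ)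
      (X : Rn d × Rn d), ‖crossSnd f g i k X‖ ≤
        C * (gsSeminorm t s d h₁ f * gsSeminorm t s d h₁ g) * Real.exp (-(R * aniso t s X)) *
          (h ^ k * (k.factorial : ℝ) ^ t) := by
  obtain ⟨h₀, r, C, hh₀, hr, hC, H⟩ := exists_crossT_bound (d := d) ht hs R
  obtain ⟨h₁, C₁, hC₁, H₁⟩ := exists_lineBound_coord_pow (d := d) ht hs hst r hh₀ (half_pos hh)
  refine ⟨h₁, C * (C₁ * C₁), by positivity, fun f g i k X => ?_⟩
  have e : h = 2 * (h / 2) := by ring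
  conv_rhs => rw [e]
  refine norm_leibniz_le ht (half_pos hh) k (b := fun j l => Complex.I ^ j * (-Complex.I) ^ l *
    crossT (fun x => ((x i : ℝ) : ℂ) ^ j * f x) (fun x => ((x i : ℝ) : ℂ) ^ l * g x) X)
    fun j l => ?_
  simp only [norm_mul, norm_pow, Complex.norm_I, norm_neg, one_pow, one_mul]
  refine (H _ _ _ _ (H₁ f i j) (H₁ g i l) X).trans (le_of_eq ?_)
  ring

theorem exists_crossT_space_bound (ht : 0 < t) (hs : 0 < s) (R : ℝ) :
    ∃ (h₁ : {h : ℝ // 0 < h}) (C : ℝ), 0 ≤ C ∧ ∀ (f g : Space t s d) (X : Rn d × Rn d),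
      ‖crossT f g X‖ ≤ C * (gsSeminorm t s d h₁ f * gsSeminorm t s d h₁ g) *
        Real.exp (-(R * aniso t s X)) := by
  obtain ⟨h₀, r, C, hh₀, hr, hC, H⟩ := exists_crossT_bound (d := d) ht hs R
  obtain ⟨h₁, H₁⟩ := exists_lineBound (d := d) (s := s) ht r hh₀
  refine ⟨h₁, C * (2 ^ t * 2 ^ t), by positivity, fun f g X => ?_⟩
  refine (H _ _ _ _ (H₁ f) (H₁ g) X).trans (le_of_eq ?_)
  ring

/-! ### Kernel bounds for the Weyl form -/

/-- Covariance under phase-space shifts, by the substitution y ↦ y + z₁ - w₁. The frequency -z₂ in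
the first slot appears because `crossT` does not conjugate, so that slot receives conjugated shifts.
-/
theorem crossT_shift (f g : Rn d → ℂ) (z w X : Rn d × Rn d) :
    crossT (fun y => planeWave (-z.2) y * f (y - z.1)) (fun y => planeWave w.2 y * g (y - w.1))
      (X + (1 / 2 : ℝ) • (z + w)) =
    planeWave (w.2 - z.2) ((1 / 2 : ℝ) • (z.1 + w.1)) *
      (crossT f g X * (planeWave (w.2 - z.2) X.1 * planeWave (z.1 - w.1) X.2)) := by
  rw [crossT, ← integral_add_right_eq_self _ (z.1 - w.1), crossT, ← integral_mul_const,
    ← integral_const_mul]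
  refine integral_congr_ae (Filter.Eventually.of_forall fun y => ?_)
  simp only [Prod.fst_add, Prod.snd_add, Prod.smul_fst, Prod.smul_snd]
  have e1 : X.1 + (1 / 2 : ℝ) • (z.1 + w.1) + (1 / 2 : ℝ) • (y + (z.1 - w.1)) - z.1 =
      X.1 + (1 / 2 : ℝ) • y := by module
  have e2 : X.1 + (1 / 2 : ℝ) • (z.1 + w.1) - (1 / 2 : ℝ) • (y + (z.1 - w.1)) - w.1 =
      X.1 - (1 / 2 : ℝ) • y := by module
  rw [e1, e2]
  have e3 : planeWave (-z.2) (X.1 + (1 / 2 : ℝ) • (z.1 + w.1) + (1 / 2 : ℝ) • (y + (z.1 - w.1))) *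
      planeWave w.2 (X.1 + (1 / 2 : ℝ) • (z.1 + w.1) - (1 / 2 : ℝ) • (y + (z.1 - w.1))) *
      planeWave (X.2 + (1 / 2 : ℝ) • (z.2 + w.2)) (y + (z.1 - w.1)) =
      planeWave (w.2 - z.2) ((1 / 2 : ℝ) • (z.1 + w.1)) * planeWave X.2 y *
      (planeWave (w.2 - z.2) X.1 * planeWave (z.1 - w.1) X.2) := by
    simp only [planeWave, ← Complex.exp_add, ← mul_add, ← Complex.ofReal_add]
    congr 3
    rw [real_inner_comm (z.1 - w.1) X.2]
    simp only [inner_add_left, inner_sub_left, inner_add_right, inner_sub_right, inner_neg_right,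
      real_inner_smul_left, real_inner_smul_right]
    ring
  linear_combination (f (X.1 + (1 / 2 : ℝ) • y) * g (X.1 - (1 / 2 : ℝ) • y)) * e3

/-- The phase in `crossT_shift` as a linear functional. -/
def phaseL (z w : Rn d × Rn d) : Rn d × Rn d →L[ℝ] ℝ :=
  (innerSL ℝ (w.2 - z.2)).comp (ContinuousLinearMap.fst ℝ _ _) +
    (innerSL ℝ (z.1 - w.1)).comp (ContinuousLinearMap.snd ℝ _ _)

theorem phaseL_exp (z w X : Rn d × Rn d) : planeWave (w.2 - z.2) X.1 * planeWave (z.1 - w.1) X.2 =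
    Complex.exp (Complex.I * ((phaseL z w X : ℝ) : ℂ)) := by
  rw [planeWave_eq, planeWave_eq, ← Complex.exp_add, ← mul_add, ← Complex.ofReal_add]
  rfl

/-- After translating by the midpoint only a constant phase is left over, and the modulus discards
it. -/
theorem norm_integral_shift (a : Rn d × Rn d → ℂ) (f g : Rn d → ℂ) (z w : Rn d × Rn d) :
    ‖∫ X, a X * crossT (fun y => planeWave (-z.2) y * f (y - z.1))
      (fun y => planeWave w.2 y * g (y - w.1)) X‖ =
    ‖∫ X, a (X + (1 / 2 : ℝ) • (z + w)) * crossT f g X *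
      Complex.exp (Complex.I * ((phaseL z w X : ℝ) : ℂ))‖ := by
  rw [← integral_add_right_eq_self _ ((1 / 2 : ℝ) • (z + w))]
  have : ∀ X : Rn d × Rn d, a (X + (1 / 2 : ℝ) • (z + w)) *
      crossT (fun y => planeWave (-z.2) y * f (y - z.1))
      (fun y => planeWave w.2 y * g (y - w.1)) (X + (1 / 2 : ℝ) • (z + w)) =
      planeWave (w.2 - z.2) ((1 / 2 : ℝ) • (z.1 + w.1)) * (a (X + (1 / 2 : ℝ) • (z + w)) *
      crossT f g X * Complex.exp (Complex.I * ((phaseL z w X : ℝ) : ℂ))) := fun X => by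
    rw [crossT_shift, ← phaseL_exp]; ring
  simp only [this]
  rw [integral_const_mul, norm_mul, norm_planeWave, one_mul]

theorem aniso_half_le (ht : 0 < t) (hs : 0 < s) (z : Rn d × Rn d) :
    aniso t s ((1 / 2 : ℝ) • z) ≤ aniso t s z := by
  unfold aniso
  have h : ∀ x : Rn d, ‖(1 / 2 : ℝ) • x‖ ≤ ‖x‖ := fun x => by
    rw [norm_smul]
    exact mul_le_of_le_one_left (norm_nonneg _) (by norm_num)
  rw [Prod.smul_fst, Prod.smul_snd]
  have := h z.1
  have := h z.2
  gcongr

/-- The midpoint is z + (w-z)/2. Growth at the midpoint is thus charged to growth at z and to the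
off-diagonal distance. -/
theorem aniso_mid_le (ht : 0 < t) (hs : 0 < s) (z w : Rn d × Rn d) :
    aniso t s ((1 / 2 : ℝ) • (z + w)) ≤ anisoC t s * (aniso t s z + aniso t s (z - w)) := by
  have e : (1 / 2 : ℝ) • (z + w) = z + (1 / 2 : ℝ) • (w - z) := by module
  have hc := one_le_anisoC ht hs
  rw [e]
  refine (aniso_add_le ht hs _ _).trans ?_
  have := aniso_half_le ht hs (w - z)
  rw [aniso_sub_comm z w]
  gcongr

variable (a : Rn d × Rn d → ℂ)

theorem partialDeriv₂_fst_single (ha : ContDiff ℝ ∞ a) (i : Fin d) (k : ℕ) :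
    partialDeriv₂ (Pi.single i k) 0 a = (dirDeriv (stdVec i, (0 : Rn d)))^[k] a := by
  rw [partialDeriv₂, multiDeriv_zero]
  exact (iterate_dirDeriv_eq (fun i => (stdVec i, (0 : Rn d))) i k ha).symm

theorem partialDeriv₂_snd_single (ha : ContDiff ℝ ∞ a) (i : Fin d) (k : ℕ) :
    partialDeriv₂ 0 (Pi.single i k) a = (dirDeriv ((0 : Rn d), stdVec i))^[k] a := by
  rw [partialDeriv₂, multiDeriv_zero]
  exact (iterate_dirDeriv_eq (fun i => ((0 : Rn d), stdVec i)) i k ha).symm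

/-- A product of a symbol and a cross-Wigner transform satisfies moment bounds. -/
theorem moment_symbol_mul {p h Ca C μ c : ℝ} (hp : 0 < p) (hh : 0 < h) (hCa : 0 ≤ Ca)
    (hμ : 0 ≤ μ) (ht : 0 < t) (hs : 0 < s) (hc : c = anisoC t s) (ha : ContDiff ℝ ∞ a)
    {v : Rn d × Rn d}
    (hab : ∀ k X, ‖(dirDeriv v)^[k] a X‖ ≤
      Ca * Real.exp (μ * aniso t s X) * ((h / 2) ^ k * (k.factorial : ℝ) ^ p))
    {g : ℕ → Rn d × Rn d → ℂ} (hg : LineChain v g) (hgm : ∀ k, AEStronglyMeasurable (g k))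
    (hgb : ∀ k X, ‖g k X‖ ≤ C * Real.exp (-((μ * c + 1) * aniso t s X)) *
      ((h / 2) ^ k * (k.factorial : ℝ) ^ p)) (m : Rn d × Rn d) (L : Rn d × Rn d →L[ℝ] ℝ) (k : ℕ) :
    |L v| ^ k * ‖∫ X, a (X + m) * g 0 X * Complex.exp (Complex.I * ((L X : ℝ) : ℂ))‖ ≤
      (Ca * C * Real.exp (μ * c * aniso t s m) *
        ∫ X : Rn d × Rn d, Real.exp (-(1 * aniso t s X))) * (h ^ k * (k.factorial : ℝ) ^ p) := by
  have hC : 0 ≤ C := by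
    have := (norm_nonneg _).trans (hgb 0 0)
    rw [pow_zero, Nat.factorial_zero, Nat.cast_one, Real.one_rpow, mul_one, mul_one] at this
    exact nonneg_of_mul_nonneg_left this (Real.exp_pos _)
  have h1 := (lineChain_dirDeriv v ha).comp_affine (v := v) (fun X => X + m) 1
    (fun x τ => by rw [one_mul]; abel)
  have hch := h1.mul hg
  simp only [Complex.ofReal_one, one_pow, one_mul] at hch
  have hint := integrable_exp_neg_aniso (d := d) (one_pos) ht hs
  have := hch.moment_le volume (fun k => by
      have h3 : ∀ p ∈ antidiagonal k, AEStronglyMeasurable (fun X : Rn d × Rn d =>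
          (k.choose p.1 : ℂ) * ((dirDeriv v)^[p.1] a (X + m) * g p.2 X)) := fun p _ => by
        refine AEStronglyMeasurable.const_mul (AEStronglyMeasurable.mul ?_ (hgm _)) _
        have := (contDiff_dirDeriv_iterate v p.1 ha).continuous
        exact Continuous.aestronglyMeasurable (by fun_prop)
      exact Finset.aestronglyMeasurable_fun_sum _ h3)
    (p := p) (h := h) (M := Ca * C * Real.exp (μ * c * aniso t s m)) hint (fun k X => by
      have h4 := norm_leibniz_mul_le hp (half_pos hh) k (fun j => hab j (X + m))
        (fun j => hgb j X)
      refine h4.trans ?_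
      -- Of the decay rate μc + 1, the part μc absorbs the growth of the translated symbol in X and
      -- the part 1 remains for integrability.
      have h5 : Real.exp (μ * aniso t s (X + m)) * Real.exp (-((μ * c + 1) * aniso t s X)) ≤
          Real.exp (μ * c * aniso t s m) * Real.exp (-(1 * aniso t s X)) := by
        rw [← Real.exp_add, ← Real.exp_add]
        refine Real.exp_le_exp.2 ?_
        have := mul_le_mul_of_nonneg_left (aniso_add_le ht hs X m) hμ
        rw [← hc] at this
        linarith
      rw [mul_div_cancel₀ _ (two_ne_zero)]
      calc _ = Ca * C * (h ^ k * (k.factorial : ℝ) ^ p) * (Real.exp (μ * aniso t s (X + m)) *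
            Real.exp (-((μ * c + 1) * aniso t s X))) := by ring
        _ ≤ Ca * C * (h ^ k * (k.factorial : ℝ) ^ p) * (Real.exp (μ * c * aniso t s m) *
            Real.exp (-(1 * aniso t s X))) := by gcongr
        _ = _ := by ring) L k
  simpa using this

/-- Decay at rate 2r in the larger of x and y implies decay at rate r in their sum. -/
theorem le_exp_of_le_exp_of_le_exp {A K x y r : ℝ} {c c' : ℝ} (hc : 0 ≤ c) (hc' : 0 ≤ c')
    (hK : 0 ≤ K) (hr : 0 ≤ r)
    (h1 : A ≤ c * K * Real.exp (-(2 * r * x))) (h2 : A ≤ c' * K * Real.exp (-(2 * r * y))) :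
    A ≤ (c + c') * K * Real.exp (-(r * (x + y))) := by
  have p1 := Real.exp_pos (-(r * (x + y)))
  rcases le_total x y with h | h
  · calc A ≤ c' * K * Real.exp (-(2 * r * y)) := h2
      _ ≤ c' * K * Real.exp (-(r * (x + y))) := by
        refine mul_le_mul_of_nonneg_left (Real.exp_le_exp.2 ?_) (by positivity)
        nlinarith
      _ ≤ _ := by gcongr; linarith
  · calc A ≤ c * K * Real.exp (-(2 * r * x)) := h1
      _ ≤ c * K * Real.exp (-(r * (x + y))) := by
        refine mul_le_mul_of_nonneg_left (Real.exp_le_exp.2 ?_) (by positivity)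
        nlinarith
      _ ≤ _ := by gcongr; linarith

/-- The form `∫ a · crossT f g` on time-frequency shifts decays off the diagonal at any rate, with
a fixed exponential growth along the diagonal. -/
theorem exists_kernel_bound (ht : 0 < t) (hs : 0 < s) (hst : 1 < s + t) (ha : IsSymbol t s a) :
    ∃ μ' : ℝ, 0 < μ' ∧ ∀ r : ℝ, 0 < r → ∃ (h : {h : ℝ // 0 < h}) (C : ℝ), 0 ≤ C ∧
      ∀ (f g : Space t s d) (z w : Rn d × Rn d),
      ‖∫ X, a X * crossT (timeFreqShift ht hs z.1 (-z.2) f) (timeFreqShift ht hs w.1 w.2 g) X‖ ≤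
        C * (gsSeminorm t s d h f * gsSeminorm t s d h g) *
          Real.exp (μ' * aniso t s z - r * aniso t s (z - w)) := by
  obtain ⟨hsm, μ, hμ, Ha⟩ := ha
  set c := anisoC t s with hc
  have hc1 : 1 ≤ c := one_le_anisoC ht hs
  -- One factor c comes from the growth of a(X+m), the other from the estimate of the midpoint m;
  -- neither depends on r.
  refine ⟨μ * c * c, by positivity, fun r hr => ?_⟩
  -- The increment pays for the share of the midpoint growth that is charged to the off-diagonal
  -- distance.
  set r' : ℝ := r + μ * c * c with hr'
  have hr0' : 0 < r' := by positivity
  -- The rate is doubled because decay in frequency and decay in position are proved separately and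
  -- then merged.
  obtain ⟨hS, hS0, HS⟩ := exp_decay_of_moments hs (2 * r') d
  obtain ⟨hT, hT0, HT⟩ := exp_decay_of_moments ht (2 * r') d
  obtain ⟨h₁, C₁, hC₁, H₁⟩ := exists_crossFst_bound (d := d) ht hs (half_pos hS0) (μ * c + 1)
  obtain ⟨h₂, C₂, hC₂, H₂⟩ := exists_crossSnd_bound (d := d) ht hs hst (half_pos hT0) (μ * c + 1)
  obtain ⟨h₃, C₃, hC₃, H₃⟩ := exists_crossT_space_bound (d := d) ht hs (μ * c + 1)
  obtain ⟨A₁, HA₁⟩ := Ha (hS / 2) (half_pos hS0)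
  obtain ⟨A₂, HA₂⟩ := Ha (hT / 2) (half_pos hT0)
  obtain ⟨A₃, HA₃⟩ := Ha 1 one_pos
  set Ca : ℝ := max (max A₁ A₂) (max A₃ 0) with hCa
  have hCa0 : 0 ≤ Ca := (le_max_right _ _).trans (le_max_right _ _)
  set C : ℝ := max (max C₁ C₂) C₃ with hCdef
  have hC0 : 0 ≤ C := hC₃.trans (le_max_right _ _)
  set h : {h : ℝ // 0 < h} := min (min h₁ h₂) h₃ with hh
  set J : ℝ := ∫ X : Rn d × Rn d, Real.exp (-(1 * aniso t s X)) with hJ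
  have hJ0 : 0 ≤ J := integral_nonneg fun _ => (Real.exp_pos _).le
  refine ⟨h, (2 ^ s + 2 ^ t) * (Ca * C * J), by positivity, fun f g z w => ?_⟩
  have sm : ∀ {h' : {h : ℝ // 0 < h}}, h ≤ h' →
      gsSeminorm t s d h' f * gsSeminorm t s d h' g ≤
      gsSeminorm t s d h f * gsSeminorm t s d h g := fun hle => by
    have := gsSeminorm_nonneg h f
    exact mul_le_mul (gsSeminorm_anti hle f) (gsSeminorm_anti hle g) (gsSeminorm_nonneg _ _) this
  set P : ℝ := gsSeminorm t s d h f * gsSeminorm t s d h g with hP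
  have hP0 : 0 ≤ P := mul_nonneg (gsSeminorm_nonneg _ _) (gsSeminorm_nonneg _ _)
  set m := (1 / 2 : ℝ) • (z + w) with hm
  set L := phaseL z w with hL
  set K : ℝ := Ca * (C * P) * Real.exp (μ * c * aniso t s m) * J with hK
  have hK0 : 0 ≤ K := by positivity
  have e := norm_integral_shift a f g z w
  change ‖∫ X, a X * crossT (fun y => planeWave (-z.2) y * f (y - z.1))
      (fun y => planeWave w.2 y * g (y - w.1)) X‖ ≤ _
  rw [e]
  set A : ℝ := ‖∫ X, a (X + m) * crossT f g X * Complex.exp (Complex.I * ((L X : ℝ) : ℂ))‖ with hA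
  have hfc := f.2.1.continuous
  have hgc := g.2.1.continuous
  have hAK : A ≤ K := by
    have hint := integrable_exp_neg_aniso (d := d) (one_pos) ht hs
    refine (norm_integral_le_of_norm_le (hint.const_mul
      (Ca * (C * P) * Real.exp (μ * c * aniso t s m)))
      (Filter.Eventually.of_forall fun X => ?_)).trans (le_of_eq (integral_const_mul _ _))
    rw [norm_mul, norm_exp_I_mul, mul_one, norm_mul]
    have a1 := HA₃ 0 0 (X + m).1 (X + m).2
    simp only [partialDeriv₂, multiDeriv_zero, msize_zero, mfact_zero, pow_zero, Real.one_rpow,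
      one_mul, add_zero] at a1
    have h5 : Real.exp (μ * aniso t s (X + m)) * Real.exp (-((μ * c + 1) * aniso t s X)) ≤
        Real.exp (μ * c * aniso t s m) * Real.exp (-(1 * aniso t s X)) := by
      rw [← Real.exp_add, ← Real.exp_add]
      refine Real.exp_le_exp.2 ?_
      have := mul_le_mul_of_nonneg_left (aniso_add_le ht hs X m) hμ.le
      linarith
    have a2 : ‖a (X + m)‖ ≤ Ca * Real.exp (μ * aniso t s (X + m)) := by
      refine a1.trans ?_
      change _ * Real.exp (μ * aniso t s (X + m)) ≤ _
      gcongr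
      exact (le_max_left _ _).trans (le_max_right _ _)
    have a3 : ‖crossT f g X‖ ≤ C * P * Real.exp (-((μ * c + 1) * aniso t s X)) := by
      refine (H₃ f g X).trans ?_
      have b1 := sm (h' := h₃) (min_le_right _ _)
      have b2 : C₃ ≤ C := le_max_right _ _
      have b3 := mul_nonneg (gsSeminorm_nonneg h₃ f) (gsSeminorm_nonneg h₃ g)
      gcongr
    calc ‖a (X + m)‖ * ‖crossT f g X‖ ≤ (Ca * Real.exp (μ * aniso t s (X + m))) *
          (C * P * Real.exp (-((μ * c + 1) * aniso t s X))) := by gcongr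
      _ = Ca * (C * P) * (Real.exp (μ * aniso t s (X + m)) *
          Real.exp (-((μ * c + 1) * aniso t s X))) := by ring
      _ ≤ Ca * (C * P) * (Real.exp (μ * c * aniso t s m) * Real.exp (-(1 * aniso t s X))) := by
          gcongr
      _ = _ := by ring
  -- The phase has x-gradient w₂ - z₂, so x-derivatives, which cost k!^s, detect the frequency
  -- difference.
  have m1 : ∀ (i : Fin d) (k : ℕ), |(w.2 - z.2) i| ^ k * A ≤
      K * (hS ^ k * (k.factorial : ℝ) ^ s) := by
    intro i k
    have := moment_symbol_mul a hs hS0 hCa0 hμ.le ht hs hc hsm (C := C * P)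
      (v := (stdVec i, (0 : Rn d)))
      (fun k X => by
        rw [← partialDeriv₂_fst_single a hsm]
        refine (HA₁ (Pi.single i k) 0 X.1 X.2).trans ?_
        rw [msize_single, msize_zero, mfact_single, mfact_zero, Real.one_rpow, add_zero, mul_one]
        have b1 : A₁ ≤ Ca := (le_max_left _ _).trans (le_max_left _ _)
        calc _ = A₁ * (Real.exp (μ * aniso t s X) * ((hS / 2) ^ k * (k.factorial : ℝ) ^ s)) := by
              rw [aniso]; ring
          _ ≤ Ca * (Real.exp (μ * aniso t s X) * ((hS / 2) ^ k * (k.factorial : ℝ) ^ s)) := by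
              gcongr
          _ = _ := by ring)
      (lineChain_crossFst ht hs f g i)
      (fun k => by
        refine Finset.aestronglyMeasurable_fun_sum _ fun p _ => ?_
        refine AEStronglyMeasurable.const_mul ?_ _
        exact (stronglyMeasurable_crossT (contDiff_dirDeriv_iterate _ _ f.2.1).continuous
          (contDiff_dirDeriv_iterate _ _ g.2.1).continuous).aestronglyMeasurable)
      (fun k X => by
        refine (H₁ f g i k X).trans ?_
        have b1 := sm (h' := h₁) ((min_le_left _ _).trans (min_le_left _ _))
        have b2 : C₁ ≤ C := (le_max_left _ _).trans (le_max_left _ _)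
        have b3 := mul_nonneg (gsSeminorm_nonneg h₁ f) (gsSeminorm_nonneg h₁ g)
        gcongr) m L k
    rw [crossFst_zero] at this
    have e2 : L (stdVec i, (0 : Rn d)) = (w.2 - z.2) i := by
      rw [hL, phaseL]
      simp [stdVec, EuclideanSpace.inner_single_right]
    rw [e2] at this
    exact this
  -- Dually, ξ-derivatives cost k!^t and detect the position difference.
  have m2 : ∀ (i : Fin d) (k : ℕ), |(z.1 - w.1) i| ^ k * A ≤
      K * (hT ^ k * (k.factorial : ℝ) ^ t) := by
    intro i k
    have := moment_symbol_mul a ht hT0 hCa0 hμ.le ht hs hc hsm (C := C * P)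
      (v := ((0 : Rn d), stdVec i))
      (fun k X => by
        rw [← partialDeriv₂_snd_single a hsm]
        refine (HA₂ 0 (Pi.single i k) X.1 X.2).trans ?_
        rw [msize_single, msize_zero, mfact_single, mfact_zero, Real.one_rpow, zero_add, mul_one]
        have b1 : A₂ ≤ Ca := (le_max_right _ _).trans (le_max_left _ _)
        calc _ = A₂ * (Real.exp (μ * aniso t s X) * ((hT / 2) ^ k * (k.factorial : ℝ) ^ t)) := by
              rw [aniso]; ring
          _ ≤ Ca * (Real.exp (μ * aniso t s X) * ((hT / 2) ^ k * (k.factorial : ℝ) ^ t)) := by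
              gcongr
          _ = _ := by ring)
      (lineChain_crossSnd ht hs hst f g i)
      (fun k => by
        refine Finset.aestronglyMeasurable_fun_sum _ fun p _ => ?_
        refine AEStronglyMeasurable.const_mul (AEStronglyMeasurable.const_mul ?_ _) _
        exact (stronglyMeasurable_crossT (by fun_prop) (by fun_prop)).aestronglyMeasurable)
      (fun k X => by
        refine (H₂ f g i k X).trans ?_
        have b1 := sm (h' := h₂) ((min_le_left _ _).trans (min_le_right _ _))
        have b2 : C₂ ≤ C := (le_max_right _ _).trans (le_max_left _ _)
        have b3 := mul_nonneg (gsSeminorm_nonneg h₂ f) (gsSeminorm_nonneg h₂ g)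
        gcongr) m L k
    rw [crossSnd_zero] at this
    have e2 : L ((0 : Rn d), stdVec i) = (z.1 - w.1) i := by
      rw [hL, phaseL]
      simp [stdVec, EuclideanSpace.inner_single_right]
    rw [e2] at this
    exact this
  have d1 := HS hS hS0 le_rfl (w.2 - z.2) A K (norm_nonneg _) hAK m1
  have d2 := HT hT hT0 le_rfl (z.1 - w.1) A K (norm_nonneg _) hAK m2
  have d3 := le_exp_of_le_exp_of_le_exp (by positivity) (by positivity) hK0 hr0'.le d1 d2
  refine d3.trans ?_
  have e4 : ‖w.2 - z.2‖ ^ (1 / s) + ‖z.1 - w.1‖ ^ (1 / t) = aniso t s (z - w) := by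
    rw [aniso, norm_sub_rev, add_comm]; rfl
  rw [e4, hK]
  have h6 : Real.exp (μ * c * aniso t s m) * Real.exp (-(r' * aniso t s (z - w))) ≤
      Real.exp (μ * c * c * aniso t s z - r * aniso t s (z - w)) := by
    rw [← Real.exp_add]
    refine Real.exp_le_exp.2 ?_
    have h7 : μ * c * aniso t s m ≤ μ * c * (c * (aniso t s z + aniso t s (z - w))) :=
      mul_le_mul_of_nonneg_left (aniso_mid_le ht hs z w) (by positivity)
    rw [hr']
    linarith
  calc _ = (2 ^ s + 2 ^ t) * (Ca * C * J) * P * (Real.exp (μ * c * aniso t s m) *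
        Real.exp (-(r' * aniso t s (z - w)))) := by ring
    _ ≤ _ := by gcongr

end Kernel

section Synthesis

variable {d : ℕ} {t s : ℝ}

/-! ### Smoothness of parameter integrals -/

theorem fderiv_eq_sum_smulRight (f : Rn d → ℂ) (x : Rn d) :
    fderiv ℝ f x = ∑ i, (EuclideanSpace.proj (𝕜 := ℝ) i).smulRight (dirDeriv (stdVec i) f x) := by
  refine ContinuousLinearMap.ext fun v => ?_
  conv_lhs => rw [← (EuclideanSpace.basisFun (Fin d) ℝ).sum_repr v]
  rw [map_sum, sum_apply]
  refine Finset.sum_congr rfl fun i _ => ?_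
  rw [map_smul]
  simp [dirDeriv, stdVec]

theorem integral_sum_clm {α ι E : Type*} [MeasurableSpace α] {μ : Measure α} [Fintype ι]
    [NormedAddCommGroup E] [NormedSpace ℝ E] [CompleteSpace E] (J : ι → ℂ →L[ℝ] E)
    {c : ι → α → ℂ} (hc : ∀ i, Integrable (c i) μ) :
    Integrable (fun w => ∑ i, J i (c i w)) μ ∧
      ∫ w, ∑ i, J i (c i w) ∂μ = ∑ i, J i (∫ w, c i w ∂μ) := by
  have hci : ∀ i, Integrable (fun w => J i (c i w)) μ := fun i => (J i).integrable_comp (hc i)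
  refine ⟨integrable_finsetSum _ fun i _ => hci i, ?_⟩
  rw [integral_finsetSum _ fun i _ => hci i]
  exact Finset.sum_congr rfl fun i _ => (J i).integral_comp_comm (hc i)

/-- Writing the derivative as a finite sum of fixed functionals with scalar coefficients reduces
measurability and domination of an operator-valued map to scalar statements. -/
theorem hasFDerivAt_integral_sum {α ι H : Type*} [MeasurableSpace α] {μ : Measure α} [Fintype ι]
    [NormedAddCommGroup H] [NormedSpace ℝ H] (P : ι → H →L[ℝ] ℝ) {F : H → α → ℂ}
    {c : ι → H → α → ℂ} {b : ι → α → ℝ} (hm : ∀ y, AEStronglyMeasurable (F y) μ)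
    (hint : ∀ y, Integrable (F y) μ) (hc : ∀ i y, Integrable (c i y) μ)
    (hb : ∀ i, Integrable (b i) μ) (hcb : ∀ i y w, ‖c i y w‖ ≤ b i w)
    (hd : ∀ w y, HasFDerivAt (fun y => F y w) (∑ i, (P i).smulRight (c i y w)) y) (y : H) :
    HasFDerivAt (fun y => ∫ w, F y w ∂μ) (∑ i, (P i).smulRight (∫ w, c i y w ∂μ)) y := by
  have hJs := integral_sum_clm (fun i => ContinuousLinearMap.smulRightL ℝ H ℂ (P i))
    (fun i => hc i y)
  have key := hasFDerivAt_integral_of_dominated_of_fderiv_le (𝕜 := ℝ) (μ := μ) (x₀ := y)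
    (s := Set.univ) (F := F)
    (F' := fun y w => ∑ i, (P i).smulRight (c i y w))
    (bound := fun w => ∑ i, ‖P i‖ * b i w) Filter.univ_mem
    (Filter.Eventually.of_forall hm) (hint y) hJs.1.aestronglyMeasurable
    (Filter.Eventually.of_forall fun w y _ => (norm_sum_le _ _).trans
      (Finset.sum_le_sum fun i _ => by
        rw [ContinuousLinearMap.norm_smulRight_apply]
        exact mul_le_mul_of_nonneg_left (hcb i y w) (norm_nonneg _)))
    (integrable_finsetSum _ fun i _ => (hb i).const_mul _)
    (Filter.Eventually.of_forall fun w y _ => hd w y)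
  exact key.congr_fderiv hJs.2

/-- Integrable majorants for all orders make the integrals of the partial derivatives a family
closed under differentiation. Smoothness and the formula for every multi-index follow together. -/
theorem partialDeriv_integral {α : Type*} [MeasurableSpace α] {μ : Measure α} {F : α → Rn d → ℂ}
    {B : (Fin d → ℕ) → α → ℝ} (hF : ∀ w, ContDiff ℝ ∞ (F w))
    (hm : ∀ β y, AEStronglyMeasurable (fun w => partialDeriv β (F w) y) μ)
    (hB : ∀ β, Integrable (B β) μ) (hb : ∀ β w y, ‖partialDeriv β (F w) y‖ ≤ B β w) :
    ContDiff ℝ ∞ (fun y => ∫ w, F w y ∂μ) ∧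
      ∀ β y, partialDeriv β (fun y => ∫ w, F w y ∂μ) y = ∫ w, partialDeriv β (F w) y ∂μ := by
  set I : (Fin d → ℕ) → Rn d → ℂ := fun β y => ∫ w, partialDeriv β (F w) y ∂μ with hI
  have hint : ∀ β y, Integrable (fun w => partialDeriv β (F w) y) μ := fun β y =>
    (hB β).mono' (hm β y) (Filter.Eventually.of_forall fun w => hb β w y)
  have hsm : ∀ β w, ContDiff ℝ ∞ (partialDeriv β (F w)) := fun β w =>
    contDiff_multiDeriv stdVec β (hF w)
  have hstep : ∀ β w (i : Fin d), dirDeriv (stdVec i) (partialDeriv β (F w)) =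
      partialDeriv (β + Pi.single i 1) (F w) := fun β w i =>
    dirDeriv_multiDeriv stdVec β i (hF w)
  have hder : ∀ β y, HasFDerivAt (I β)
      (∑ i, (EuclideanSpace.proj (𝕜 := ℝ) i).smulRight (I (β + Pi.single i 1) y)) y := fun β y =>
    hasFDerivAt_integral_sum (fun i => EuclideanSpace.proj (𝕜 := ℝ) i)
      (fun y => hm β y) (fun y => hint β y) (fun i y => hint (β + Pi.single i 1) y)
      (fun i => hB (β + Pi.single i 1)) (fun i y w => hb _ w y) (fun w y => by
        have h1 := (smooth_differentiable (hsm β w) y).hasFDerivAt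
        rw [fderiv_eq_sum_smulRight] at h1
        simp only [hstep] at h1
        exact h1) y
  -- The induction runs over all β at once, since the derivative of `I β` involves the `I` of higher
  -- multi-indices.
  have hcd : ∀ (n : ℕ) β, ContDiff ℝ n (I β) := by
    intro n
    induction n with
    | zero =>
      intro β
      rw [Nat.cast_zero, contDiff_zero]
      exact continuous_iff_continuousAt.2 fun y => (hder β y).continuousAt
    | succ n ih =>
      intro β
      rw [Nat.cast_succ, contDiff_succ_iff_fderiv]
      refine ⟨fun y => (hder β y).differentiableAt, by simp, ?_⟩
      have : fderiv ℝ (I β) = fun y =>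
          ∑ i, (EuclideanSpace.proj (𝕜 := ℝ) i).smulRight (I (β + Pi.single i 1) y) :=
        funext fun y => (hder β y).fderiv
      rw [this]
      exact ContDiff.sum fun i _ => contDiff_const.smulRight (ih _)
  have h0 : (fun y => ∫ w, F w y ∂μ) = I 0 := by
    funext y
    simp only [hI, partialDeriv_zero]
  have hinf : ∀ β, ContDiff ℝ ∞ (I β) := fun β => contDiff_infty.2 fun n => hcd n β
  have hdir : ∀ β (i : Fin d), dirDeriv (stdVec i) (I β) = I (β + Pi.single i 1) := by
    intro β i
    funext y
    rw [dirDeriv, (hder β y).fderiv, sum_apply, Finset.sum_eq_single i]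
    · simp [stdVec]
    · intro j _ hj; simp [stdVec, hj]
    · simp
  refine ⟨h0 ▸ hinf 0, fun β y => ?_⟩
  rw [h0]
  have hit : ∀ (i : Fin d) (k : ℕ) γ, (dirDeriv (stdVec i))^[k] (I γ) = I (γ + Pi.single i k) := by
    intro i k γ
    induction k with
    | zero => simp
    | succ k ih => rw [Function.iterate_succ_apply', ih, hdir, add_assoc, ← Pi.single_add]
  have hfold : ∀ l : List (Fin d),
      l.foldr (fun i g => (dirDeriv (stdVec i))^[β i] g) (I 0) =
        I ((l.map fun i => (Pi.single i (β i) : Fin d → ℕ)).sum) := by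
    intro l
    induction l with
    | nil => rfl
    | cons i l ih => rw [List.foldr_cons, ih, hit, List.map_cons, List.sum_cons, add_comm]
  have hsum : ((List.finRange d).map fun i => (Pi.single i (β i) : Fin d → ℕ)).sum = β := by
    rw [← List.ofFn_eq_map, List.sum_ofFn]
    exact Finset.univ_sum_single β
  have := hfold (List.finRange d)
  rw [hsum] at this
  exact congrFun this y

/-- Derivatives in y at fixed w are derivatives of the joint function, hence depend continuously on
w; this supplies measurability in the parameter. -/
theorem partialDeriv_slice {W : Type*} [NormedAddCommGroup W] [NormedSpace ℝ W]
    {K : W × Rn d → ℂ} (hK : ContDiff ℝ ∞ K) (β : Fin d → ℕ) (w : W) (y : Rn d) :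
    partialDeriv β (fun y => K (w, y)) y = multiDeriv (fun i => ((0 : W), stdVec i)) β K (w, y) := by
  have one : ∀ (v : Rn d) (g : W × Rn d → ℂ), ContDiff ℝ ∞ g →
      dirDeriv v (fun y => g (w, y)) = fun y => dirDeriv ((0 : W), v) g (w, y) := by
    intro v g hg
    funext y
    have h1 : HasFDerivAt (fun y : Rn d => (w, y)) (ContinuousLinearMap.inr ℝ W (Rn d)) y :=
      hasFDerivAt_prodMk_right w y
    have h2 := (smooth_differentiable hg (w, y)).hasFDerivAt.comp y h1
    have h3 : dirDeriv v (fun y => g (w, y)) y = _ := congrArg (fun L => L v) h2.fderiv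
    rw [h3]
    simp [dirDeriv]
  have it : ∀ (i : Fin d) (k : ℕ) (g : W × Rn d → ℂ), ContDiff ℝ ∞ g →
      (dirDeriv (stdVec i))^[k] (fun y => g (w, y)) =
        fun y => (dirDeriv ((0 : W), stdVec i))^[k] g (w, y) := by
    intro i k g hg
    induction k with
    | zero => rfl
    | succ k ih =>
      simp only [Function.iterate_succ_apply']
      rw [ih, one _ _ (contDiff_dirDeriv_iterate _ k hg)]
  have main : ∀ l : List (Fin d),
      ContDiff ℝ ∞ (l.foldr (fun i g => (dirDeriv ((0 : W), stdVec i))^[β i] g) K) ∧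
      l.foldr (fun i g => (dirDeriv (stdVec i))^[β i] g) (fun y => K (w, y)) =
        fun y => l.foldr (fun i g => (dirDeriv ((0 : W), stdVec i))^[β i] g) K (w, y) := by
    intro l
    induction l with
    | nil => exact ⟨hK, rfl⟩
    | cons i l ih =>
      simp only [List.foldr_cons]
      exact ⟨contDiff_dirDeriv_iterate _ _ ih.1, by rw [ih.2, it i _ _ ih.1]⟩
  exact congrFun (main _).2 y

/-! ### Synthesis -/

/-- The conjugated time-frequency shifts of the window. -/
def conjShift (ht : 0 < t) (hs : 0 < s) (ψ : Space t s d) (w : Rn d × Rn d) : Space t s d :=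
  conj (timeFreqShift ht hs w.1 w.2 ψ)

theorem conj_planeWave (ξ y : Rn d) : starRingEnd ℂ (planeWave ξ y) = planeWave (-ξ) y := by
  rw [planeWave, planeWave, ← Complex.exp_conj]
  simp

theorem conjShift_apply (ht : 0 < t) (hs : 0 < s) (ψ : Space t s d) (w : Rn d × Rn d) (y : Rn d) :
    conjShift ht hs ψ w y = planeWave (-w.2) y * starRingEnd ℂ (ψ (y - w.1)) := by
  rw [← conj_planeWave, ← map_mul]
  rfl

theorem conjShift_eq (ht : 0 < t) (hs : 0 < s) (ψ : Space t s d) (w : Rn d × Rn d) :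
    conjShift ht hs ψ w = timeFreqShift ht hs w.1 (-w.2) (conj ψ) :=
  Subtype.ext (funext fun y => conjShift_apply ht hs ψ w y)

theorem exists_conjShift_bound (ht : 0 < t) (hs : 0 < s) (ψ : Space t s d)
    (h : {h : ℝ // 0 < h}) : ∃ C ν : ℝ, 0 ≤ C ∧ 0 < ν ∧ ∀ w : Rn d × Rn d,
      gsSeminorm t s d h (conjShift ht hs ψ w) ≤ C * Real.exp (ν * aniso t s w) := by
  obtain ⟨C, ν, hC, hν, H⟩ := exists_timeFreqShift_bound ht hs (conj ψ) h
  refine ⟨C, ν, hC, hν, fun w => ?_⟩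
  rw [conjShift_eq]
  refine (H w.1 (-w.2)).trans (le_of_eq ?_)
  simp [aniso]

theorem contDiff_conjShift (ht : 0 < t) (hs : 0 < s) (ψ : Space t s d) :
    ContDiff ℝ ∞ (fun p : (Rn d × Rn d) × Rn d => conjShift ht hs ψ p.1 p.2) := by
  simp only [conjShift_apply, planeWave]
  have h1 : ContDiff ℝ ∞ (fun p : (Rn d × Rn d) × Rn d => ψ (p.2 - p.1.1)) :=
    ψ.2.1.comp (contDiff_snd.sub contDiff_fst.fst)
  have h2 : ContDiff ℝ ∞ (fun p : (Rn d × Rn d) × Rn d => inner ℝ p.2 (-p.1.2)) :=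
    contDiff_snd.inner ℝ contDiff_fst.snd.neg
  exact ((contDiff_const.mul (Complex.ofRealCLM.contDiff.comp h2)).cexp).mul
    (Complex.conjCLE.contDiff.comp h1)

theorem continuous_conjShift (ht : 0 < t) (hs : 0 < s) (ψ : Space t s d) :
    Continuous (fun p : (Rn d × Rn d) × Rn d => conjShift ht hs ψ p.1 p.2) :=
  (contDiff_conjShift ht hs ψ).continuous

theorem continuous_timeFreqShift (ht : 0 < t) (hs : 0 < s) (ψ : Space t s d) :
    Continuous (fun p : (Rn d × Rn d) × Rn d => timeFreqShift ht hs p.1.1 p.1.2 ψ p.2) := by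
  have h1 : Continuous fun p : (Rn d × Rn d) × Rn d => planeWave p.1.2 p.2 :=
    continuous_planeWave_uncurry.comp (continuous_fst.snd.prodMk continuous_snd)
  have h2 := ψ.2.1.continuous
  simp only [timeFreqShift_apply]
  fun_prop

variable (t s) in
/-- Measurable functions on phase space that decay faster than any `e^{-ν ρ}`, where `ρ` is the
anisotropic gauge. -/
def Admissible (G : Rn d × Rn d → ℂ) : Prop :=
  AEStronglyMeasurable G ∧ ∀ ν : ℝ, Integrable (fun w => Real.exp (ν * aniso t s w) * ‖G w‖)

theorem admissible_of_bound (ht : 0 < t) (hs : 0 < s) {G : Rn d × Rn d → ℂ}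
    (hG : AEStronglyMeasurable G)
    (H : ∀ r : ℝ, ∃ C : ℝ, ∀ w, ‖G w‖ ≤ C * Real.exp (-(r * aniso t s w))) :
    Admissible t s G := by
  refine ⟨hG, fun ν => ?_⟩
  obtain ⟨C, hC⟩ := H (ν + 1)
  refine ((integrable_exp_neg_aniso one_pos ht hs).const_mul C).mono' ?_
    (Filter.Eventually.of_forall fun w => ?_)
  · have := continuous_aniso (d := d) ht hs
    have h1 : Continuous fun w : Rn d × Rn d => Real.exp (ν * aniso t s w) := by fun_prop
    exact h1.aestronglyMeasurable.mul hG.norm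
  · rw [norm_mul, norm_norm, Real.norm_eq_abs, Real.abs_exp]
    calc _ ≤ Real.exp (ν * aniso t s w) * (C * Real.exp (-((ν + 1) * aniso t s w))) := by
          gcongr; exact hC w
      _ = C * (Real.exp (ν * aniso t s w) * Real.exp (-((ν + 1) * aniso t s w))) := by ring
      _ = _ := by
          rw [← Real.exp_add]
          congr 2
          ring

theorem partialDeriv_conjShift_bound (ht : 0 < t) (hs : 0 < s) (ψ : Space t s d)
    (β : Fin d → ℕ) : ∃ C ν : ℝ, ∀ w y, ‖partialDeriv β (conjShift ht hs ψ w) y‖ ≤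
      C * Real.exp (ν * aniso t s w) := by
  obtain ⟨C, ν, hC, hν, H⟩ := exists_conjShift_bound ht hs ψ ⟨1, one_pos⟩
  refine ⟨C * mfact β ^ s, ν, fun w y => ?_⟩
  have h1 := gsSeminorm_bound ⟨1, one_pos⟩ (conjShift ht hs ψ w) 0 β y
  simp only [mpow, Pi.zero_apply, pow_zero, Finset.prod_const_one, Complex.ofReal_one, one_mul,
    mfact_zero, Real.one_rpow, one_pow] at h1
  have := Real.rpow_pos_of_pos (mfact_pos β) s
  calc _ ≤ _ := h1
    _ ≤ (C * Real.exp (ν * aniso t s w)) * mfact β ^ s := by gcongr; exact H w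
    _ = _ := by ring

theorem measurable_partialDeriv_conjShift (ht : 0 < t) (hs : 0 < s) (ψ : Space t s d)
    (β : Fin d → ℕ) (y : Rn d) :
    Continuous fun w => partialDeriv β (conjShift ht hs ψ w) y := by
  have h := contDiff_conjShift ht hs ψ
  have h1 := contDiff_multiDeriv (fun i => ((0 : Rn d × Rn d), stdVec i)) β h
  have h2 : (fun w => partialDeriv β (conjShift ht hs ψ w) y) = fun w =>
      multiDeriv (fun i => ((0 : Rn d × Rn d), stdVec i)) β
        (fun p : (Rn d × Rn d) × Rn d => conjShift ht hs ψ p.1 p.2) (w, y) :=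
    funext fun w => partialDeriv_slice h β w y
  rw [h2]
  exact h1.continuous.comp (by fun_prop)

theorem partialDeriv_const_mul (c : ℂ) {f : Rn d → ℂ} (hf : ContDiff ℝ ∞ f) (β : Fin d → ℕ)
    (y : Rn d) : partialDeriv β (fun y => c * f y) y = c * partialDeriv β f y :=
  congrFun (multiDeriv_smul stdVec β c hf) y

theorem partialDeriv_synthesis (ht : 0 < t) (hs : 0 < s) (ψ : Space t s d)
    {G : Rn d × Rn d → ℂ} (hG : Admissible t s G) :
    ContDiff ℝ ∞ (fun y => ∫ w, G w * conjShift ht hs ψ w y) ∧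
      ∀ β y, partialDeriv β (fun y => ∫ w, G w * conjShift ht hs ψ w y) y =
        ∫ w, G w * partialDeriv β (conjShift ht hs ψ w) y := by
  choose C ν H using partialDeriv_conjShift_bound ht hs ψ
  have e : ∀ β w y, partialDeriv β (fun y => G w * conjShift ht hs ψ w y) y =
      G w * partialDeriv β (conjShift ht hs ψ w) y := fun β w y =>
    partialDeriv_const_mul (G w) (conjShift ht hs ψ w).2.1 β y
  have key := partialDeriv_integral (μ := (volume : Measure (Rn d × Rn d)))
    (F := fun w y => G w * conjShift ht hs ψ w y)
    (B := fun β w => C β * (Real.exp (ν β * aniso t s w) * ‖G w‖))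
    (fun w => contDiff_const.mul (conjShift ht hs ψ w).2.1)
    (fun β y => by
      simp only [e]
      exact hG.1.mul (measurable_partialDeriv_conjShift ht hs ψ β y).aestronglyMeasurable)
    (fun β => (hG.2 (ν β)).const_mul _)
    (fun β w y => by
      rw [e, norm_mul]
      calc _ ≤ ‖G w‖ * (C β * Real.exp (ν β * aniso t s w)) := by gcongr; exact H β w y
        _ = _ := by ring)
  simp only [e] at key
  exact key

/-- The seminorms of the shifts grow exponentially in w, so the triangle inequality under the
integral yields a weighted L¹ norm of G. The rate ν varies with h, which is why admissibility asks
for every rate. -/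
theorem synthesis_bound (ht : 0 < t) (hs : 0 < s) (ψ : Space t s d) (h : {h : ℝ // 0 < h}) :
    ∃ C ν : ℝ, 0 ≤ C ∧ 0 < ν ∧ ∀ G : Rn d × Rn d → ℂ, Admissible t s G → ∀ α β y,
      ‖(mpow y α : ℂ) * partialDeriv β (fun y => ∫ w, G w * conjShift ht hs ψ w y) y‖ ≤
        (C * ∫ w, Real.exp (ν * aniso t s w) * ‖G w‖) *
          (h.1 ^ (msize α + msize β) * mfact α ^ t * mfact β ^ s) := by
  obtain ⟨C, ν, hC, hν, H⟩ := exists_conjShift_bound ht hs ψ h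
  refine ⟨C, ν, hC, hν, fun G hG α β y => ?_⟩
  rw [(partialDeriv_synthesis ht hs ψ hG).2 β y, ← integral_const_mul]
  have hw := weight_pos (t := t) (s := s) h.2 α β
  set W := h.1 ^ (msize α + msize β) * mfact α ^ t * mfact β ^ s
  have e : C * (∫ w, Real.exp (ν * aniso t s w) * ‖G w‖) * W =
      ∫ w, C * W * (Real.exp (ν * aniso t s w) * ‖G w‖) := by
    rw [integral_const_mul]; ring
  rw [e]
  refine norm_integral_le_of_norm_le ((hG.2 ν).const_mul _)
    (Filter.Eventually.of_forall fun w => ?_)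
  have h1 := gsSeminorm_bound h (conjShift ht hs ψ w) α β y
  calc ‖(mpow y α : ℂ) * (G w * partialDeriv β (conjShift ht hs ψ w) y)‖
      = ‖G w‖ * ‖(mpow y α : ℂ) * partialDeriv β (conjShift ht hs ψ w) y‖ := by
        rw [← norm_mul]; congr 1; ring
    _ ≤ ‖G w‖ * (C * Real.exp (ν * aniso t s w) * W) := by
        gcongr
        exact h1.trans (by gcongr; exact H w)
    _ = _ := by ring

/-- The superposition `∫ G(w) \overline{π(w) ψ} dw` of conjugated time-frequency shifts. -/
def synth (ht : 0 < t) (hs : 0 < s) (ψ : Space t s d) {G : Rn d × Rn d → ℂ}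
    (hG : Admissible t s G) : Space t s d :=
  ⟨fun y => ∫ w, G w * conjShift ht hs ψ w y, isGelfandShilov_iff.2
    ⟨(partialDeriv_synthesis ht hs ψ hG).1, fun h hh => by
      obtain ⟨C, ν, -, -, H⟩ := synthesis_bound ht hs ψ ⟨h, hh⟩
      exact ⟨_, fun α β y => H G hG α β y⟩⟩⟩

theorem synth_apply (ht : 0 < t) (hs : 0 < s) (ψ : Space t s d) {G : Rn d × Rn d → ℂ}
    (hG : Admissible t s G) (y : Rn d) :
    synth ht hs ψ hG y = ∫ w, G w * conjShift ht hs ψ w y := rfl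

theorem exists_synth_bound (ht : 0 < t) (hs : 0 < s) (ψ : Space t s d) (h : {h : ℝ // 0 < h}) :
    ∃ C ν : ℝ, 0 ≤ C ∧ 0 < ν ∧ ∀ (G : Rn d × Rn d → ℂ) (hG : Admissible t s G),
      gsSeminorm t s d h (synth ht hs ψ hG) ≤ C * ∫ w, Real.exp (ν * aniso t s w) * ‖G w‖ := by
  obtain ⟨C, ν, hC, hν, H⟩ := synthesis_bound ht hs ψ h
  exact ⟨C, ν, hC, hν, fun G hG => gsSeminorm_le fun α β y => H G hG α β y⟩

/-! ### The inversion formula -/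

theorem stronglyMeasurable_analysis (ht : 0 < t) (hs : 0 < s) (ψ f : Space t s d) :
    StronglyMeasurable (analysis ht hs ψ f) := by
  refine StronglyMeasurable.integral_prod_right' (f := fun p : (Rn d × Rn d) × Rn d =>
    f p.2 * timeFreqShift ht hs p.1.1 p.1.2 ψ p.2) ?_
  exact ((f.2.1.continuous.comp continuous_snd).mul
    (continuous_timeFreqShift ht hs ψ)).stronglyMeasurable

theorem admissible_analysis (ht : 0 < t) (hs : 0 < s) (ψ f : Space t s d) :
    Admissible t s (analysis ht hs ψ f) := by
  refine admissible_of_bound ht hs (stronglyMeasurable_analysis ht hs ψ f).aestronglyMeasurable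
    fun r => ?_
  obtain ⟨h, C, -, H⟩ := exists_analysis_bound ht hs ψ r
  exact ⟨_, fun w => H f w⟩

/-- The constant `(2π)^d ‖ψ‖²` in the inversion formula. -/
def windowConst (ψ : Space t s d) : ℝ := (2 * Real.pi) ^ d * ∫ y : Rn d, ‖ψ y‖ ^ 2

theorem windowConst_pos {ψ : Space t s d} (hψ : ψ ≠ 0) : 0 < windowConst ψ := by
  have hc : Continuous fun y => ‖ψ y‖ ^ 2 := ψ.2.1.continuous.norm.pow 2
  have hint : Integrable fun y => ‖ψ y‖ ^ 2 := by
    have := (integrable_mul_space ψ ψ).norm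
    simpa [norm_mul, pow_two] using this
  have h0 : ∀ y, 0 ≤ ‖ψ y‖ ^ 2 := fun y => by positivity
  have hpos : 0 < ∫ y : Rn d, ‖ψ y‖ ^ 2 := by
    refine lt_of_le_of_ne (integral_nonneg h0) fun h => hψ ?_
    rw [eq_comm, integral_eq_zero_iff_of_nonneg h0 hint] at h
    have h1 := (Continuous.ae_eq_iff_eq volume hc continuous_const).1 h
    refine Subtype.ext (funext fun y => ?_)
    have h2 : ‖ψ y‖ ^ 2 = 0 := congrFun h1 y
    have h3 : ψ y = 0 := by simpa using h2
    exact h3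
  unfold windowConst
  positivity

/-- The substitution ξ = -2πη converts to the normalisation e^{-2πi⟨·,·⟩} with its sign; its
Jacobian is the constant (2π)^d. -/
theorem fourier_inversion_scaled {g : Rn d → ℂ} (hc : Continuous g) (hg : Integrable g)
    (hF : Integrable fun ξ : Rn d => ∫ y, g y * planeWave ξ y) (y : Rn d) :
    ∫ ξ, (∫ y', g y' * planeWave ξ y') * planeWave (-ξ) y = (2 * Real.pi) ^ d * g y := by
  set H : Rn d → ℂ := fun ξ => ∫ y, g y * planeWave ξ y with hH
  have hpi : (2 * Real.pi : ℝ) ≠ 0 := by positivity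
  have e1 : ∀ η : Rn d, 𝓕 g η = H ((-(2 * Real.pi)) • η) := by
    intro η
    rw [Real.fourier_eq', hH]
    refine integral_congr_ae (Filter.Eventually.of_forall fun v => ?_)
    simp only [smul_eq_mul, planeWave, real_inner_smul_right]
    rw [mul_comm]
    congr 2
    push_cast
    ring
  have hFg : Integrable (𝓕 g) := by
    have := hF.comp_smul (R := -(2 * Real.pi)) (neg_ne_zero.2 hpi)
    exact this.congr (Filter.Eventually.of_forall fun η => (e1 η).symm)
  have inv := congrFun (hc.fourierInv_fourier_eq hg hFg) y
  rw [Real.fourierInv_eq'] at inv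
  have e2 := Measure.integral_comp_smul (μ := (volume : Measure (Rn d)))
    (fun ξ => H ξ * planeWave (-ξ) y) (-(2 * Real.pi))
  have e3 : ∀ η : Rn d, H ((-(2 * Real.pi)) • η) * planeWave (-((-(2 * Real.pi)) • η)) y =
      Complex.exp (↑(2 * Real.pi * inner ℝ η y) * Complex.I) • 𝓕 g η := by
    intro η
    rw [e1, smul_eq_mul, mul_comm]
    congr 1
    rw [planeWave, neg_smul, neg_neg, real_inner_smul_right, real_inner_comm, mul_comm]
  simp only [e3, inv] at e2
  rw [finrank_euclideanSpace_fin] at e2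
  rw [e2, Complex.real_smul]
  have e4 : |((-(2 * Real.pi)) ^ d)⁻¹| = ((2 * Real.pi) ^ d)⁻¹ := by
    rw [abs_inv, abs_pow, abs_neg, abs_of_pos (by positivity)]
  rw [e4]
  push_cast
  rw [mul_inv_cancel_left₀]
  exact pow_ne_zero _ (by exact_mod_cast hpi)

theorem norm_conjShift_le (ht : 0 < t) (hs : 0 < s) (ψ : Space t s d) (w : Rn d × Rn d)
    (y : Rn d) : ‖conjShift ht hs ψ w y‖ ≤ gsSeminorm t s d ⟨1, one_pos⟩ ψ := by
  rw [conjShift_apply, norm_mul, norm_planeWave, one_mul, Complex.norm_conj]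
  exact norm_le_gsSeminorm ψ _

theorem Admissible.integrable {G : Rn d × Rn d → ℂ} (hG : Admissible t s G) : Integrable G := by
  have := hG.2 0
  simp only [zero_mul, Real.exp_zero, one_mul] at this
  exact (integrable_norm_iff hG.1).1 this

theorem Admissible.integrable_mul_conjShift (ht : 0 < t) (hs : 0 < s) (ψ : Space t s d)
    {G : Rn d × Rn d → ℂ} (hG : Admissible t s G) (y : Rn d) :
    Integrable fun w => G w * conjShift ht hs ψ w y :=
  hG.integrable.mul_bdd (c := gsSeminorm t s d ⟨1, one_pos⟩ ψ)
    ((continuous_conjShift ht hs ψ).comp (by fun_prop : Continuous fun w : Rn d × Rn d =>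
      (w, y))).aestronglyMeasurable
    (Filter.Eventually.of_forall fun w => norm_conjShift_le ht hs ψ w y)

/-- For fixed position x, the frequency integral is Fourier inversion for f·ψ(·-x) and gives (2π)^d
|ψ(y-x)|² f(y). Integration over x leaves the squared norm of the window. -/
theorem synth_analysis_apply (ht : 0 < t) (hs : 0 < s) (ψ f : Space t s d) (y : Rn d) :
    ∫ w, analysis ht hs ψ f w * conjShift ht hs ψ w y = windowConst ψ * f y := by
  have hadm := admissible_analysis ht hs ψ f
  have hint := hadm.integrable_mul_conjShift ht hs ψ y
  have hfc := f.2.1.continuous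
  have hψc := ψ.2.1.continuous
  rw [Measure.volume_eq_prod] at hint ⊢
  rw [integral_prod _ hint]
  have inner1 : ∀ x : Rn d, ∫ ξ, analysis ht hs ψ f (x, ξ) * conjShift ht hs ψ (x, ξ) y =
      ((2 * Real.pi) ^ d * ‖ψ (y - x)‖ ^ 2 : ℝ) * f y := by
    intro x
    have e : ∀ ξ, analysis ht hs ψ f (x, ξ) = ∫ y', (f y' * ψ (y' - x)) * planeWave ξ y' := by
      intro ξ
      refine integral_congr_ae (Filter.Eventually.of_forall fun y => ?_)
      simp only [timeFreqShift_apply]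
      ring
    have hg : Integrable fun y' => f y' * ψ (y' - x) :=
      (integrable_space f).mul_bdd (c := gsSeminorm t s d ⟨1, one_pos⟩ ψ)
        (by fun_prop : Continuous fun y' => ψ (y' - x)).aestronglyMeasurable
        (Filter.Eventually.of_forall fun y' => norm_le_gsSeminorm ψ _)
    have hF : Integrable fun ξ : Rn d => ∫ y', (f y' * ψ (y' - x)) * planeWave ξ y' := by
      obtain ⟨h, C, hC, H⟩ := exists_analysis_bound ht hs ψ 1
      refine ((integrable_exp_neg_mul_norm_rpow (d := d) one_pos (one_div_pos.2 hs)).const_mul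
        (C * gsSeminorm t s d h f)).mono' ?_ (Filter.Eventually.of_forall fun ξ => ?_)
      · have := (stronglyMeasurable_analysis ht hs ψ f).comp_measurable
          (measurable_prodMk_left (x := x))
        refine this.aestronglyMeasurable.congr (Filter.Eventually.of_forall fun ξ => e ξ)
      · rw [← e]
        refine (H f (x, ξ)).trans ?_
        have := gsSeminorm_nonneg h f
        refine mul_le_mul_of_nonneg_left (Real.exp_le_exp.2 (neg_le_neg ?_)) (by positivity)
        simp only [aniso, one_mul]
        have : 0 ≤ ‖x‖ ^ (1 / t) := by positivity
        linarith
    have := fourier_inversion_scaled (by fun_prop) hg hF y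
    simp only [e, conjShift_apply, ← mul_assoc]
    rw [integral_mul_const, this]
    push_cast
    rw [← Complex.mul_conj']
    ring
  simp only [inner1]
  rw [integral_mul_const, integral_complex_ofReal, integral_const_mul,
    integral_sub_left_eq_self (fun x => ‖ψ x‖ ^ 2)]
  rfl

theorem synth_analysis (ht : 0 < t) (hs : 0 < s) (ψ f : Space t s d) :
    synth ht hs ψ (admissible_analysis ht hs ψ f) = (windowConst ψ : ℂ) • f :=
  Subtype.ext (funext fun y => synth_analysis_apply ht hs ψ f y)

end Synthesis

section Representation

variable {d : ℕ} {t s : ℝ}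

/-! ### Ultradistributions as superpositions -/

theorem exists_gsSeminorm_sup_le (S : Finset {h : ℝ // 0 < h}) :
    ∃ h : {h : ℝ // 0 < h}, ∀ f : Space t s d,
      S.sup (gsSeminorm t s d) f ≤ gsSeminorm t s d h f := by
  induction S using Finset.induction_on with
  | empty => exact ⟨⟨1, one_pos⟩, fun f => by simp⟩
  | insert k S _ ih =>
    obtain ⟨h, H⟩ := ih
    refine ⟨min k h, fun f => ?_⟩
    rw [Finset.sup_insert]
    exact max_le (gsSeminorm_anti (min_le_left _ _) f)
      ((H f).trans (gsSeminorm_anti (min_le_right _ _) f))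

theorem exists_ultradistribution_bound (u : Ultradistribution t s d) :
    ∃ (h : {h : ℝ // 0 < h}) (C : ℝ), 0 ≤ C ∧ ∀ f, ‖u f‖ ≤ C * gsSeminorm t s d h f := by
  have hc : Continuous fun f : Space t s d => u f := (WeakDual.toStrongDual u).continuous
  obtain ⟨S, C, -, H⟩ := Seminorm.bound_of_continuous space_withSeminorms
    ((normSeminorm ℂ ℂ).comp (WeakDual.toStrongDual u).toLinearMap) hc.norm
  obtain ⟨h, Hh⟩ := exists_gsSeminorm_sup_le (t := t) (s := s) (d := d) S
  refine ⟨h, C, C.2, fun f => (H f).trans ?_⟩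
  exact mul_le_mul_of_nonneg_left (Hh f) C.2

/-- The bound makes u factor through the range of J as a bounded functional; Hahn-Banach extends it
to H and the Riesz theorem gives the vector. -/
theorem exists_inner_eq_of_norm_le {E H : Type*} [AddCommGroup E] [Module ℂ E]
    [NormedAddCommGroup H] [InnerProductSpace ℂ H] [CompleteSpace H] (J : E →ₗ[ℂ] H)
    (u : E →ₗ[ℂ] ℂ) (C : ℝ) (hu : ∀ f, ‖u f‖ ≤ C * ‖J f‖) :
    ∃ v : H, ∀ f, u f = inner ℂ v (J f) := by
  -- A purely algebraic section suffices: continuity on the range comes from the bound, and so does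
  -- independence of the chosen preimage.
  obtain ⟨g, hg⟩ := J.rangeRestrict.exists_rightInverse_of_surjective
    (LinearMap.range_rangeRestrict J)
  have hJg : ∀ x, J (g x) = x := fun x =>
    congrArg Subtype.val (LinearMap.congr_fun hg x)
  obtain ⟨L, hL, -⟩ := exists_extension_norm_eq (LinearMap.range J)
    ((u.comp g).mkContinuous C fun x => by
      have := hu (g x)
      rwa [hJg] at this)
  refine ⟨(InnerProductSpace.toDual ℂ H).symm L, fun f => ?_⟩
  rw [InnerProductSpace.toDual_symm_apply]
  have h1 := hL (J.rangeRestrict f)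
  have h2 : u (f - g (J.rangeRestrict f)) = 0 := by
    have h3 : J (f - g (J.rangeRestrict f)) = 0 := by
      rw [map_sub, hJg]
      simp
    have := hu (f - g (J.rangeRestrict f))
    rw [h3] at this
    simpa using this
  rw [map_sub, sub_eq_zero] at h2
  rw [h2]
  exact h1.symm

theorem memLp_two_of_bound (ht : 0 < t) (hs : 0 < s) {E : Type*} [NormedAddCommGroup E]
    {F : Rn d × Rn d → E} (hF : AEStronglyMeasurable F) (C : ℝ)
    (H : ∀ w, ‖F w‖ ≤ C * Real.exp (-aniso t s w)) : MemLp F 2 := by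
  have hc : Continuous fun w : Rn d × Rn d => Real.exp (-aniso t s w) := by
    have := continuous_aniso (d := d) ht hs
    fun_prop
  have h1 : MemLp (fun w : Rn d × Rn d => Real.exp (-aniso t s w)) 2 := by
    rw [memLp_two_iff_integrable_sq hc.aestronglyMeasurable]
    refine (integrable_exp_neg_aniso two_pos ht hs).congr
      (Filter.Eventually.of_forall fun w => ?_)
    simp only [pow_two]
    rw [← Real.exp_add]
    congr 1
    ring
  exact (h1.const_mul C).mono' hF (Filter.Eventually.of_forall H)

theorem continuous_exp_aniso (ht : 0 < t) (hs : 0 < s) (ν : ℝ) :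
    Continuous fun w : Rn d × Rn d => Real.exp (ν * aniso t s w) := by
  have := continuous_aniso (d := d) ht hs
  fun_prop

theorem memLp_weighted_analysis (ht : 0 < t) (hs : 0 < s) (ψ : Space t s d) (ν : ℝ)
    (f : Space t s d) :
    MemLp (fun w => (Real.exp (ν * aniso t s w) : ℂ) * analysis ht hs ψ f w) 2 := by
  obtain ⟨h, C, hC, H⟩ := exists_analysis_bound ht hs ψ (ν + 1)
  refine memLp_two_of_bound ht hs ?_ (C * gsSeminorm t s d h f) fun w => ?_
  · exact (Complex.continuous_ofReal.comp
      (continuous_exp_aniso ht hs ν)).aestronglyMeasurable.mul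
      (stronglyMeasurable_analysis ht hs ψ f).aestronglyMeasurable
  · rw [norm_mul, Complex.norm_real, Real.norm_eq_abs, Real.abs_exp]
    calc _ ≤ Real.exp (ν * aniso t s w) *
          (C * gsSeminorm t s d h f * Real.exp (-((ν + 1) * aniso t s w))) := by
          gcongr; exact H f w
      _ = C * gsSeminorm t s d h f *
          (Real.exp (ν * aniso t s w) * Real.exp (-((ν + 1) * aniso t s w))) := by ring
      _ = _ := by
          rw [← Real.exp_add]
          congr 2
          ring

theorem integrable_mul_timeFreqShift (ht : 0 < t) (hs : 0 < s) (ψ f : Space t s d)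
    (w : Rn d × Rn d) : Integrable fun y => f y * timeFreqShift ht hs w.1 w.2 ψ y :=
  integrable_mul_space f (timeFreqShift ht hs w.1 w.2 ψ)

theorem analysis_add (ht : 0 < t) (hs : 0 < s) (ψ f g : Space t s d) (w : Rn d × Rn d) :
    analysis ht hs ψ (f + g) w = analysis ht hs ψ f w + analysis ht hs ψ g w := by
  rw [analysis, analysis, analysis, ← integral_add (integrable_mul_timeFreqShift ht hs ψ f w)
    (integrable_mul_timeFreqShift ht hs ψ g w)]
  exact integral_congr_ae (Filter.Eventually.of_forall fun y => add_mul _ _ _)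

theorem analysis_smul (ht : 0 < t) (hs : 0 < s) (ψ : Space t s d) (c : ℂ) (f : Space t s d)
    (w : Rn d × Rn d) : analysis ht hs ψ (c • f) w = c * analysis ht hs ψ f w := by
  rw [analysis, analysis, ← integral_const_mul]
  exact integral_congr_ae (Filter.Eventually.of_forall fun y => mul_assoc _ _ _)

/-- The exponentially weighted transform, with values in `L²`. -/
def weightedAnalysis (ht : 0 < t) (hs : 0 < s) (ψ : Space t s d) (ν : ℝ) :
    Space t s d →ₗ[ℂ] Lp ℂ 2 (volume : Measure (Rn d × Rn d)) where
  toFun f := (memLp_weighted_analysis ht hs ψ ν f).toLp _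
  map_add' f g := by
    rw [← MemLp.toLp_add]
    refine MemLp.toLp_congr _ _ (Filter.Eventually.of_forall fun w => ?_)
    simp only [Pi.add_apply, analysis_add, mul_add]
  map_smul' c f := by
    rw [RingHom.id_apply, ← MemLp.toLp_const_smul]
    refine MemLp.toLp_congr _ _ (Filter.Eventually.of_forall fun w => ?_)
    simp only [Pi.smul_apply, analysis_smul, smul_eq_mul]
    ring

/-- Cauchy-Schwarz against e^{-ρ}, with ρ the gauge; this costs one unit of the exponential rate. -/
theorem integral_norm_analysis_le (ht : 0 < t) (hs : 0 < s) (ψ : Space t s d) (ν : ℝ) :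
    ∃ C : ℝ, 0 ≤ C ∧ ∀ f, ∫ w, Real.exp (ν * aniso t s w) * ‖analysis ht hs ψ f w‖ ≤
      C * ‖weightedAnalysis ht hs ψ (ν + 1) f‖ := by
  have hm : MemLp (fun w : Rn d × Rn d => Real.exp (-aniso t s w)) 2 :=
    memLp_two_of_bound ht hs (by
      have := continuous_exp_aniso (d := d) ht hs (-1)
      simpa using this.aestronglyMeasurable) 1 fun w => by simp
  refine ⟨‖hm.toLp‖, norm_nonneg _, fun f => ?_⟩
  have hf := memLp_weighted_analysis ht hs ψ (ν + 1) f
  have h1 := real_inner_le_norm hm.toLp hf.norm.toLp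
  have h2 : ‖hf.norm.toLp‖ = ‖weightedAnalysis ht hs ψ (ν + 1) f‖ := by
    change _ = ‖hf.toLp‖
    rw [Lp.norm_toLp, Lp.norm_toLp, eLpNorm_norm]
  rw [h2] at h1
  refine le_trans (le_of_eq ?_) h1
  rw [L2.inner_def]
  refine integral_congr_ae ?_
  filter_upwards [hm.coeFn_toLp, hf.norm.coeFn_toLp] with w e1 e2
  rw [e1, e2, norm_mul, Complex.norm_real, Real.norm_eq_abs, Real.abs_exp]
  simp only [RCLike.inner_apply, conj_trivial]
  have : Real.exp (ν * aniso t s w) =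
      Real.exp (-aniso t s w) * Real.exp ((ν + 1) * aniso t s w) := by
    rw [← Real.exp_add]; congr 1; ring
  rw [this]
  ring

/-- Every ultradistribution is a superposition of time-frequency shifts of a given window, with a
density of at most exponential growth with respect to the anisotropic gauge. -/
theorem exists_representation (ht : 0 < t) (hs : 0 < s) {ψ : Space t s d} (hψ : ψ ≠ 0)
    (u : Ultradistribution t s d) : ∃ (F : Rn d × Rn d → ℂ) (R : ℝ), AEStronglyMeasurable F ∧
      Integrable (fun w => Real.exp (-(R * aniso t s w)) * ‖F w‖) ∧
      ∀ f, u f = ∫ w, F w * analysis ht hs ψ f w := by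
  obtain ⟨h, C, hC, hu⟩ := exists_ultradistribution_bound u
  obtain ⟨C₁, ν, hC₁, -, H₁⟩ := exists_synth_bound ht hs ψ h
  obtain ⟨C₂, hC₂, H₂⟩ := integral_norm_analysis_le ht hs ψ ν
  have hc := windowConst_pos hψ
  -- By the inversion formula, the seminorm controlling u is at most a weighted L¹ norm of the
  -- transform of f, and hence at most its weighted L² norm.
  obtain ⟨v, hv⟩ := exists_inner_eq_of_norm_le (weightedAnalysis ht hs ψ (ν + 1))
    (WeakDual.toStrongDual u).toLinearMap (C * ((windowConst ψ)⁻¹ * (C₁ * C₂))) (fun f => by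
      refine (hu f).trans ?_
      rw [mul_assoc]
      refine mul_le_mul_of_nonneg_left ?_ hC
      have h1 := H₁ _ (admissible_analysis ht hs ψ f)
      rw [synth_analysis, map_smul_eq_mul, Complex.norm_real, Real.norm_eq_abs, abs_of_pos hc] at h1
      rw [mul_assoc, ← div_eq_inv_mul, le_div_iff₀ hc, mul_comm]
      refine h1.trans ?_
      rw [mul_assoc]
      exact mul_le_mul_of_nonneg_left (H₂ f) hC₁)
  have hvm : MemLp v 2 := Lp.memLp v
  have hexp := continuous_exp_aniso (d := d) ht hs
  -- The conjugate and the weight undo the inner product with the weighted transform. The extra unit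
  -- in ν + 2 is spent on Cauchy-Schwarz, since v is only square integrable.
  refine ⟨fun w => starRingEnd ℂ (v w) * (Real.exp ((ν + 1) * aniso t s w) : ℂ), ν + 2, ?_, ?_,
    fun f => ?_⟩
  · exact (Complex.continuous_conj.comp_aestronglyMeasurable hvm.1).mul
      (Complex.continuous_ofReal.comp (hexp (ν + 1))).aestronglyMeasurable
  · have hm : MemLp (fun w : Rn d × Rn d => Real.exp (-aniso t s w)) 2 :=
      memLp_two_of_bound ht hs (by simpa using (hexp (-1)).aestronglyMeasurable) 1
        fun w => by simp
    refine (hm.integrable_mul hvm.norm).congr (Filter.Eventually.of_forall fun w => ?_)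
    simp only [Pi.mul_apply, norm_mul, Complex.norm_real, Real.norm_eq_abs, Real.abs_exp,
      RCLike.norm_conj]
    have : Real.exp (-aniso t s w) =
        Real.exp (-((ν + 2) * aniso t s w)) * Real.exp ((ν + 1) * aniso t s w) := by
      rw [← Real.exp_add]; congr 1; ring
    rw [this]
    ring
  · have h1 := hv f
    rw [L2.inner_def] at h1
    refine h1.trans (integral_congr_ae ?_)
    filter_upwards [(memLp_weighted_analysis ht hs ψ (ν + 1) f).coeFn_toLp] with w e1
    rw [RCLike.inner_apply]
    change (MemLp.toLp _ (memLp_weighted_analysis ht hs ψ (ν + 1) f)) w * _ = _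
    rw [e1]
    ring

/-! ### Application of an ultradistribution to a synthesis -/

theorem analysis_synth (ht : 0 < t) (hs : 0 < s) (χ ψ : Space t s d) {G : Rn d × Rn d → ℂ}
    (hG : Admissible t s G) (w' : Rn d × Rn d) :
    analysis ht hs χ (synth ht hs ψ hG) w' =
      ∫ w, G w * analysis ht hs χ (conjShift ht hs ψ w) w' := by
  have hint : Integrable (Function.uncurry fun (y : Rn d) (w : Rn d × Rn d) =>
      G w * conjShift ht hs ψ w y * timeFreqShift ht hs w'.1 w'.2 χ y)
      (volume.prod volume) := by
    have h1 := (integrable_space (timeFreqShift ht hs w'.1 w'.2 χ)).mul_prod hG.integrable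
    have hsw : Continuous fun p : Rn d × (Rn d × Rn d) => (p.2, p.1) := by fun_prop
    have hm := (continuous_conjShift ht hs ψ).comp hsw
    refine (h1.mul_bdd (c := gsSeminorm t s d ⟨1, one_pos⟩ ψ) hm.aestronglyMeasurable
      (Filter.Eventually.of_forall fun p => norm_conjShift_le ht hs ψ p.2 p.1)).congr
        (Filter.Eventually.of_forall fun p => ?_)
    simp only [Function.uncurry, Function.comp_apply]
    ring
  calc analysis ht hs χ (synth ht hs ψ hG) w'
      = ∫ y, ∫ w, G w * conjShift ht hs ψ w y * timeFreqShift ht hs w'.1 w'.2 χ y := by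
        refine integral_congr_ae (Filter.Eventually.of_forall fun y => ?_)
        simp only [synth_apply]
        rw [integral_mul_const]
    _ = ∫ w, ∫ y, G w * conjShift ht hs ψ w y * timeFreqShift ht hs w'.1 w'.2 χ y :=
        integral_integral_swap hint
    _ = _ := by
        refine integral_congr_ae (Filter.Eventually.of_forall fun w => ?_)
        simp only [mul_assoc]
        rw [integral_const_mul]
        rfl

/-- The representation of u turns this interchange into a scalar Fubini theorem on the product of
two phase spaces, so no vector-valued integral is involved. -/
theorem apply_synth (ht : 0 < t) (hs : 0 < s) {ψ : Space t s d} (hψ : ψ ≠ 0)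
    (u : Ultradistribution t s d) {G : Rn d × Rn d → ℂ} (hG : Admissible t s G) :
    u (synth ht hs ψ hG) = ∫ w, G w * u (conjShift ht hs ψ w) := by
  obtain ⟨F, R, hF, hFi, hu⟩ := exists_representation ht hs hψ u
  obtain ⟨h, C, hC, H⟩ := exists_analysis_bound ht hs ψ R
  obtain ⟨C', ν, hC', hν, H'⟩ := exists_conjShift_bound ht hs ψ h
  have hmeas : StronglyMeasurable fun p : (Rn d × Rn d) × (Rn d × Rn d) =>
      analysis ht hs ψ (conjShift ht hs ψ p.2) p.1 := by
    refine StronglyMeasurable.integral_prod_right'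
      (f := fun p : ((Rn d × Rn d) × (Rn d × Rn d)) × Rn d =>
        conjShift ht hs ψ p.1.2 p.2 * timeFreqShift ht hs p.1.1.1 p.1.1.2 ψ p.2) ?_
    exact (((continuous_conjShift ht hs ψ).comp
        (by fun_prop : Continuous fun p : ((Rn d × Rn d) × (Rn d × Rn d)) × Rn d => (p.1.2, p.2))).mul
      ((continuous_timeFreqShift ht hs ψ).comp (by fun_prop : Continuous fun
        p : ((Rn d × Rn d) × (Rn d × Rn d)) × Rn d => (p.1.1, p.2)))).stronglyMeasurable
  have hint : Integrable (Function.uncurry fun w' w : Rn d × Rn d =>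
      F w' * (G w * analysis ht hs ψ (conjShift ht hs ψ w) w')) (volume.prod volume) := by
    refine ((hFi.mul_prod (hG.2 ν)).const_mul (C * C')).mono' ?_
      (Filter.Eventually.of_forall fun p => ?_)
    · exact hF.comp_fst.mul (hG.1.comp_snd.mul hmeas.aestronglyMeasurable)
    · simp only [Function.uncurry, norm_mul]
      calc ‖F p.1‖ * (‖G p.2‖ * ‖analysis ht hs ψ (conjShift ht hs ψ p.2) p.1‖)
          ≤ ‖F p.1‖ * (‖G p.2‖ * (C * (C' * Real.exp (ν * aniso t s p.2)) *
            Real.exp (-(R * aniso t s p.1)))) := by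
            gcongr
            refine (H _ _).trans ?_
            gcongr
            exact H' _
        _ = _ := by ring
  rw [hu]
  calc _ = ∫ w', ∫ w, F w' * (G w * analysis ht hs ψ (conjShift ht hs ψ w) w') := by
        refine integral_congr_ae (Filter.Eventually.of_forall fun w' => ?_)
        simp only [analysis_synth ht hs ψ ψ hG]
        rw [integral_const_mul]
    _ = ∫ w, ∫ w', F w' * (G w * analysis ht hs ψ (conjShift ht hs ψ w) w') :=
        integral_integral_swap hint
    _ = _ := by
        refine integral_congr_ae (Filter.Eventually.of_forall fun w => ?_)
        simp only [hu, ← integral_const_mul]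
        refine integral_congr_ae (Filter.Eventually.of_forall fun w' => ?_)
        simp only
        ring

/-- The inversion formula in dual form: an ultradistribution is recovered from its values on the
conjugated shifts of one window. -/
theorem windowConst_mul_apply (ht : 0 < t) (hs : 0 < s) {ψ : Space t s d} (hψ : ψ ≠ 0)
    (u : Ultradistribution t s d) (f : Space t s d) :
    windowConst ψ * u f = ∫ w, analysis ht hs ψ f w * u (conjShift ht hs ψ w) := by
  rw [← apply_synth ht hs hψ u (admissible_analysis ht hs ψ f), synth_analysis, map_smul]
  rfl

theorem exists_apply_conjShift_bound (ht : 0 < t) (hs : 0 < s) (ψ : Space t s d)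
    (u : Ultradistribution t s d) : ∃ C ν : ℝ, 0 ≤ C ∧ 0 < ν ∧ ∀ w,
      ‖u (conjShift ht hs ψ w)‖ ≤ C * Real.exp (ν * aniso t s w) := by
  obtain ⟨h, C, hC, H⟩ := exists_ultradistribution_bound u
  obtain ⟨C', ν, hC', hν, H'⟩ := exists_conjShift_bound ht hs ψ h
  refine ⟨C * C', ν, by positivity, hν, fun w => (H _).trans ?_⟩
  rw [mul_assoc]
  exact mul_le_mul_of_nonneg_left (H' w) hC

end Representation

section WeylForm

variable {d : ℕ} {t s : ℝ} {a : Rn d × Rn d → ℂ}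

/-! ### The Weyl form -/

theorem IsSymbol.exists_bound (ha : IsSymbol t s a) :
    ∃ μ C : ℝ, 0 < μ ∧ 0 ≤ C ∧ ∀ X, ‖a X‖ ≤ C * Real.exp (μ * aniso t s X) := by
  obtain ⟨-, μ, hμ, H⟩ := ha
  obtain ⟨C, hC⟩ := H 1 one_pos
  have h0 : ∀ X, ‖a X‖ ≤ C * Real.exp (μ * aniso t s X) := fun X => by
    have := hC 0 0 X.1 X.2
    simpa [partialDeriv₂, multiDeriv_zero, msize_zero, mfact_zero, aniso] using this
  exact ⟨μ, C, hμ, nonneg_of_mul_nonneg_left ((norm_nonneg _).trans (h0 0)) (Real.exp_pos _), h0⟩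

theorem integrable_symbol_mul_crossT (ht : 0 < t) (hs : 0 < s) (ha : IsSymbol t s a)
    (f g : Space t s d) : Integrable fun X => a X * crossT f g X := by
  obtain ⟨μ, C, hμ, hC, H⟩ := ha.exists_bound
  obtain ⟨h, C', hC', H'⟩ := exists_crossT_space_bound (d := d) ht hs (μ + 1)
  refine ((integrable_exp_neg_aniso one_pos ht hs).const_mul
    (C * (C' * (gsSeminorm t s d h f * gsSeminorm t s d h g)))).mono' ?_
    (Filter.Eventually.of_forall fun X => ?_)
  · exact ha.1.continuous.aestronglyMeasurable.mul
      (stronglyMeasurable_crossT f.2.1.continuous g.2.1.continuous).aestronglyMeasurable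
  · rw [norm_mul]
    calc _ ≤ (C * Real.exp (μ * aniso t s X)) *
          (C' * (gsSeminorm t s d h f * gsSeminorm t s d h g) *
            Real.exp (-((μ + 1) * aniso t s X))) := by
          gcongr
          exacts [H X, H' f g X]
      _ = C * (C' * (gsSeminorm t s d h f * gsSeminorm t s d h g)) *
          (Real.exp (μ * aniso t s X) * Real.exp (-((μ + 1) * aniso t s X))) := by ring
      _ = _ := by
          rw [← Real.exp_add]
          congr 2
          ring

theorem expDecay_space (ht : 0 < t) (f : Space t s d) : ExpDecay t (f : Rn d → ℂ) := by
  obtain ⟨h, H⟩ := exists_lineBound (d := d) (s := s) ht 1 one_pos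
  exact (H f).expDecay one_pos

theorem crossT_add_left (ht : 0 < t) (f f' g : Space t s d) (X : Rn d × Rn d) :
    crossT (f + f' : Space t s d) g X = crossT f g X + crossT f' g X := by
  rw [crossT, crossT, crossT, ← integral_add
    ((expDecay_space ht f).integrable_cross ht (expDecay_space ht g) X)
    ((expDecay_space ht f').integrable_cross ht (expDecay_space ht g) X)]
  refine integral_congr_ae (Filter.Eventually.of_forall fun y => ?_)
  change (f _ + f' _) * _ * _ = _
  ring

theorem crossT_add_right (ht : 0 < t) (f g g' : Space t s d) (X : Rn d × Rn d) :
    crossT f (g + g' : Space t s d) X = crossT f g X + crossT f g' X := by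
  rw [crossT, crossT, crossT, ← integral_add
    ((expDecay_space ht f).integrable_cross ht (expDecay_space ht g) X)
    ((expDecay_space ht f).integrable_cross ht (expDecay_space ht g') X)]
  refine integral_congr_ae (Filter.Eventually.of_forall fun y => ?_)
  change _ * (g _ + g' _) * _ = _
  ring

theorem crossT_smul_left (c : ℂ) (f g : Space t s d) (X : Rn d × Rn d) :
    crossT (c • f : Space t s d) g X = c * crossT f g X := by
  rw [crossT, crossT, ← integral_const_mul]
  refine integral_congr_ae (Filter.Eventually.of_forall fun y => ?_)
  change (c * f _) * _ * _ = _
  ring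

theorem crossT_smul_right (c : ℂ) (f g : Space t s d) (X : Rn d × Rn d) :
    crossT f (c • g : Space t s d) X = c * crossT f g X := by
  rw [crossT, crossT, ← integral_const_mul]
  refine integral_congr_ae (Filter.Eventually.of_forall fun y => ?_)
  change _ * (c * g _) * _ = _
  ring

/-- The bilinear form `(φ, f) ↦ (a^w(x, D) f, \overline{φ})`. -/
def weylForm (ht : 0 < t) (hs : 0 < s) (ha : IsSymbol t s a) :
    Space t s d →ₗ[ℂ] Space t s d →ₗ[ℂ] ℂ :=
  LinearMap.mk₂ ℂ (fun φ f => (((2 * Real.pi) ^ (-(d : ℝ)) : ℝ) : ℂ) *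
      ∫ X, a X * crossT φ f X)
    (fun φ φ' f => by
      simp only [crossT_add_left ht, mul_add]
      rw [integral_add (integrable_symbol_mul_crossT ht hs ha φ f)
        (integrable_symbol_mul_crossT ht hs ha φ' f), mul_add])
    (fun c φ f => by
      simp only [crossT_smul_left, mul_left_comm _ c, smul_eq_mul]
      rw [integral_const_mul, mul_left_comm])
    (fun φ f f' => by
      simp only [crossT_add_right ht, mul_add]
      rw [integral_add (integrable_symbol_mul_crossT ht hs ha φ f)
        (integrable_symbol_mul_crossT ht hs ha φ f'), mul_add])
    (fun c φ f => by
      simp only [crossT_smul_right, mul_left_comm _ c, smul_eq_mul]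
      rw [integral_const_mul, mul_left_comm])

theorem weylForm_apply (ht : 0 < t) (hs : 0 < s) (ha : IsSymbol t s a) (φ f : Space t s d) :
    weylForm ht hs ha φ f =
      (((2 * Real.pi) ^ (-(d : ℝ)) : ℝ) : ℂ) * ∫ X, a X * crossT φ f X := rfl

theorem conj_conj (f : Space t s d) : conj (conj f) = f :=
  Subtype.ext (funext fun y => Complex.conj_conj (f y))

theorem conj_wigner (f g : Space t s d) (X : Rn d × Rn d) :
    starRingEnd ℂ (wigner g f X.1 X.2) = crossT (conj g) f X := by
  rw [wigner, crossT, ← integral_conj]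
  refine integral_congr_ae (Filter.Eventually.of_forall fun y => ?_)
  simp only [map_mul, conj_planeWave, neg_neg, Complex.conj_conj]
  rfl

/-- Replacing g by its conjugate removes all conjugations, because the conjugate of W(g,f) is the
bilinear transform of conj g and f. -/
theorem isWeylOperator_iff (ht : 0 < t) (hs : 0 < s) (ha : IsSymbol t s a)
    (A : Ultradistribution t s d →L[ℂ] Ultradistribution t s d) :
    IsWeylOperator a A ↔ ∀ f φ : Space t s d, A (ofFun f) φ = weylForm ht hs ha φ f := by
  have e : ∀ f g : Space t s d, (((2 * Real.pi) ^ (-(d : ℝ)) : ℝ) : ℂ) *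
      ∫ z : Rn d × Rn d, a z * starRingEnd ℂ (wigner g f z.1 z.2) =
      weylForm ht hs ha (conj g) f := fun f g => by
    rw [weylForm_apply]
    simp only [conj_wigner]
  constructor
  · intro H f φ
    have := H f (conj φ)
    rwa [e, pairing, conj_conj] at this
  · intro H f g
    rw [e, pairing]
    exact H f _

theorem timeFreqShift_zero (ht : 0 < t) (hs : 0 < s) (f : Space t s d) :
    timeFreqShift ht hs 0 0 f = f := by
  refine Subtype.ext (funext fun y => ?_)
  rw [timeFreqShift_apply]
  simp [planeWave]

theorem exists_weylForm_shift_bound (ht : 0 < t) (hs : 0 < s) (hst : 1 < s + t)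
    (ha : IsSymbol t s a) :
    ∃ μ' : ℝ, 0 < μ' ∧ ∀ r : ℝ, 0 < r → ∃ (h : {h : ℝ // 0 < h}) (C : ℝ), 0 ≤ C ∧
      ∀ (f g : Space t s d) (z w : Rn d × Rn d),
      ‖weylForm ht hs ha (timeFreqShift ht hs z.1 (-z.2) f) (timeFreqShift ht hs w.1 w.2 g)‖ ≤
        C * (gsSeminorm t s d h f * gsSeminorm t s d h g) *
          Real.exp (μ' * aniso t s z - r * aniso t s (z - w)) := by
  obtain ⟨μ', hμ', H⟩ := exists_kernel_bound a ht hs hst ha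
  refine ⟨μ', hμ', fun r hr => ?_⟩
  obtain ⟨h, C, hC, H'⟩ := H r hr
  have hpi : (0 : ℝ) ≤ (2 * Real.pi) ^ (-(d : ℝ)) := by positivity
  refine ⟨h, (2 * Real.pi) ^ (-(d : ℝ)) * C, by positivity, fun f g z w => ?_⟩
  rw [weylForm_apply, norm_mul, Complex.norm_real, Real.norm_eq_abs, abs_of_nonneg hpi]
  refine (mul_le_mul_of_nonneg_left (H' f g z w) hpi).trans (le_of_eq ?_)
  ring

/-- At z = 0 the growth along the diagonal disappears and only the decay in w remains. -/
theorem exists_weylForm_window_bound (ht : 0 < t) (hs : 0 < s) (hst : 1 < s + t)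
    (ha : IsSymbol t s a) {r : ℝ} (hr : 0 < r) :
    ∃ (h : {h : ℝ // 0 < h}) (C : ℝ), 0 ≤ C ∧ ∀ (f g : Space t s d) (w : Rn d × Rn d),
      ‖weylForm ht hs ha f (timeFreqShift ht hs w.1 w.2 g)‖ ≤
        C * (gsSeminorm t s d h f * gsSeminorm t s d h g) * Real.exp (-(r * aniso t s w)) := by
  obtain ⟨μ', -, H⟩ := exists_weylForm_shift_bound (d := d) ht hs hst ha
  obtain ⟨h, C, hC, H'⟩ := H r hr
  refine ⟨h, C, hC, fun f g w => ?_⟩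
  have := H' f g 0 w
  simpa [timeFreqShift_zero, aniso_zero ht hs, aniso_neg] using this

/-- A linear functional that is bounded by one of the seminorms, as an ultradistribution. -/
def ultradistributionOfBound (L : Space t s d →ₗ[ℂ] ℂ)
    (hL : ∃ (h : {h : ℝ // 0 < h}) (C : ℝ), 0 ≤ C ∧ ∀ f, ‖L f‖ ≤ C * gsSeminorm t s d h f) :
    Ultradistribution t s d :=
  StrongDual.toWeakDual (⟨L, by
    obtain ⟨h, C, hC, H⟩ := hL
    refine WithSeminorms.continuous_normedSpace_rng ℂ space_withSeminorms L
      ⟨{h}, ⟨C, hC⟩, fun g => ?_⟩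
    simp only [Finset.sup_singleton]
    exact H g⟩ : StrongDual ℂ (Space t s d))

/-- The ultradistribution `f ↦ (a^w(x, D) f, \overline{φ})`. -/
def weylFunctional (ht : 0 < t) (hs : 0 < s) (hst : 1 < s + t) (ha : IsSymbol t s a)
    (φ : Space t s d) : Ultradistribution t s d :=
  ultradistributionOfBound (weylForm ht hs ha φ) (by
    obtain ⟨h, C, hC, H⟩ := exists_weylForm_window_bound (d := d) ht hs hst ha one_pos
    have := gsSeminorm_nonneg h φ
    refine ⟨h, C * gsSeminorm t s d h φ, by positivity, fun f => ?_⟩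
    have := H φ f 0
    simpa [timeFreqShift_zero, aniso_zero ht hs, mul_assoc] using this)

theorem stronglyMeasurable_weylForm_window (ht : 0 < t) (hs : 0 < s) (ha : IsSymbol t s a)
    (φ ψ : Space t s d) : StronglyMeasurable fun w : Rn d × Rn d =>
      weylForm ht hs ha φ (timeFreqShift ht hs w.1 w.2 ψ) := by
  simp only [weylForm_apply]
  have h1 : StronglyMeasurable fun p : (Rn d × Rn d) × (Rn d × Rn d) =>
      crossT φ (timeFreqShift ht hs p.1.1 p.1.2 ψ) p.2 := by
    refine StronglyMeasurable.integral_prod_right'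
      (f := fun p : ((Rn d × Rn d) × (Rn d × Rn d)) × Rn d =>
        φ (p.1.2.1 + (1 / 2 : ℝ) • p.2) * timeFreqShift ht hs p.1.1.1 p.1.1.2 ψ
          (p.1.2.1 - (1 / 2 : ℝ) • p.2) * planeWave p.1.2.2 p.2) ?_
    have c1 : Continuous fun p : ((Rn d × Rn d) × (Rn d × Rn d)) × Rn d =>
        planeWave p.1.2.2 p.2 :=
      continuous_planeWave_uncurry.comp (continuous_fst.snd.snd.prodMk continuous_snd)
    have c2 : Continuous fun p : ((Rn d × Rn d) × (Rn d × Rn d)) × Rn d =>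
        (p.1.1, p.1.2.1 - (1 / 2 : ℝ) • p.2) := by fun_prop
    have c3 := (continuous_timeFreqShift ht hs ψ).comp c2
    have c4 := φ.2.1.continuous
    have c5 : Continuous fun p : ((Rn d × Rn d) × (Rn d × Rn d)) × Rn d =>
        φ (p.1.2.1 + (1 / 2 : ℝ) • p.2) := by fun_prop
    exact ((c5.mul c3).mul c1).stronglyMeasurable
  have h2 : StronglyMeasurable fun p : (Rn d × Rn d) × (Rn d × Rn d) => a p.2 :=
    (ha.1.continuous.comp continuous_snd).stronglyMeasurable
  exact ((h2.mul h1).integral_prod_right').const_mul _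

theorem admissible_weylForm (ht : 0 < t) (hs : 0 < s) (hst : 1 < s + t) (ha : IsSymbol t s a)
    (ψ φ : Space t s d) : Admissible t s fun w : Rn d × Rn d =>
      weylForm ht hs ha φ (timeFreqShift ht hs w.1 w.2 ψ) := by
  refine admissible_of_bound ht hs
    (stronglyMeasurable_weylForm_window ht hs ha φ ψ).aestronglyMeasurable fun r => ?_
  obtain ⟨h, C, hC, H⟩ := exists_weylForm_window_bound (d := d) ht hs hst ha
    (r := max r 1) (by positivity)
  refine ⟨C * (gsSeminorm t s d h φ * gsSeminorm t s d h ψ), fun w => (H φ ψ w).trans ?_⟩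
  have := gsSeminorm_nonneg h φ
  have := gsSeminorm_nonneg h ψ
  refine mul_le_mul_of_nonneg_left (Real.exp_le_exp.2 (neg_le_neg ?_)) (by positivity)
  exact mul_le_mul_of_nonneg_right (le_max_left _ _) (aniso_nonneg w)

theorem continuous_of_gsSeminorm_bound (L : Space t s d →ₗ[ℂ] Space t s d)
    (H : ∀ h, ∃ (h' : {h : ℝ // 0 < h}) (C : ℝ), 0 ≤ C ∧
      ∀ f, gsSeminorm t s d h (L f) ≤ C * gsSeminorm t s d h' f) : Continuous L := by
  refine WithSeminorms.continuous_of_isBounded space_withSeminorms space_withSeminorms L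
    fun h => ?_
  obtain ⟨h', C, hC, H'⟩ := H h
  refine ⟨{h'}, ⟨C, hC⟩, fun f => ?_⟩
  simp only [Finset.sup_singleton]
  exact H' f

/-- The linear map underlying `weylTranspose`. -/
def weylTransposeLinear (ht : 0 < t) (hs : 0 < s) (hst : 1 < s + t) (ha : IsSymbol t s a)
    (ψ : Space t s d) : Space t s d →ₗ[ℂ] Space t s d where
  toFun φ := synth ht hs ψ (admissible_weylForm ht hs hst ha ψ φ)
  map_add' φ φ' := by
    refine Subtype.ext (funext fun y => ?_)
    refine Eq.trans ?_ (integral_add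
      ((admissible_weylForm ht hs hst ha ψ φ).integrable_mul_conjShift ht hs ψ y)
      ((admissible_weylForm ht hs hst ha ψ φ').integrable_mul_conjShift ht hs ψ y))
    refine integral_congr_ae (Filter.Eventually.of_forall fun w => ?_)
    simp only [map_add, LinearMap.add_apply, add_mul]
  map_smul' c φ := by
    refine Subtype.ext (funext fun y => ?_)
    refine Eq.trans ?_ (integral_const_mul c _)
    refine integral_congr_ae (Filter.Eventually.of_forall fun w => ?_)
    simp only [map_smul, LinearMap.smul_apply, smul_eq_mul, mul_assoc]

/-- The transpose of `windowConst ψ • a^w(x, D)`, expressed through the window `ψ`. -/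
def weylTranspose (ht : 0 < t) (hs : 0 < s) (hst : 1 < s + t) (ha : IsSymbol t s a)
    (ψ : Space t s d) : Space t s d →L[ℂ] Space t s d where
  toLinearMap := weylTransposeLinear ht hs hst ha ψ
  cont := by
    refine continuous_of_gsSeminorm_bound (weylTransposeLinear ht hs hst ha ψ) fun h => ?_
    obtain ⟨C, ν, hC, hν, H⟩ := exists_synth_bound ht hs ψ h
    -- Rate ν for the weight in the synthesis bound, and one more unit for integrability.
    obtain ⟨h', C', hC', H'⟩ := exists_weylForm_window_bound (d := d) ht hs hst ha
      (r := ν + 1) (by positivity)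
    have hI := integrable_exp_neg_aniso (d := d) one_pos ht hs
    set I := ∫ w : Rn d × Rn d, Real.exp (-(1 * aniso t s w))
    have hI0 : 0 ≤ I := integral_nonneg fun _ => (Real.exp_pos _).le
    have hψ := gsSeminorm_nonneg h' ψ
    refine ⟨h', C * (C' * gsSeminorm t s d h' ψ * I), by positivity, fun φ =>
      (H _ (admissible_weylForm ht hs hst ha ψ φ)).trans ?_⟩
    rw [mul_assoc]
    refine mul_le_mul_of_nonneg_left ?_ hC
    have e : C' * gsSeminorm t s d h' ψ * I * gsSeminorm t s d h' φ =
        ∫ w : Rn d × Rn d, C' * (gsSeminorm t s d h' φ * gsSeminorm t s d h' ψ) *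
          Real.exp (-(1 * aniso t s w)) := by
      rw [integral_const_mul]; ring
    rw [e]
    refine integral_mono ((admissible_weylForm ht hs hst ha ψ φ).2 ν) (hI.const_mul _) fun w => ?_
    have := gsSeminorm_nonneg h' φ
    calc _ ≤ Real.exp (ν * aniso t s w) * (C' * (gsSeminorm t s d h' φ * gsSeminorm t s d h' ψ) *
          Real.exp (-((ν + 1) * aniso t s w))) := by
          gcongr; exact H' φ ψ w
      _ = C' * (gsSeminorm t s d h' φ * gsSeminorm t s d h' ψ) *
          (Real.exp (ν * aniso t s w) * Real.exp (-((ν + 1) * aniso t s w))) := by ring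
      _ = _ := by
          rw [← Real.exp_add]
          congr 2
          ring

/-- The transpose of a continuous operator on `Σ_t^s`, acting on ultradistributions. -/
def transposeL (B : Space t s d →L[ℂ] Space t s d) :
    Ultradistribution t s d →L[ℂ] Ultradistribution t s d where
  toFun u := StrongDual.toWeakDual ((WeakDual.toStrongDual u).comp B)
  map_add' _ _ := rfl
  map_smul' _ _ := rfl
  cont := WeakDual.continuous_of_continuous_eval fun φ => WeakDual.eval_continuous (B φ)

/-- The Weyl operator on ultradistributions, expressed through the window `ψ`. -/
def weylOperator (ht : 0 < t) (hs : 0 < s) (hst : 1 < s + t) (ha : IsSymbol t s a)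
    (ψ : Space t s d) : Ultradistribution t s d →L[ℂ] Ultradistribution t s d :=
  transposeL ((windowConst ψ : ℂ)⁻¹ • weylTranspose ht hs hst ha ψ)

/-- The phase-space form of the operator: taking for φ a conjugated shift exhibits the transform of
the image as an integral operator applied to the transform of u. -/
theorem weylOperator_apply (ht : 0 < t) (hs : 0 < s) (hst : 1 < s + t) (ha : IsSymbol t s a)
    {ψ : Space t s d} (hψ : ψ ≠ 0) (u : Ultradistribution t s d) (φ : Space t s d) :
    weylOperator ht hs hst ha ψ u φ = (windowConst ψ : ℂ)⁻¹ *
      ∫ w : Rn d × Rn d, weylForm ht hs ha φ (timeFreqShift ht hs w.1 w.2 ψ) *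
        u (conjShift ht hs ψ w) := by
  rw [← apply_synth ht hs hψ u (admissible_weylForm ht hs hst ha ψ φ)]
  exact (WeakDual.toStrongDual u).map_smul _ _

theorem windowConst_conj (ψ : Space t s d) : windowConst (conj ψ) = windowConst ψ := by
  have : ∀ y, ‖conj ψ y‖ = ‖ψ y‖ := fun y => Complex.norm_conj _
  simp only [windowConst, this]

theorem conj_ne_zero {ψ : Space t s d} (hψ : ψ ≠ 0) : conj ψ ≠ 0 := fun h => hψ <| by
  have h1 := congrArg conj h
  rw [conj_conj] at h1
  rw [h1]
  exact Subtype.ext (funext fun y => map_zero (starRingEnd ℂ))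

theorem integral_neg_snd (F : Rn d × Rn d → ℂ) : ∫ w : Rn d × Rn d, F (w.1, -w.2) = ∫ w, F w := by
  have hmp : MeasurePreserving
      ((MeasurableEquiv.refl (Rn d)).prodCongr (MeasurableEquiv.neg (Rn d))) :=
    (MeasurePreserving.id volume).prod (Measure.measurePreserving_neg volume)
  exact hmp.integral_comp' F

theorem isWeylOperator_weylOperator (ht : 0 < t) (hs : 0 < s) (hst : 1 < s + t)
    (ha : IsSymbol t s a) {ψ : Space t s d} (hψ : ψ ≠ 0) :
    IsWeylOperator a (weylOperator ht hs hst ha ψ) := by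
  rw [isWeylOperator_iff ht hs ha]
  intro f φ
  have hc : (windowConst ψ : ℂ) ≠ 0 := by exact_mod_cast (windowConst_pos hψ).ne'
  rw [weylOperator_apply ht hs hst ha hψ, inv_mul_eq_iff_eq_mul₀ hc]
  -- The dual inversion formula is applied to the functional f ↦ `weylForm` φ f with the conjugate
  -- window. Conjugating the window reverses the frequency, and the reflection ξ ↦ -ξ below restores
  -- the original shifts.
  have key := windowConst_mul_apply ht hs (conj_ne_zero hψ) (weylFunctional ht hs hst ha φ) f
  rw [windowConst_conj] at key
  refine Eq.trans ?_ key.symm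
  rw [← integral_neg_snd]
  refine integral_congr_ae (Filter.Eventually.of_forall fun w => ?_)
  simp only [conjShift_eq, conj_conj, neg_neg]
  rw [mul_comm]
  rfl

/-- An operator on ultradistributions is determined by its restriction to `Σ_t^s`. -/
theorem weakDual_ext {A A' : Ultradistribution t s d →L[ℂ] Ultradistribution t s d}
    (H : ∀ f : Space t s d, A (ofFun f) = A' (ofFun f)) : A = A' := by
  refine ContinuousLinearMap.ext fun u => DFunLike.ext _ _ fun φ => ?_
  -- A weak* continuous functional is evaluation at some test function χ. If it vanishes on the
  -- embedded test functions, testing on the conjugate of χ gives ∫ |χ|² = 0.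
  obtain ⟨χ, hχ⟩ := LinearMap.dualEmbedding_surjective (topDualPairing ℂ (Space t s d))
    (((⟨⟨⟨fun v : Ultradistribution t s d => v φ, fun _ _ => rfl⟩, fun _ _ => rfl⟩,
      WeakDual.eval_continuous φ⟩ : Ultradistribution t s d →L[ℂ] ℂ)).comp (A - A'))
  have hv : ∀ v : Ultradistribution t s d, v χ = A v φ - A' v φ := fun v =>
    congrArg (fun L => L v) hχ
  have hχ0 : χ = 0 := by
    by_contra hne
    have h1 := windowConst_pos hne
    have h2 := hv (ofFun (conj χ))
    rw [H, sub_self] at h2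
    have h3 : ∫ y, conj χ y * χ y = 0 := h2
    have h4 : ∀ y, conj χ y * χ y = ((‖χ y‖ ^ 2 : ℝ) : ℂ) := fun y => by
      push_cast
      exact Complex.conj_mul' _
    simp only [h4] at h3
    rw [integral_complex_ofReal, Complex.ofReal_eq_zero] at h3
    rw [windowConst, h3, mul_zero] at h1
    exact lt_irrefl _ h1
  have := hv u
  rw [hχ0, map_zero] at this
  exact sub_eq_zero.1 this.symm

theorem existsUnique_weylOperator (ht : 0 < t) (hs : 0 < s) (hst : 1 < s + t)
    (ha : IsSymbol t s a) :
    ∃! A : Ultradistribution t s d →L[ℂ] Ultradistribution t s d, IsWeylOperator a A := by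
  refine existsUnique_of_exists_of_unique ?_ fun A A' hA hA' => weakDual_ext fun f => ?_
  -- The construction needs a nonzero window. If there were none, the test space would be trivial
  -- and the zero operator would satisfy the identity.
  · by_cases h : ∃ ψ : Space t s d, ψ ≠ 0
    · obtain ⟨ψ, hψ⟩ := h
      exact ⟨_, isWeylOperator_weylOperator ht hs hst ha hψ⟩
    · push Not at h
      refine ⟨0, (isWeylOperator_iff ht hs ha 0).2 fun f φ => ?_⟩
      rw [h f, map_zero]
      rfl
  · rw [isWeylOperator_iff ht hs ha] at hA hA'
    exact DFunLike.ext _ _ fun φ => (hA f φ).trans (hA' f φ).symm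

end WeylForm

section Microlocal

variable {d : ℕ} {t s : ℝ} {a : Rn d × Rn d → ℂ}

/-! ### Microlocality -/

variable (t s) in
/-- The anisotropic dilation of phase space. -/
def anisoDilate (l : ℝ) (w : Rn d × Rn d) : Rn d × Rn d := (l ^ t • w.1, l ^ s • w.2)

theorem aniso_anisoDilate (ht : 0 < t) (hs : 0 < s) {l : ℝ} (hl : 0 < l) (w : Rn d × Rn d) :
    aniso t s (anisoDilate t s l w) = l * aniso t s w :=
  aniso_scale ht hs hl w.1 w.2

theorem anisoDilate_sub (l : ℝ) (z w : Rn d × Rn d) :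
    anisoDilate t s l z - anisoDilate t s l w = anisoDilate t s l (z - w) := by
  simp [anisoDilate, smul_sub]

theorem exists_anisoDilate_eq {l : ℝ} (hl : 0 < l) (w : Rn d × Rn d) :
    ∃ w', anisoDilate t s l w' = w := by
  refine ⟨((l ^ t)⁻¹ • w.1, (l ^ s)⁻¹ • w.2), ?_⟩
  simp [anisoDilate, smul_smul, (Real.rpow_pos_of_pos hl _).ne']

theorem aniso_le_of_norm_le (ht : 0 < t) (hs : 0 < s) {ρ : ℝ} {w : Rn d × Rn d} (hw : ‖w‖ ≤ ρ) :
    aniso t s w ≤ ρ ^ (1 / t) + ρ ^ (1 / s) :=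
  add_le_add
    (Real.rpow_le_rpow (norm_nonneg _) ((norm_fst_le w).trans hw) (one_div_nonneg.2 ht.le))
    (Real.rpow_le_rpow (norm_nonneg _) ((norm_snd_le w).trans hw) (one_div_nonneg.2 hs.le))

theorem le_aniso_of_le_norm (ht : 0 < t) (hs : 0 < s) {δ : ℝ} (hδ : 0 ≤ δ) {w : Rn d × Rn d}
    (hw : δ ≤ ‖w‖) : min (δ ^ (1 / t)) (δ ^ (1 / s)) ≤ aniso t s w := by
  rw [Prod.norm_def, le_max_iff] at hw
  have h1 : 0 ≤ ‖w.1‖ ^ (1 / t) := by positivity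
  have h2 : 0 ≤ ‖w.2‖ ^ (1 / s) := by positivity
  rcases hw with hw | hw
  · have := Real.rpow_le_rpow hδ hw (one_div_nonneg.2 ht.le)
    exact (min_le_left _ _).trans (this.trans (le_add_of_nonneg_right h2))
  · have := Real.rpow_le_rpow hδ hw (one_div_nonneg.2 hs.le)
    exact (min_le_right _ _).trans (this.trans (le_add_of_nonneg_left h1))

/-- Integral operators whose kernel decays off the diagonal preserve superexponential decay along
the anisotropic dilations near a point. -/
theorem exists_isOpen_decay_integral (ht : 0 < t) (hs : 0 < s)
    {K : Rn d × Rn d → Rn d × Rn d → ℂ} {V : Rn d × Rn d → ℂ} {μ CV ν : ℝ} (hμ : 0 ≤ μ)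
    (hCV : 0 ≤ CV) (hν : 0 ≤ ν)
    (hK : ∀ r : ℝ, 0 < r → ∃ C : ℝ, 0 ≤ C ∧ ∀ z w,
      ‖K z w‖ ≤ C * Real.exp (μ * aniso t s z - r * aniso t s (z - w)))
    (hV : ∀ w, ‖V w‖ ≤ CV * Real.exp (ν * aniso t s w)) {U : Set (Rn d × Rn d)} (hU : IsOpen U)
    (hdecay : ∀ r : ℝ, 0 < r → ∃ C : ℝ, ∀ l : ℝ, 0 < l → ∀ w ∈ U,
      Real.exp (r * l) * ‖V (anisoDilate t s l w)‖ ≤ C) {z₀ : Rn d × Rn d} (hz₀ : z₀ ∈ U) :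
    ∃ U' : Set (Rn d × Rn d), IsOpen U' ∧ U' ⊆ U ∧ z₀ ∈ U' ∧
      ∀ r : ℝ, 0 < r → ∃ C : ℝ, ∀ l : ℝ, 0 < l → ∀ z ∈ U',
        Real.exp (r * l) * ‖∫ w, K (anisoDilate t s l z) w * V w‖ ≤ C := by
  obtain ⟨η, hη, hball⟩ := Metric.isOpen_iff.1 hU z₀ hz₀
  -- With z in the half ball, every w outside U is at distance at least δ from z, hence at gauge
  -- distance at least ε.
  set δ := η / 2 with hδ
  have hδ0 : 0 < δ := half_pos hη
  set ε := min (δ ^ (1 / t)) (δ ^ (1 / s)) with hε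
  have hε0 : 0 < ε := lt_min (by positivity) (by positivity)
  set ρ := ‖z₀‖ + δ with hρ
  set M := ρ ^ (1 / t) + ρ ^ (1 / s) with hM
  have hM0 : 0 ≤ M := by positivity
  set c := anisoC t s with hc
  have hc1 : 1 ≤ c := one_le_anisoC ht hs
  refine ⟨Metric.ball z₀ δ, Metric.isOpen_ball,
    (Metric.ball_subset_ball (by linarith)).trans hball, Metric.mem_ball_self hδ0, fun r hr => ?_⟩
  have hfar : ∀ z ∈ Metric.ball z₀ δ, ∀ w ∉ U, ε ≤ aniso t s (z - w) := by
    intro z hz w hw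
    refine le_aniso_of_le_norm ht hs hδ0.le ?_
    by_contra! hlt
    refine hw (hball ?_)
    rw [← dist_eq_norm] at hlt
    rw [Metric.mem_ball] at hz ⊢
    have := dist_triangle w z z₀
    rw [dist_comm w z] at this
    linarith
  have hnear : ∀ z ∈ Metric.ball z₀ δ, aniso t s z ≤ M := by
    intro z hz
    refine aniso_le_of_norm_le ht hs ?_
    rw [Metric.mem_ball, dist_eq_norm] at hz
    have := norm_add_le (z - z₀) z₀
    rw [sub_add_cancel] at this
    linarith
  -- Outside the dilated U the gauge distance is at least lε, so rate q there produces e^{-rl} and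
  -- cancels the growth of the kernel along the diagonal and the part of the growth of V charged to
  -- Z.
  set q := (r + μ * M + ν * c * M) / ε with hq
  have hq0 : 0 ≤ q := by positivity
  obtain ⟨C₁, hC₁, H₁⟩ := hK 1 one_pos
  -- The three summands serve integrability, the part of the growth of V charged to Z - w, and the
  -- decay in l.
  obtain ⟨C₂, hC₂, H₂⟩ := hK (1 + ν * c + q) (by positivity)
  obtain ⟨CU, HU⟩ := hdecay (r + μ * M) (by positivity)
  -- The point z₀ witnesses that the supremum bound is not vacuous.
  have hCU : 0 ≤ CU := le_trans (by positivity) (HU 1 one_pos z₀ hz₀)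
  set I := ∫ w : Rn d × Rn d, Real.exp (-(1 * aniso t s w)) with hI
  refine ⟨(C₁ * CU + C₂ * CV) * I, fun l hl z hz => ?_⟩
  set Z := anisoDilate t s l z with hZ
  have haZ : aniso t s Z ≤ l * M := by
    rw [hZ, aniso_anisoDilate ht hs hl]
    exact mul_le_mul_of_nonneg_left (hnear z hz) hl.le
  have hpt : ∀ w, ‖K Z w * V w‖ ≤ Real.exp (-(r * l)) * (C₁ * CU + C₂ * CV) *
      Real.exp (-(1 * aniso t s (Z - w))) := by
    intro w
    obtain ⟨w', rfl⟩ := exists_anisoDilate_eq (t := t) (s := s) hl w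
    set w := anisoDilate t s l w' with hw
    rw [norm_mul]
    -- In the dilated U, the decay of V at rate r + μM also compensates the growth of the kernel at
    -- Z, which is at most e^{μMl}; off-diagonal rate 1 suffices.
    by_cases hwU : w' ∈ U
    · have h1 := HU l hl w' hwU
      have h2 : ‖V w‖ ≤ CU * Real.exp (-((r + μ * M) * l)) := by
        rw [Real.exp_neg, ← div_eq_mul_inv, le_div_iff₀ (Real.exp_pos _), mul_comm]
        exact h1
      calc ‖K Z w‖ * ‖V w‖ ≤ (C₁ * Real.exp (μ * aniso t s Z - 1 * aniso t s (Z - w))) *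
            (CU * Real.exp (-((r + μ * M) * l))) := by
            gcongr
            exact H₁ _ _
        _ = C₁ * CU * Real.exp (μ * aniso t s Z - 1 * aniso t s (Z - w) + -((r + μ * M) * l)) := by
            rw [Real.exp_add]; ring
        _ ≤ C₁ * CU * Real.exp (-(r * l) + -(1 * aniso t s (Z - w))) := by
            refine mul_le_mul_of_nonneg_left (Real.exp_le_exp.2 ?_) (by positivity)
            have := mul_le_mul_of_nonneg_left haZ hμ
            linarith
        _ = Real.exp (-(r * l)) * (C₁ * CU) * Real.exp (-(1 * aniso t s (Z - w))) := by
            rw [Real.exp_add]; ring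
        _ ≤ _ := by
            gcongr
            exact le_add_of_nonneg_right (by positivity)
    -- Dilations are linear and scale the gauge by l, so the separation of z from the complement of
    -- U grows linearly in l.
    · have hA : l * ε ≤ aniso t s (Z - w) := by
        rw [hZ, hw, anisoDilate_sub, aniso_anisoDilate ht hs hl]
        exact mul_le_mul_of_nonneg_left (hfar z hz w' hwU) hl.le
      have hW : aniso t s w ≤ c * (aniso t s Z + aniso t s (Z - w)) := aniso_le_add_sub ht hs Z w
      have hqA : l * (r + μ * M + ν * c * M) ≤ q * aniso t s (Z - w) := by
        refine le_trans (le_of_eq ?_) (mul_le_mul_of_nonneg_left hA hq0)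
        rw [hq]
        field_simp
      calc ‖K Z w‖ * ‖V w‖ ≤
            (C₂ * Real.exp (μ * aniso t s Z - (1 + ν * c + q) * aniso t s (Z - w))) *
            (CV * Real.exp (ν * aniso t s w)) := by
            gcongr
            exacts [H₂ _ _, hV _]
        _ = C₂ * CV * Real.exp (μ * aniso t s Z - (1 + ν * c + q) * aniso t s (Z - w) +
            ν * aniso t s w) := by
            rw [Real.exp_add]; ring
        _ ≤ C₂ * CV * Real.exp (-(r * l) + -(1 * aniso t s (Z - w))) := by
            refine mul_le_mul_of_nonneg_left (Real.exp_le_exp.2 ?_) (by positivity)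
            have h1 := mul_le_mul_of_nonneg_left haZ hμ
            have h2 := mul_le_mul_of_nonneg_left hW hν
            have h3 := mul_le_mul_of_nonneg_left haZ (by positivity : 0 ≤ ν * c)
            linarith
        _ = Real.exp (-(r * l)) * (C₂ * CV) * Real.exp (-(1 * aniso t s (Z - w))) := by
            rw [Real.exp_add]; ring
        _ ≤ _ := by
            gcongr
            exact le_add_of_nonneg_left (by positivity)
  have hint := (integrable_exp_neg_aniso (d := d) one_pos ht hs).comp_sub_right Z
  simp only [aniso_sub_comm Z] at hpt
  have h1 := norm_integral_le_of_norm_le (hint.const_mul _) (Filter.Eventually.of_forall hpt)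
  rw [integral_const_mul,
    integral_sub_right_eq_self (fun w : Rn d × Rn d => Real.exp (-(1 * aniso t s w)))] at h1
  calc _ ≤ Real.exp (r * l) * (Real.exp (-(r * l)) * (C₁ * CU + C₂ * CV) * I) :=
        mul_le_mul_of_nonneg_left h1 (Real.exp_pos _).le
    _ = Real.exp (r * l) * Real.exp (-(r * l)) * ((C₁ * CU + C₂ * CV) * I) := by ring
    _ = _ := by rw [← Real.exp_add, add_neg_cancel, Real.exp_zero, one_mul]

theorem stft_eq (ht : 0 < t) (hs : 0 < s) (ψ : Space t s d) (u : Ultradistribution t s d)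
    (x ξ : Rn d) : stft ht hs ψ u x ξ =
      (((2 * Real.pi) ^ (-(d : ℝ) / 2) : ℝ) : ℂ) * u (conjShift ht hs ψ (x, ξ)) := rfl

/-- Both windows enter only through constants in the kernel bound, so the output window φ is
independent of the window ψ used to expand the operator and to measure u. -/
theorem waveFrontSet_weylOperator_subset (ht : 0 < t) (hs : 0 < s) (hst : 1 < s + t)
    (ha : IsSymbol t s a) (φ : Space t s d) {ψ : Space t s d} (hψ : ψ ≠ 0)
    (u : Ultradistribution t s d) :
    waveFrontSet ht hs φ (weylOperator ht hs hst ha ψ u) ⊆ waveFrontSet ht hs ψ u := by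
  rintro z₀ ⟨hz₀, hnot⟩
  refine ⟨hz₀, fun ⟨U, hU, hU0, hzU, hdecay⟩ => hnot ?_⟩
  have hκ : (0 : ℝ) < (2 * Real.pi) ^ (-(d : ℝ) / 2) := by positivity
  set κ : ℝ := (2 * Real.pi) ^ (-(d : ℝ) / 2) with hκdef
  obtain ⟨CV, ν, hCV, hν, hV⟩ := exists_apply_conjShift_bound ht hs ψ u
  obtain ⟨μ, hμ, hK⟩ := exists_weylForm_shift_bound (d := d) ht hs hst ha
  -- The kernel is the Weyl form at conjugated shifts of φ and shifts of ψ. Conjugation supplies the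
  -- reversed frequency for which the off-diagonal bound is stated.
  obtain ⟨U', hU', hUU', hzU', H⟩ := exists_isOpen_decay_integral ht hs
    (K := fun z w => weylForm ht hs ha (conjShift ht hs φ z) (timeFreqShift ht hs w.1 w.2 ψ))
    (V := fun w => u (conjShift ht hs ψ w)) hμ.le hCV hν.le (fun r hr => by
      obtain ⟨h, C, hC, H⟩ := hK r hr
      have h1 := gsSeminorm_nonneg h (conj φ)
      have h2 := gsSeminorm_nonneg h ψ
      refine ⟨C * (gsSeminorm t s d h (conj φ) * gsSeminorm t s d h ψ), by positivity,
        fun z w => ?_⟩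
      rw [conjShift_eq]
      exact H _ _ z w) hV hU (fun r hr => by
      obtain ⟨C, hC⟩ := hdecay r hr
      refine ⟨κ⁻¹ * C, fun l hl w hw => ?_⟩
      have := hC l hl w.1 w.2 hw
      rw [stft_eq, norm_mul, Complex.norm_real, Real.norm_eq_abs, abs_of_pos hκ,
        mul_left_comm] at this
      rwa [← div_eq_inv_mul, le_div_iff₀ hκ, mul_comm]) hzU
  refine ⟨U', hU', hUU'.trans hU0, hzU', fun r hr => ?_⟩
  obtain ⟨C, hC⟩ := H r hr
  have hc := windowConst_pos hψ
  refine ⟨κ * ((windowConst ψ)⁻¹ * C), fun l hl x ξ hx => ?_⟩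
  rw [stft_eq, weylOperator_apply ht hs hst ha hψ, norm_mul, norm_mul, norm_inv, Complex.norm_real,
    Complex.norm_real, Real.norm_eq_abs, Real.norm_eq_abs, abs_of_pos hκ, abs_of_pos hc,
    mul_left_comm, mul_left_comm (Real.exp _)]
  have := hC l hl (x, ξ) hx
  gcongr
  exact this

end Microlocal

end GelfandShilov

end

/-! ### The Weyl operator on ultradistributions and its microlocality. -/

theorem theorem6p1 {d : ℕ} {s t : ℝ} (hs : 0 < s) (ht : 0 < t) (hst : 1 < s + t)
    (a : GelfandShilov.Rn d × GelfandShilov.Rn d → ℂ) (ha : GelfandShilov.IsSymbol t s a) :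
    (∃! A : GelfandShilov.Ultradistribution t s d →L[ℂ] GelfandShilov.Ultradistribution t s d,
      GelfandShilov.IsWeylOperator a A) ∧
    ∀ A : GelfandShilov.Ultradistribution t s d →L[ℂ] GelfandShilov.Ultradistribution t s d,
      GelfandShilov.IsWeylOperator a A →
      ∀ φ ψ : GelfandShilov.Space t s d, φ ≠ 0 → ψ ≠ 0 →
      ∀ u : GelfandShilov.Ultradistribution t s d,
        GelfandShilov.waveFrontSet ht hs φ (A u) ⊆ GelfandShilov.waveFrontSet ht hs ψ u := by
  have hex := GelfandShilov.existsUnique_weylOperator ht hs hst ha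
  refine ⟨hex, fun A hA φ ψ _ hψ u => ?_⟩
  -- By uniqueness the operator may be expanded with the very window that measures u.
  rw [hex.unique hA (GelfandShilov.isWeylOperator_weylOperator ht hs hst ha hψ)]
  exact GelfandShilov.waveFrontSet_weylOperator_subset ht hs hst ha φ hψ u
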